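/- Let $L>0$, let $f:\mathbb R\to\mathbb R$ be smooth with primitive $W(y)=\int_0^y f$, and let $\theta:\mathbb R\to\mathbb R$ be even and continuous with $\upsilon_1|\kappa|^m\le\theta(\kappa)\le\upsilon_2|\kappa|^m$ for $|\kappa|\ge\kappa_0$, where $m>0$ and $\upsilon_1,\upsilon_2>0$. All functions are real and $L$-periodic in $x$; $\hat g(k)=\frac1L\int_0^L g(x)e^{-2\pi i kx/L}dx$, $\|g\|_s^2=L\sum_{k\in\mathbb Z}(1+k^2)^s|\hat g(k)|^2$, $(g,h)=\int_0^L gh\,dx$, $\|g\|=\|g\|_0$, and $H^s=H^s_{per}([0,L])$ is the space of $g\in L^2$ with $\|g\|_s<\infty$ ($s\ge 0$). The operator $\mathcal M$ is defined by $\widehat{\mathcal Mg}(k)=\theta(k)\hat g(k)$. Consider $$u_t+(f(u))_x-(\mathcal Mu)_x=0. \qquad (1)$$ A global solution in $H^s$ with datum $u_0\in H^s$ is $u\in C([0,\infty);H^s)$ with $u(0)=u_0$ and $f(u(t))\in L^1$ for all $t\ge0$ that satisfies (1), integrated in time, in the sense of periodic distributions (the Fourier coefficients of $f(u(t))$ being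 locally integrable in $t$). Problem (1) is globally well-posed in $H^s$ if each datum in $H^s$ has exactly one global solution, the solution depends continuously on the datum (from $H^s$ to $C([0,T];H^s)$ for every $T>0$), and regularity persists: if $u_0$ lies in $H^r$ for all $r\ge s$, then $u\in C([0,\infty);H^r)$ for all $r\ge s$. Assume: * (Well-posedness) (1) is globally well-posed in $H^s$ for some $s\ge m/2$. * (Energy) If $m\le1$: $W(u)\in L^1$ for all $u\in H^{m/2}$ and $u\mapsto\int_0^LW(u)\,dx$ is of class $C^2$ on $H^{m/2}$. (No assumption if $m>1$.) * (Surface of waves) $O\subset\mathbb R^2$ is open and $(\omega,A)\mapsto\phi_{(\omega,A)}$ is smooth from $O$ to $C^\infty_{per}([0,L])$ (that is, $\phi_{(\omega,A)}(x)$ is a $C^\infty$ function of $(\omega,A,x)\in O\times\mathbb R$, $L$-periodic in $x$). For each $(\omega,A)\in O$, $\phi=\phi_{(\omega,A)}$ satisfies $\mathcal M\phi+\omega\phi-f(\phi)+A=0$, and the operator $\mathcal L=\mathcal M+\omega-f'(\phi)$ on $L^2$ with domain $H^m$ has exactly one negative eigenvalue, which is simple, while $0$ is a simple eigenvalue with eigenfunction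 $\phi'$ (in particular $\phi'\not\equiv0$). Fix $(\omega,A)\in O$, write $\phi=\phi_{(\omega,A)}$, and assume also: * (Gårding inequality) there are $c_1,c_2>0$ with $(\mathcal Lv,v)\ge c_1\|v\|_{m/2}^2-c_2\|v\|^2$ for all $v\in C^\infty_{per}([0,L])$. Define, at $(\omega,A)$, $$M_\omega=\int_0^L\partial_\omega\phi\,dx,\quad M_A=\int_0^L\partial_A\phi\,dx,\quad F_\omega=\tfrac12\int_0^L\partial_\omega(\phi^2)\,dx,\quad F_A=\tfrac12\int_0^L\partial_A(\phi^2)\,dx,$$ $$\Delta(a,b)=a^2M_A+ab(M_\omega+F_A)+b^2F_\omega .$$ Call $\phi$ orbitally stable if for every $\varepsilon>0$ there is $\delta>0$ such that for every $u_0\in H^s$ with $\|u_0-\phi\|_{m/2}<\delta$ the solution $u$ of (1) with datum $u_0$ exists for all $t\ge0$ and satisfies $\inf_{q\in\mathbb R}\|u(t)-\phi(\cdot+q)\|_{m/2}<\varepsilon$ for all $t\ge0$. Then: 1. If $\Delta(a,b)>0$ for some $(a,b)\in\mathbb R^2$, then $\phi$ is orbitally stable. 2. In particular, $\phi$ is orbitally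 stable if $M_A>0$, or if $F_\omega>0$, or if $M_\omega^2-F_\omega M_A>0$. 3. $F_A=M_\omega$. Moreover, there are unique $g,h\in H^m$ orthogonal in $L^2$ to $\phi'$ with $\mathcal Lg=1$ and $\mathcal Lh=\phi$ (written $g=\mathcal L^{-1}1$, $h=\mathcal L^{-1}\phi$), and $M_A=-(\mathcal L^{-1}1,1)$, $F_\omega=-(\mathcal L^{-1}\phi,\phi)$, $M_\omega=-(\mathcal L^{-1}\phi,1)$. -/

import Mathlib

open MeasureTheory Set

noncomputable section

namespace PeriodicWaves

/-! ### Fourier coefficients and periodic Sobolev spaces -/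

/-- Real square-integrable functions on one period `(0, L]` (modulo null sets). -/
abbrev L2per (L : ℝ) : Type := Lp ℝ 2 (volume.restrict (Ioc (0 : ℝ) L))

/-- The `k`-th Fourier coefficient `(1/L) ∫₀ᴸ g(x) e^{-2πikx/L} dx`. Only the values of `g` on
`(0, L]` matter, so the definition serves periodic functions and elements of `L2per L` alike. -/
def coeff (L : ℝ) (g : ℝ → ℝ) (k : ℤ) : ℂ :=
  (1 / (L : ℂ)) * ∫ x in (0 : ℝ)..L,
    (g x : ℂ) * Complex.exp (-(2 * Real.pi * Complex.I * k * x / L))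

/-- The norm of the periodic Sobolev space of order `r`,
`‖g‖_r² = L ∑ₖ (1 + k²)^r |ĝ(k)|²`; for `r = 0` it is the `L²` norm on `(0, L]`.
It is only used for functions for which the series converges. -/
def sobolevNorm (L r : ℝ) (g : ℝ → ℝ) : ℝ :=
  Real.sqrt (L * ∑' k : ℤ, (1 + (k : ℝ) ^ 2) ^ r * ‖coeff L g k‖ ^ 2)

theorem coeff_eq_fourierCoeffOn {L : ℝ} (hL : 0 < L) (g : ℝ → ℝ) (k : ℤ) :
    coeff L g k = fourierCoeffOn hL (fun x => (g x : ℂ)) k := by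
  rw [fourierCoeffOn_eq_integral, coeff]
  simp only [sub_zero, fourier_coe_apply, Complex.real_smul, smul_eq_mul]
  congr 1
  · push_cast
    rfl
  · refine intervalIntegral.integral_congr fun x _ => ?_
    rw [mul_comm]
    congr 2
    push_cast
    ring

theorem coeff_congr {L : ℝ} (hL : 0 < L) {g h : ℝ → ℝ}
    (hgh : g =ᵐ[volume.restrict (Ioc (0 : ℝ) L)] h) (k : ℤ) : coeff L g k = coeff L h k := by
  unfold coeff
  rw [intervalIntegral.integral_of_le hL.le, intervalIntegral.integral_of_le hL.le]
  congr 1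
  refine integral_congr_ae ?_
  filter_upwards [hgh] with x hx
  rw [hx]

theorem intervalIntegrable_coeff {L : ℝ} (hL : 0 < L) (u : L2per L) (k : ℤ) :
    IntervalIntegrable
      (fun x : ℝ => (u x : ℂ) * Complex.exp (-(2 * Real.pi * Complex.I * k * x / L)))
      volume 0 L := by
  have h1 : Integrable (u : ℝ → ℝ) (volume.restrict (Ioc (0 : ℝ) L)) :=
    (Lp.memLp u).integrable (by norm_num)
  rw [intervalIntegrable_iff_integrableOn_Ioc_of_le hL.le]
  refine Integrable.mul_bdd (c := 1) h1.ofReal (by fun_prop) ?_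
  refine Filter.Eventually.of_forall fun x => ?_
  have h : (-(2 * Real.pi * Complex.I * k * x / L) : ℂ)
      = ((-(2 * Real.pi * k * x / L) : ℝ) : ℂ) * Complex.I := by
    push_cast
    ring
  rw [h, Complex.norm_exp_ofReal_mul_I]

theorem coeff_add {L : ℝ} (hL : 0 < L) (u v : L2per L) (k : ℤ) :
    coeff L (u + v : L2per L) k = coeff L u k + coeff L v k := by
  rw [coeff_congr hL (Lp.coeFn_add u v) k]
  unfold coeff
  rw [← mul_add, ← intervalIntegral.integral_add (intervalIntegrable_coeff hL u k)
    (intervalIntegrable_coeff hL v k)]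
  congr 1
  refine intervalIntegral.integral_congr fun x _ => ?_
  simp only [Pi.add_apply]
  push_cast
  ring

theorem coeff_smul {L : ℝ} (hL : 0 < L) (c : ℝ) (u : L2per L) (k : ℤ) :
    coeff L (c • u : L2per L) k = (c : ℂ) * coeff L u k := by
  rw [coeff_congr hL (Lp.coeFn_smul c u) k]
  unfold coeff
  rw [mul_left_comm, ← intervalIntegral.integral_const_mul (c : ℂ)]
  congr 1
  refine intervalIntegral.integral_congr fun x _ => ?_
  simp only [Pi.smul_apply, smul_eq_mul]
  push_cast
  ring

theorem coeff_injective {L : ℝ} (hL : 0 < L) (u : L2per L) (h : ∀ k, coeff L u k = 0) :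
    u = 0 := by
  have hm : MemLp (fun x => ((u x : ℝ) : ℂ)) 2 (volume.restrict (Ioc (0 : ℝ) L)) :=
    (Lp.memLp u).ofReal
  have hs := hasSum_sq_fourierCoeffOn hL hm
  simp only [← coeff_eq_fourierCoeffOn hL, h, norm_zero, ne_eq, OfNat.ofNat_ne_zero,
    not_false_eq_true, zero_pow, sub_zero] at hs
  have h0 := hs.unique hasSum_zero
  rw [smul_eq_mul, mul_eq_zero, or_iff_right (inv_ne_zero hL.ne'),
    intervalIntegral.integral_of_le hL.le] at h0
  have hi : Integrable (fun x => ‖((u x : ℝ) : ℂ)‖ ^ 2) (volume.restrict (Ioc (0 : ℝ) L)) :=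
    hm.integrable_norm_pow (by norm_num)
  rw [integral_eq_zero_iff_of_nonneg (fun x => sq_nonneg ‖((u x : ℝ) : ℂ)‖) hi] at h0
  refine (Lp.eq_zero_iff_ae_eq_zero).2 ?_
  filter_upwards [h0] with x hx
  simpa using hx

/-- The Fourier coefficients of `u`, weighted so that their `ℓ²` norm is the Sobolev norm of
order `s`. -/
def weighted (L s : ℝ) (u : ℝ → ℝ) (k : ℤ) : ℂ :=
  ((Real.sqrt (L * (1 + (k : ℝ) ^ 2) ^ s) : ℝ) : ℂ) * coeff L u k

theorem norm_weighted_sq {L : ℝ} (hL : 0 < L) (s : ℝ) (u : ℝ → ℝ) (k : ℤ) :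
    ‖weighted L s u k‖ ^ 2 = L * ((1 + (k : ℝ) ^ 2) ^ s * ‖coeff L u k‖ ^ 2) := by
  rw [weighted, norm_mul, mul_pow, Complex.norm_real, Real.norm_eq_abs, sq_abs,
    Real.sq_sqrt (by positivity), mul_assoc]

theorem memlp_weighted_iff {L : ℝ} (hL : 0 < L) (s : ℝ) (u : ℝ → ℝ) :
    Memℓp (weighted L s u) 2 ↔
      Summable fun k : ℤ => (1 + (k : ℝ) ^ 2) ^ s * ‖coeff L u k‖ ^ 2 := by
  rw [memℓp_gen_iff (by norm_num)]
  simp only [ENNReal.toReal_ofNat, Real.rpow_ofNat, norm_weighted_sq hL]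
  exact summable_mul_left_iff hL.ne'

theorem weighted_add {L : ℝ} (hL : 0 < L) (s : ℝ) (u v : L2per L) :
    weighted L s (u + v : L2per L) = weighted L s u + weighted L s v := by
  funext k
  simp only [weighted, coeff_add hL, Pi.add_apply, mul_add]

theorem weighted_smul {L : ℝ} (hL : 0 < L) (s c : ℝ) (u : L2per L) :
    weighted L s (c • u : L2per L) = c • weighted L s u := by
  funext k
  simp only [weighted, coeff_smul hL, Pi.smul_apply, Complex.real_smul]
  ring

/-- The functions in `L²` whose Sobolev norm of order `s` (`s ≥ 0`) is finite, as a subspace. -/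
def hperSubmodule (L s : ℝ) [hL : Fact (0 < L)] : Submodule ℝ (L2per L) where
  carrier := {u | Summable fun k : ℤ => (1 + (k : ℝ) ^ 2) ^ s * ‖coeff L u k‖ ^ 2}
  add_mem' := by
    intro u v hu hv
    simp only [mem_ofPred_eq, ← memlp_weighted_iff hL.out] at hu hv ⊢
    rw [weighted_add hL.out]
    exact hu.add hv
  zero_mem' := by
    have h : ∀ k, coeff L (0 : L2per L) k = 0 := fun k => by
      simpa using coeff_smul hL.out 0 (0 : L2per L) k
    refine summable_zero.congr fun k => ?_
    rw [h k, norm_zero]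
    ring
  smul_mem' := by
    intro c u hu
    simp only [mem_ofPred_eq, ← memlp_weighted_iff hL.out] at hu ⊢
    rw [weighted_smul hL.out]
    exact hu.const_smul c

/-- The periodic Sobolev space `H^s_per([0, L])` of real functions. It is a type of its own, so
that it carries the Sobolev norm and not the `L²` norm. -/
def Hper (L s : ℝ) [Fact (0 < L)] : Type := ↥(hperSubmodule L s)

namespace Hper

variable {L s : ℝ} [hL : Fact (0 < L)]

instance : AddCommGroup (Hper L s) := inferInstanceAs (AddCommGroup ↥(hperSubmodule L s))

instance : Module ℝ (Hper L s) := inferInstanceAs (Module ℝ ↥(hperSubmodule L s))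

/-- The underlying element of `L²`. -/
def toL2 (u : Hper L s) : L2per L := Subtype.val u

instance : CoeFun (Hper L s) (fun _ => ℝ → ℝ) := ⟨fun u => (u.toL2 : ℝ → ℝ)⟩

/-- The isometry of `H^s` into `ℓ²(ℤ)` that defines the norm. -/
def toSeq : Hper L s →ₗ[ℝ] lp (fun _ : ℤ => ℂ) 2 where
  toFun u := ⟨weighted L s u, (memlp_weighted_iff hL.out s u).2 u.2⟩
  map_add' u v := Subtype.ext (weighted_add hL.out s u.toL2 v.toL2)
  map_smul' c u := Subtype.ext (weighted_smul hL.out s c u.toL2)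

theorem toSeq_injective : Function.Injective (toSeq : Hper L s →ₗ[ℝ] lp (fun _ : ℤ => ℂ) 2) := by
  rw [← LinearMap.ker_eq_bot, LinearMap.ker_eq_bot']
  intro u hu
  refine Subtype.ext (coeff_injective hL.out u.toL2 fun k => ?_)
  have h : weighted L s u k = 0 := congrFun (congrArg Subtype.val hu) k
  have hpos : 0 < L * (1 + (k : ℝ) ^ 2) ^ s := mul_pos hL.out (by positivity)
  rw [weighted, mul_eq_zero, Complex.ofReal_eq_zero] at h
  exact h.resolve_left (Real.sqrt_pos.2 hpos).ne'

instance : NormedAddCommGroup (Hper L s) :=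
  NormedAddCommGroup.induced (Hper L s) (lp (fun _ : ℤ => ℂ) 2) toSeq toSeq_injective

instance : NormedSpace ℝ (Hper L s) :=
  NormedSpace.induced ℝ (Hper L s) (lp (fun _ : ℤ => ℂ) 2) toSeq

theorem norm_eq (u : Hper L s) : ‖u‖ = sobolevNorm L s u := by
  have h : ‖u‖ = ‖(toSeq u : lp (fun _ : ℤ => ℂ) 2)‖ := rfl
  rw [h, lp.norm_eq_tsum_rpow (by norm_num), sobolevNorm, Real.sqrt_eq_rpow, ← tsum_mul_left]
  simp only [ENNReal.toReal_ofNat, Real.rpow_ofNat, one_div]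
  congr 1
  exact tsum_congr fun k => norm_weighted_sq hL.out s u k

end Hper

/-! ### The equation `u_t + (f(u))_x - (𝓜 u)_x = 0` -/

/-- The symbol `θ` of `𝓜` is even, continuous, and of order `m > 0` at infinity. -/
structure IsSymbol (θ : ℝ → ℝ) (m : ℝ) : Prop where
  pos : 0 < m
  even : ∀ y, θ (-y) = θ y
  cont : Continuous θ
  growth : ∃ v₁ v₂ κ₀ : ℝ, 0 < v₁ ∧ 0 < v₂ ∧
    ∀ κ : ℝ, κ₀ ≤ |κ| → v₁ * |κ| ^ m ≤ θ κ ∧ θ κ ≤ v₂ * |κ| ^ m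

/-- `g = 𝓜 u` in `L²`, where `𝓜` is the Fourier multiplier with symbol `θ`. -/
def IsMul (L : ℝ) (θ : ℝ → ℝ) (u g : ℝ → ℝ) : Prop :=
  MemLp g 2 (volume.restrict (Ioc (0 : ℝ) L)) ∧ ∀ k : ℤ, coeff L g k = (θ k : ℂ) * coeff L u k

/-- `u ∈ C([0, ∞); H^s)` is a solution of `u_t + (f(u))_x - (𝓜 u)_x = 0` with `u(0) = u₀`, in the
sense of periodic distributions in `x` (that is, for each Fourier coefficient in `x`) and
integrated in time. -/
structure IsGlobalSolution (L : ℝ) [Fact (0 < L)] (f θ : ℝ → ℝ) (s : ℝ) (u₀ : Hper L s)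
    (u : ℝ → Hper L s) : Prop where
  init : u 0 = u₀
  cont : ContinuousOn u (Ici 0)
  integrable : ∀ t, 0 ≤ t → IntervalIntegrable (fun x => f (u t x)) volume 0 L
  integrable_time : ∀ (k : ℤ) (t : ℝ), 0 ≤ t →
    IntervalIntegrable (fun τ => coeff L (fun x => f (u τ x)) k) volume 0 t
  equation : ∀ (k : ℤ) (t : ℝ), 0 ≤ t →
    coeff L (u t) k - coeff L u₀ k = ∫ τ in (0 : ℝ)..t,
      -(2 * Real.pi * Complex.I * k / L) *
        (coeff L (fun x => f (u τ x)) k - (θ k : ℂ) * coeff L (u τ) k)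

/-- Global well-posedness of the Cauchy problem in `H^s`: existence and uniqueness of global
solutions, continuous dependence on the initial datum, and persistence of regularity
(the solution with a smooth initial datum is smooth in `x`, continuously in time). -/
structure IsGloballyWellPosed (L : ℝ) [Fact (0 < L)] (f θ : ℝ → ℝ) (s : ℝ) : Prop where
  exists_solution : ∀ u₀ : Hper L s, ∃ u, IsGlobalSolution L f θ s u₀ u
  unique : ∀ (u₀ : Hper L s) (u v : ℝ → Hper L s), IsGlobalSolution L f θ s u₀ u →
    IsGlobalSolution L f θ s u₀ v → ∀ t, 0 ≤ t → u t = v t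
  continuous_dependence : ∀ (u₀ : Hper L s) (u : ℝ → Hper L s), IsGlobalSolution L f θ s u₀ u →
    ∀ T > 0, ∀ ε > 0, ∃ δ > 0, ∀ (v₀ : Hper L s) (v : ℝ → Hper L s),
      IsGlobalSolution L f θ s v₀ v → ‖v₀ - u₀‖ < δ → ∀ t ∈ Icc 0 T, ‖v t - u t‖ < ε
  persistence : ∀ (u₀ : Hper L s) (u : ℝ → Hper L s), IsGlobalSolution L f θ s u₀ u →
    (∀ r, s ≤ r → u₀.toL2 ∈ hperSubmodule L r) →
    ∀ r, s ≤ r → ∃ v : ℝ → Hper L r, ContinuousOn v (Ici 0) ∧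
      ∀ t, 0 ≤ t → (v t).toL2 = (u t).toL2

/-- The primitive `W` of `f`. -/
def primitive (f : ℝ → ℝ) (y : ℝ) : ℝ := ∫ z in (0 : ℝ)..y, f z

/-- The potential part `u ↦ ∫₀ᴸ W(u) dx` of the energy is well defined and of class `C²` on `H^r`.
(The rest of the energy is quadratic.) -/
def PotentialEnergyC2 (L : ℝ) [Fact (0 < L)] (f : ℝ → ℝ) (r : ℝ) : Prop :=
  (∀ u : Hper L r, IntervalIntegrable (fun x => primitive f (u x)) volume 0 L) ∧
  ContDiff ℝ 2 (fun u : Hper L r => ∫ x in (0 : ℝ)..L, primitive f (u x))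

/-! ### Traveling waves and the linearized operator -/

/-- `φ` is a smooth `L`-periodic solution of `𝓜φ + ωφ - f(φ) + A = 0`. -/
structure IsPeriodicWave (L : ℝ) (f θ : ℝ → ℝ) (ω A : ℝ) (φ : ℝ → ℝ) : Prop where
  smooth : ContDiff ℝ (⊤ : ℕ∞) φ
  periodic : Function.Periodic φ L
  equation : IsMul L θ φ (fun x => f (φ x) - ω * φ x - A)

/-- `𝓛 v = w`, where `𝓛 = 𝓜 + ω - f'(φ)`; that is, `𝓜 v = w - ωv + f'(φ)v` in `L²`. -/
def IsLin (L : ℝ) (f θ : ℝ → ℝ) (ω : ℝ) (φ v w : ℝ → ℝ) : Prop :=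
  IsMul L θ v (fun x => w x - ω * v x + deriv f (φ x) * v x)

/-- `𝓛`, with domain `H^m`, has exactly one negative eigenvalue, which is simple, and zero is a
simple eigenvalue with eigenfunction `φ'`. -/
structure SpectralCondition (L : ℝ) [Fact (0 < L)] (f θ : ℝ → ℝ) (m ω : ℝ) (φ : ℝ → ℝ) :
    Prop where
  negative : ∃ (lam : ℝ) (χ : Hper L m), lam < 0 ∧ χ ≠ 0 ∧
    IsLin L f θ ω φ χ (fun x => lam * χ x) ∧
    (∀ v : Hper L m, IsLin L f θ ω φ v (fun x => lam * v x) → ∃ c : ℝ, v = c • χ) ∧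
    (∀ (lam' : ℝ) (v : Hper L m), lam' < 0 → v ≠ 0 →
      IsLin L f θ ω φ v (fun x => lam' * v x) → lam' = lam)
  zero_eigenvalue : IsLin L f θ ω φ (deriv φ) (fun _ => 0)
  zero_ne : ∃ x, deriv φ x ≠ 0
  zero_simple : ∀ v : Hper L m, IsLin L f θ ω φ v (fun _ => 0) →
    ∃ c : ℝ, ⇑v.toL2 =ᵐ[volume.restrict (Ioc (0 : ℝ) L)] fun x => c * deriv φ x

/-- The Gårding-type inequality `(𝓛v, v) ≥ c₁ ‖v‖²_{m/2} - c₂ ‖v‖²` for smooth periodic `v`. -/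
def GardingInequality (L : ℝ) (f θ : ℝ → ℝ) (m ω : ℝ) (φ : ℝ → ℝ) : Prop :=
  ∃ c₁ c₂ : ℝ, 0 < c₁ ∧ 0 < c₂ ∧ ∀ v w : ℝ → ℝ, ContDiff ℝ (⊤ : ℕ∞) v → Function.Periodic v L →
    IsLin L f θ ω φ v w →
    c₁ * sobolevNorm L (m / 2) v ^ 2 - c₂ * (∫ x in (0 : ℝ)..L, v x ^ 2) ≤
      ∫ x in (0 : ℝ)..L, w x * v x

/-- `(ω, A) ↦ φ ω A` is a smooth surface, over the open set `O`, of traveling waves of the fixed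
period `L`, each of which satisfies the spectral condition. -/
structure IsWaveSurface (L : ℝ) [Fact (0 < L)] (f θ : ℝ → ℝ) (m : ℝ) (O : Set (ℝ × ℝ))
    (φ : ℝ → ℝ → ℝ → ℝ) : Prop where
  isOpen : IsOpen O
  smooth : ContDiffOn ℝ (⊤ : ℕ∞) (fun p : (ℝ × ℝ) × ℝ => φ p.1.1 p.1.2 p.2) (O ×ˢ univ)
  wave : ∀ p ∈ O, IsPeriodicWave L f θ p.1 p.2 (φ p.1 p.2)
  spectral : ∀ p ∈ O, SpectralCondition L f θ m p.1 (φ p.1 p.2)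

/-- `M_ω = ∫₀ᴸ ∂_ω φ dx`. -/
def Mω (L : ℝ) (φ : ℝ → ℝ → ℝ → ℝ) (ω A : ℝ) : ℝ :=
  ∫ x in (0 : ℝ)..L, deriv (fun y => φ y A x) ω

/-- `M_A = ∫₀ᴸ ∂_A φ dx`. -/
def MA (L : ℝ) (φ : ℝ → ℝ → ℝ → ℝ) (ω A : ℝ) : ℝ :=
  ∫ x in (0 : ℝ)..L, deriv (fun y => φ ω y x) A

/-- `F_ω = (1/2) ∫₀ᴸ ∂_ω (φ²) dx`. -/
def Fω (L : ℝ) (φ : ℝ → ℝ → ℝ → ℝ) (ω A : ℝ) : ℝ :=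
  (1 / 2) * ∫ x in (0 : ℝ)..L, deriv (fun y => φ y A x ^ 2) ω

/-- `F_A = (1/2) ∫₀ᴸ ∂_A (φ²) dx`. -/
def FA (L : ℝ) (φ : ℝ → ℝ → ℝ → ℝ) (ω A : ℝ) : ℝ :=
  (1 / 2) * ∫ x in (0 : ℝ)..L, deriv (fun y => φ ω y x ^ 2) A

/-- The quadratic form `Δ(a, b) = a² M_A + ab (M_ω + F_A) + b² F_ω`. -/
def Delta (L : ℝ) (φ : ℝ → ℝ → ℝ → ℝ) (ω A a b : ℝ) : ℝ :=
  a ^ 2 * MA L φ ω A + a * b * (Mω L φ ω A + FA L φ ω A) + b ^ 2 * Fω L φ ω A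

/-- `g ∈ H^m` is `𝓛⁻¹ y`, where `𝓛⁻¹` is the inverse of `𝓛` on the orthogonal complement of `φ'`:
the one and only solution of `𝓛 g = y` that is orthogonal to `φ'`. -/
def IsLinInv (L : ℝ) [Fact (0 < L)] (f θ : ℝ → ℝ) (m ω : ℝ) (φ y : ℝ → ℝ) (g : Hper L m) :
    Prop :=
  ((∫ x in (0 : ℝ)..L, g x * deriv φ x) = 0 ∧ IsLin L f θ ω φ g y) ∧
  ∀ h : Hper L m, (∫ x in (0 : ℝ)..L, h x * deriv φ x) = 0 → IsLin L f θ ω φ h y → h = g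

/-! ### Orbital stability -/

/-- The distance, in the Sobolev norm of order `r`, of `g` from the orbit
`{φ(· + q) : q ∈ ℝ}`. -/
def orbitDist (L r : ℝ) (g φ : ℝ → ℝ) : ℝ :=
  ⨅ q : ℝ, sobolevNorm L r (fun x => g x - φ (x + q))

/-- Orbital stability of `φ` in `H^{m/2}` by the flow of the equation in `H^s`, `s ≥ m/2`. -/
def OrbitallyStable (L : ℝ) [Fact (0 < L)] (f θ : ℝ → ℝ) (m s : ℝ) (φ : ℝ → ℝ) : Prop :=
  ∀ ε > 0, ∃ δ > 0, ∀ u₀ : Hper L s, sobolevNorm L (m / 2) (fun x => u₀ x - φ x) < δ →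
    (∃ u, IsGlobalSolution L f θ s u₀ u) ∧
    ∀ u, IsGlobalSolution L f θ s u₀ u → ∀ t, 0 ≤ t → orbitDist L (m / 2) (u t) φ < ε

end PeriodicWaves

end

/-! Write E(u) = ½(𝓜u,u) − ∫W(u) for the energy, F(u) = ½∫u² for the momentum and M(u) = ∫u for the
mass. The wave equation says that φ is a critical point of E + ωF + AM, and the second variation
there is 𝓛. Two things keep φ from being a strict minimum: the kernel of 𝓛, which is tangent to the
orbit of translations and therefore harmless, and one negative direction, which must be excluded by
conserving Q = aM + bF.

Differentiating the wave equation in the parameters gives 𝓛∂_ωφ = −φ and 𝓛∂_Aφ = −1. Hence η = a∂_Aφ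
+ b∂_ωφ solves 𝓛η = −y, where y = a + bφ is the gradient of Q at φ, and −(𝓛η,η) = (y,η) = Δ(a,b). If
this is positive, η uses up the only negative direction, while the constraint (y,z) = 0 means (𝓛η,z)
= 0; so 𝓛 is positive on y^⊥ modulo φ'. This is `IsGardingForm.exists_pos_on_constraint`, a
Cauchy–Schwarz argument resting on the positivity in `exists_pos_lower_bound`. A penalty K(y,·)²
removes the constraint and the Gårding inequality upgrades positivity in L² to coercivity in H^{m/2}
(`exists_coercive`, `exists_coercive_opForm`).

The Lyapunov functional is E + ωF + AM plus (K/2)(Q − Q(φ))², normalized to vanish at φ. Near φ and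
transversally to the orbit it dominates the square of the distance (`exists_le_lyapunov`). This uses
the expansion `exists_taylor_potential`: for m > 1 it comes from the embedding of H^{m/2} in L^∞,
for m ≤ 1 from the assumed C² regularity, whose derivatives are identified on bounded functions and
then by density. Transversality is free: at the nearest translate the difference is orthogonal to φ'
(`exists_orbitDist_eq`).

Conservation is proved for smooth solutions, one Fourier mode at a time, from u_t = ∂_x E'(u)
(`conservation_of_smooth`), and passes to all solutions by density and continuous dependence.
Stability follows by continuity in time (`orbitallyStable_of_coercive`). The identity F_A = M_ω is
the symmetry of 𝓛, and the formulas with 𝓛⁻¹ come from projecting −∂_Aφ and −∂_ωφ off the kernel. -/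

open MeasureTheory Set Filter Topology

noncomputable section

namespace PeriodicWaves

/-! ### Fourier coefficients -/

/-- Lebesgue measure on one period. -/
abbrev perMeasure (L : ℝ) : Measure ℝ := volume.restrict (Ioc (0 : ℝ) L)

/-- The `k`-th Fourier character. -/
def char (L : ℝ) (k : ℤ) (x : ℝ) : ℂ := Complex.exp (2 * Real.pi * Complex.I * k * x / L)

theorem char_eq (L : ℝ) (k : ℤ) (x : ℝ) :
    char L k x = Complex.exp (((2 * Real.pi * k * x / L : ℝ) : ℂ) * Complex.I) := by
  unfold char
  congr 1
  push_cast
  ring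

theorem norm_char (L : ℝ) (k : ℤ) (x : ℝ) : ‖char L k x‖ = 1 := by
  rw [char_eq, Complex.norm_exp_ofReal_mul_I]

theorem exp_eq_char (L : ℝ) (k : ℤ) (x : ℝ) :
    Complex.exp (-(2 * Real.pi * Complex.I * k * x / L)) = char L (-k) x := by
  unfold char
  congr 1
  push_cast
  ring

theorem conj_char (L : ℝ) (k : ℤ) (x : ℝ) :
    (starRingEnd ℂ) (char L k x) = char L (-k) x := by
  rw [char_eq, char_eq, ← Complex.exp_conj]
  congr 1
  simp only [map_mul, Complex.conj_ofReal, Complex.conj_I]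
  push_cast
  ring

theorem char_mul (L : ℝ) (k j : ℤ) (x : ℝ) : char L k x * char L j x = char L (k + j) x := by
  unfold char
  rw [← Complex.exp_add]
  congr 1
  push_cast
  ring

theorem char_zero (L : ℝ) (x : ℝ) : char L 0 x = 1 := by
  simp [char]

theorem char_add (L : ℝ) (k : ℤ) (x y : ℝ) : char L k (x + y) = char L k x * char L k y := by
  unfold char
  rw [← Complex.exp_add]
  congr 1
  push_cast
  ring

theorem char_self {L : ℝ} (hL : 0 < L) (k : ℤ) : char L k L = 1 := by
  have : (L : ℂ) ≠ 0 := by exact_mod_cast hL.ne'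
  unfold char
  rw [mul_div_assoc, div_self this, mul_one, Complex.exp_eq_one_iff]
  exact ⟨k, by ring⟩

theorem char_zsmul {L : ℝ} (hL : 0 < L) (k n : ℤ) : char L k (n • L) = 1 := by
  have : (L : ℂ) ≠ 0 := by exact_mod_cast hL.ne'
  unfold char
  rw [Complex.exp_eq_one_iff]
  refine ⟨k * n, ?_⟩
  push_cast [zsmul_eq_mul]
  field_simp

theorem continuous_char (L : ℝ) (k : ℤ) : Continuous (char L k) := by
  unfold char
  fun_prop

theorem hasDerivAt_char (L : ℝ) (k : ℤ) (x : ℝ) :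
    HasDerivAt (char L k) (2 * Real.pi * Complex.I * k / L * char L k x) x := by
  have h1 : HasDerivAt (fun x : ℝ => (2 * Real.pi * Complex.I * k * x / L : ℂ))
      (2 * Real.pi * Complex.I * k / L) x := by
    have := ((Complex.ofRealCLM.hasDerivAt (x := x)).const_mul
      (2 * Real.pi * Complex.I * k : ℂ)).div_const (L : ℂ)
    simpa using this
  rw [mul_comm]
  exact h1.cexp

theorem integral_char {L : ℝ} (hL : 0 < L) (k : ℤ) :
    ∫ x in (0 : ℝ)..L, char L k x = if k = 0 then (L : ℂ) else 0 := by
  split_ifs with h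
  · subst h
    simp [char_zero]
  · have hL' : (L : ℂ) ≠ 0 := by exact_mod_cast hL.ne'
    have hk : (2 * Real.pi * Complex.I * k / L : ℂ) ≠ 0 := by
      have : (k : ℂ) ≠ 0 := by exact_mod_cast h
      have : (Real.pi : ℂ) ≠ 0 := by exact_mod_cast Real.pi_ne_zero
      simp [*]
    have h2 : ∀ x ∈ uIcc 0 L, HasDerivAt
        (fun x => char L k x / (2 * Real.pi * Complex.I * k / L)) (char L k x) x := by
      intro x _
      have := (hasDerivAt_char L k x).div_const (2 * Real.pi * Complex.I * k / L : ℂ)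
      rwa [mul_div_cancel_left₀ _ hk] at this
    rw [intervalIntegral.integral_eq_sub_of_hasDerivAt h2
      ((continuous_char L k).intervalIntegrable _ _), char_self hL]
    simp [char]

theorem coeff_eq (L : ℝ) (g : ℝ → ℝ) (k : ℤ) :
    coeff L g k = (1 / (L : ℂ)) * ∫ x in (0 : ℝ)..L, (g x : ℂ) * char L (-k) x := by
  simp only [coeff, exp_eq_char]

theorem intervalIntegrable_mul_char {L : ℝ} {g : ℝ → ℝ}
    (hg : IntervalIntegrable g volume 0 L) (k : ℤ) :
    IntervalIntegrable (fun x => (g x : ℂ) * char L k x) volume 0 L :=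
  IntervalIntegrable.mul_continuousOn (f := fun x => (g x : ℂ)) ⟨hg.1.ofReal, hg.2.ofReal⟩
    (continuous_char L k).continuousOn

theorem coeff_fun_add {L : ℝ} {g h : ℝ → ℝ} (hg : IntervalIntegrable g volume 0 L)
    (hh : IntervalIntegrable h volume 0 L) (k : ℤ) :
    coeff L (fun x => g x + h x) k = coeff L g k + coeff L h k := by
  simp only [coeff_eq]
  rw [← mul_add, ← intervalIntegral.integral_add (intervalIntegrable_mul_char hg _)
    (intervalIntegrable_mul_char hh _)]
  simp only [Complex.ofReal_add, add_mul]

theorem coeff_fun_mul (L c : ℝ) (g : ℝ → ℝ) (k : ℤ) :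
    coeff L (fun x => c * g x) k = c * coeff L g k := by
  simp only [coeff_eq]
  rw [mul_left_comm, ← intervalIntegral.integral_const_mul (c : ℂ)]
  simp only [Complex.ofReal_mul, mul_assoc]

theorem coeff_fun_sub {L : ℝ} {g h : ℝ → ℝ} (hg : IntervalIntegrable g volume 0 L)
    (hh : IntervalIntegrable h volume 0 L) (k : ℤ) :
    coeff L (fun x => g x - h x) k = coeff L g k - coeff L h k := by
  have := coeff_fun_add hg (hh.const_mul (-1)) k
  rw [coeff_fun_mul] at this
  simp only [neg_one_mul, ← sub_eq_add_neg, Complex.ofReal_neg, Complex.ofReal_one] at this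
  exact this

theorem coeff_neg_index {L : ℝ} (g : ℝ → ℝ) (k : ℤ) :
    coeff L g (-k) = (starRingEnd ℂ) (coeff L g k) := by
  simp only [coeff_eq, map_mul, intervalIntegral, map_sub, ← integral_conj, Complex.conj_ofReal,
    conj_char, map_div₀, map_one]

theorem integral_eq_coeff_zero {L : ℝ} (hL : 0 < L) (g : ℝ → ℝ) :
    ∫ x in (0 : ℝ)..L, g x = L * (coeff L g 0).re := by
  have hL' : (L : ℂ) ≠ 0 := by exact_mod_cast hL.ne'
  have h : (L : ℂ) * coeff L g 0 = ((∫ x in (0 : ℝ)..L, g x : ℝ) : ℂ) := by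
    rw [coeff_eq, ← mul_assoc, mul_one_div_cancel hL', one_mul, ← intervalIntegral.integral_ofReal]
    simp [char_zero]
  have := congrArg Complex.re h
  rwa [Complex.re_ofReal_mul, Complex.ofReal_re, eq_comm] at this

theorem norm_coeff_le_of_bound {L : ℝ} (hL : 0 < L) {g : ℝ → ℝ} {C : ℝ}
    (hg : ∀ᵐ x ∂perMeasure L, |g x| ≤ C) (k : ℤ) : ‖coeff L g k‖ ≤ C := by
  have h := intervalIntegral.norm_integral_le_of_norm_le_const_ae (a := 0) (b := L) (C := C)
    (f := fun x => (g x : ℂ) * char L (-k) x) (by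
      rw [uIoc_of_le hL.le]
      filter_upwards [(ae_restrict_iff' measurableSet_Ioc).1 hg] with x hx hx'
      rw [norm_mul, norm_char, mul_one, Complex.norm_real]
      exact hx hx')
  rw [coeff_eq, norm_mul, norm_div, norm_one, Complex.norm_real, Real.norm_of_nonneg hL.le,
    one_div, inv_mul_le_iff₀ hL]
  rw [sub_zero, abs_of_pos hL, mul_comm] at h
  exact h

theorem MemLp.intervalIntegrable_per {L : ℝ} (hL : 0 < L) {g : ℝ → ℝ}
    (hg : MemLp g 2 (perMeasure L)) : IntervalIntegrable g volume 0 L := by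
  rw [intervalIntegrable_iff_integrableOn_Ioc_of_le hL.le]
  exact hg.integrable (by norm_num)

theorem intervalIntegrable_mul_of_memLp {L : ℝ} (hL : 0 < L) {g h : ℝ → ℝ}
    (hg : MemLp g 2 (perMeasure L)) (hh : MemLp h 2 (perMeasure L)) :
    IntervalIntegrable (fun x => g x * h x) volume 0 L := by
  rw [intervalIntegrable_iff_integrableOn_Ioc_of_le hL.le]
  exact hg.integrable_mul hh

theorem parseval {L : ℝ} (hL : 0 < L) {g : ℝ → ℝ} (hg : MemLp g 2 (perMeasure L)) :
    HasSum (fun k => L * ‖coeff L g k‖ ^ 2) (∫ x in (0 : ℝ)..L, g x ^ 2) := by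
  have h := (hasSum_sq_fourierCoeffOn hL hg.ofReal).mul_left L
  rw [sub_zero, smul_eq_mul, ← mul_assoc, mul_inv_cancel₀ hL.ne', one_mul] at h
  simp only [coeff_eq_fourierCoeffOn hL]
  have e : ∫ x in (0 : ℝ)..L, g x ^ 2 = ∫ x in (0 : ℝ)..L, ‖((g x : ℝ) : ℂ)‖ ^ 2 :=
    intervalIntegral.integral_congr fun x _ => by simp
  rw [e]
  exact h

theorem re_conj_mul_eq (a b : ℂ) :
    ((starRingEnd ℂ) a * b).re = (‖a + b‖ ^ 2 - ‖a - b‖ ^ 2) / 4 := by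
  simp only [Complex.sq_norm, Complex.normSq_apply, Complex.mul_re, Complex.conj_re,
    Complex.conj_im, Complex.add_re, Complex.add_im, Complex.sub_re, Complex.sub_im]
  ring

/-- Polarization of `parseval`. Only real parts occur because g and h are real. -/
theorem parseval_inner {L : ℝ} (hL : 0 < L) {g h : ℝ → ℝ} (hg : MemLp g 2 (perMeasure L))
    (hh : MemLp h 2 (perMeasure L)) :
    HasSum (fun k => L * ((starRingEnd ℂ) (coeff L g k) * coeff L h k).re)
      (∫ x in (0 : ℝ)..L, g x * h x) := by
  have h1 := parseval hL (hg.add hh)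
  have h2 := parseval hL (hg.sub hh)
  have h3 := (h1.sub h2).div_const 4
  have ig := MemLp.intervalIntegrable_per hL hg
  have ih := MemLp.intervalIntegrable_per hL hh
  have e : ∫ x in (0 : ℝ)..L, g x * h x
      = ((∫ x in (0 : ℝ)..L, (g + h) x ^ 2) - ∫ x in (0 : ℝ)..L, (g - h) x ^ 2) / 4 := by
    rw [← intervalIntegral.integral_sub, ← intervalIntegral.integral_div]
    · refine intervalIntegral.integral_congr fun x _ => ?_
      simp only [Pi.add_apply, Pi.sub_apply]
      ring
    · simpa only [sq] using intervalIntegrable_mul_of_memLp hL (hg.add hh) (hg.add hh)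
    · simpa only [sq] using intervalIntegrable_mul_of_memLp hL (hg.sub hh) (hg.sub hh)
  rw [e]
  refine h3.congr_fun fun k => ?_
  have e1 : coeff L (g + h) k = _ := coeff_fun_add ig ih k
  have e2 : coeff L (g - h) k = _ := coeff_fun_sub ig ih k
  rw [e1, e2, re_conj_mul_eq]
  ring

theorem ae_eq_of_coeff_eq {L : ℝ} (hL : 0 < L) {g h : ℝ → ℝ} (hg : MemLp g 2 (perMeasure L))
    (hh : MemLp h 2 (perMeasure L)) (H : ∀ k, coeff L g k = coeff L h k) :
    g =ᵐ[perMeasure L] h := by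
  have hgh := hg.sub hh
  have h0 := coeff_injective hL (hgh.toLp _) fun k => by
    rw [coeff_congr hL hgh.coeFn_toLp k]
    have e := coeff_fun_sub (MemLp.intervalIntegrable_per hL hg)
      (MemLp.intervalIntegrable_per hL hh) k
    rw [H k, sub_self] at e
    exact e
  have h1 := hgh.coeFn_toLp
  rw [h0] at h1
  filter_upwards [h1, Lp.coeFn_zero ℝ 2 (perMeasure L)] with x hx hx0
  rw [hx0] at hx
  simp only [Pi.zero_apply, Pi.sub_apply] at hx
  linarith

/-- Integration by parts: g times a character takes the same value at 0 and L, so the integral of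
its derivative vanishes. -/
theorem coeff_deriv {L : ℝ} (hL : 0 < L) {g g' : ℝ → ℝ} (hper : Function.Periodic g L)
    (hg : ∀ x, HasDerivAt g (g' x) x) (hg' : Continuous g') (k : ℤ) :
    coeff L g' k = 2 * Real.pi * Complex.I * k / L * coeff L g k := by
  have h1 : ∀ x ∈ uIcc 0 L, HasDerivAt (fun x => (g x : ℂ) * char L (-k) x)
      ((g' x : ℂ) * char L (-k) x
        + (g x : ℂ) * (2 * Real.pi * Complex.I * (-k : ℤ) / L * char L (-k) x)) x := fun x _ =>
    (hg x).ofReal_comp.mul (hasDerivAt_char L (-k) x)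
  have hgc : Continuous g := continuous_iff_continuousAt.2 fun x => (hg x).continuousAt
  have i1 := intervalIntegrable_mul_char (L := L) (hg'.intervalIntegrable 0 L) (-k)
  have i2 := intervalIntegrable_mul_char (L := L) (hgc.intervalIntegrable 0 L) (-k)
  have h2 := intervalIntegral.integral_eq_sub_of_hasDerivAt h1 (i1.add (by
    refine (i2.const_mul (2 * Real.pi * Complex.I * (-k : ℤ) / L)).congr ?_
    exact fun x _ => by ring))
  rw [char_self hL, ← zero_add L, hper 0, zero_add] at h2
  have e0 : char L (-k) 0 = 1 := by simp [char]
  rw [e0, sub_self, intervalIntegral.integral_add i1 (by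
    refine (i2.const_mul (2 * Real.pi * Complex.I * (-k : ℤ) / L)).congr ?_
    exact fun x _ => by ring)] at h2
  have h3 : ∫ x in (0 : ℝ)..L, (g x : ℂ) * (2 * Real.pi * Complex.I * (-k : ℤ) / L * char L (-k) x)
      = 2 * Real.pi * Complex.I * (-k : ℤ) / L * ∫ x in (0 : ℝ)..L, (g x : ℂ) * char L (-k) x := by
    rw [← intervalIntegral.integral_const_mul]
    exact intervalIntegral.integral_congr fun x _ => by ring
  rw [h3] at h2
  rw [coeff_eq, coeff_eq, eq_neg_of_add_eq_zero_left h2]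
  push_cast
  ring

/-! ### Functions with summable Fourier coefficients -/

/-- The real part of the Fourier series with coefficients `c`. -/
def synth (L : ℝ) (c : ℤ → ℂ) (x : ℝ) : ℝ := (∑' k, c k * char L k x).re

theorem summable_mul_char {L : ℝ} {c : ℤ → ℂ} (hc : Summable fun k => ‖c k‖) (x : ℝ) :
    Summable fun k => c k * char L k x :=
  Summable.of_norm (by simpa only [norm_mul, norm_char, mul_one] using hc)

theorem hasSum_synth {L : ℝ} {c : ℤ → ℂ} (hc : Summable fun k => ‖c k‖) (x : ℝ) :
    HasSum (fun k => (c k * char L k x).re) (synth L c x) :=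
  Complex.hasSum_re (summable_mul_char hc x).hasSum

theorem abs_synth_le {L : ℝ} {c : ℤ → ℂ} (hc : Summable fun k => ‖c k‖) (x : ℝ) :
    |synth L c x| ≤ ∑' k, ‖c k‖ := by
  refine (Complex.abs_re_le_norm _).trans (tsum_of_norm_bounded hc.hasSum fun k => ?_)
  rw [norm_mul, norm_char, mul_one]

theorem continuous_synth {L : ℝ} {c : ℤ → ℂ} (hc : Summable fun k => ‖c k‖) :
    Continuous (synth L c) := by
  refine Complex.continuous_re.comp (continuous_tsum (fun k =>
    continuous_const.mul (continuous_char L k)) hc fun k x => ?_)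
  rw [norm_mul, norm_char, mul_one]

theorem periodic_synth {L : ℝ} (hL : 0 < L) (c : ℤ → ℂ) : Function.Periodic (synth L c) L := by
  intro x
  simp only [synth, char_add, char_self hL, mul_one]

theorem hasDerivAt_synth {L : ℝ} (hL : 0 < L) {c : ℤ → ℂ} (hc : Summable fun k => ‖c k‖)
    (hc' : Summable fun k : ℤ => |(k : ℝ)| * ‖c k‖) (x : ℝ) :
    HasDerivAt (synth L c) (synth L (fun k => 2 * Real.pi * Complex.I * k / L * c k) x) x := by
  have hu : Summable fun k : ℤ => 2 * Real.pi / L * (|(k : ℝ)| * ‖c k‖) := hc'.mul_left _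
  have hb : ∀ (k : ℤ) (y : ℝ),
      ‖2 * Real.pi * Complex.I * k / L * c k * char L k y‖ ≤
        2 * Real.pi / L * (|(k : ℝ)| * ‖c k‖) := by
    intro k y
    have : ‖(2 * Real.pi * Complex.I * k / L : ℂ)‖ = 2 * Real.pi / L * |(k : ℝ)| := by
      simp [abs_of_pos Real.pi_pos, abs_of_pos hL]
      ring
    rw [norm_mul, norm_char, mul_one, norm_mul, this, mul_assoc]
  have h := hasDerivAt_tsum (𝕜 := ℝ) hu (g := fun k y => c k * char L k y)
    (g' := fun k y => 2 * Real.pi * Complex.I * k / L * c k * char L k y) (y₀ := x)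
    (fun k y => by
      have := (hasDerivAt_char L k y).const_mul (c k)
      rwa [← mul_assoc, mul_comm (c k)] at this) hb (summable_mul_char hc x) x
  exact (Complex.reCLM.hasFDerivAt.comp_hasDerivAt x h)

/-- The Hermitian symmetry of c makes the series real, so the real part in `synth` discards nothing.
Absolute summability allows termwise integration, and the characters are orthogonal. -/
theorem coeff_synth {L : ℝ} (hL : 0 < L) {c : ℤ → ℂ} (hc : Summable fun k => ‖c k‖)
    (hsym : ∀ k, c (-k) = (starRingEnd ℂ) (c k)) (k : ℤ) : coeff L (synth L c) k = c k := by
  have hL' : (L : ℂ) ≠ 0 := by exact_mod_cast hL.ne'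
  have hreal : ∀ x, ((synth L c x : ℝ) : ℂ) = ∑' j, c j * char L j x := by
    intro x
    rw [synth, ← Complex.conj_eq_iff_re, Complex.conj_tsum, ← (Equiv.neg ℤ).tsum_eq]
    refine tsum_congr fun j => ?_
    simp only [Equiv.neg_apply, map_mul, conj_char, hsym, Complex.conj_conj, neg_neg]
  let F : ℤ → C(ℝ, ℂ) := fun j =>
    ⟨fun x => c j * char L j x * char L (-k) x, by
      have := continuous_char L
      fun_prop⟩
  have hF := intervalIntegral.hasSum_intervalIntegral_of_summable_norm (a := 0) (b := L) (f := F) (by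
    refine Summable.of_nonneg_of_le (fun _ => norm_nonneg _) (fun j => ?_) hc
    refine (ContinuousMap.norm_le _ (norm_nonneg _)).2 fun x => ?_
    simp [F, norm_char])
  have hterm : ∀ j, ∫ x in (0 : ℝ)..L, F j x = if j = k then L * c k else 0 := by
    intro j
    have : ∀ x, F j x = c j * char L (j - k) x := fun x => by
      simp only [F, ContinuousMap.coe_mk, mul_assoc, char_mul, ← sub_eq_add_neg]
    simp only [this, intervalIntegral.integral_const_mul, integral_char hL, sub_eq_zero]
    split_ifs with h
    · rw [h, mul_comm]
    · simp
  simp only [hterm] at hF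
  have hF' := hF.unique (hasSum_ite_eq k (L * c k))
  rw [coeff_eq]
  have : ∀ x, ((synth L c x : ℝ) : ℂ) * char L (-k) x = ∑' j, F j x := by
    intro x
    rw [hreal, ← tsum_mul_right]
    rfl
  simp only [this]
  rw [hF']
  field_simp

theorem memLp_of_continuous {L : ℝ} {g : ℝ → ℝ} (hg : Continuous g) :
    MemLp g 2 (perMeasure L) := by
  obtain ⟨C, hC⟩ := (isCompact_Icc (a := 0) (b := L)).exists_bound_of_continuousOn hg.continuousOn
  refine MemLp.of_bound hg.aestronglyMeasurable C ?_
  filter_upwards [ae_restrict_mem measurableSet_Ioc] with x hx using hC x ⟨hx.1.le, hx.2⟩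

theorem ae_eq_synth {L : ℝ} (hL : 0 < L) {g : ℝ → ℝ} (hg : MemLp g 2 (perMeasure L))
    (hc : Summable fun k => ‖coeff L g k‖) : g =ᵐ[perMeasure L] synth L (coeff L g) :=
  ae_eq_of_coeff_eq hL hg (memLp_of_continuous (continuous_synth hc)) fun k =>
    (coeff_synth hL hc (coeff_neg_index g) k).symm

/-! ### Translations -/

/-- The translation `x ↦ x + q` of the circle, on its fundamental domain `(0, L]`. -/
def rotate (L q : ℝ) [hL : Fact (0 < L)] (x : ℝ) : ℝ :=
  (AddCircle.equivIoc L 0 ((x + q : ℝ) : AddCircle L) : ℝ)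

/-- An element of `L2per L` has meaningful values on (0, L] only, so a translation has to wrap
around. The map factors through the circle, and each factor preserves measure. -/
theorem measurePreserving_rotate (L q : ℝ) [hL : Fact (0 < L)] :
    MeasurePreserving (rotate L q) (perMeasure L) (perMeasure L) := by
  have h1 := AddCircle.measurePreserving_mk L 0
  have h2 := measurePreserving_add_right (volume : Measure (AddCircle L)) (q : AddCircle L)
  have h3 := AddCircle.measurePreserving_equivIoc (T := L) (a := 0)
  have h4 := measurePreserving_subtype_coe (μa := (volume : Measure ℝ))
    (measurableSet_Ioc (a := (0 : ℝ)) (b := 0 + L))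
  have h := h4.comp (h3.comp (h2.comp h1))
  have e : perMeasure L = volume.restrict (Ioc 0 (0 + L)) := by rw [zero_add]
  rw [e]
  exact h

theorem exists_rotate_eq (L q : ℝ) [hL : Fact (0 < L)] (x : ℝ) :
    ∃ n : ℤ, rotate L q x = x + q + n • L := by
  have h : ((rotate L q x : ℝ) : AddCircle L) = ((x + q : ℝ) : AddCircle L) :=
    (AddCircle.equivIoc L 0).symm_apply_apply _
  obtain ⟨n, hn⟩ := (QuotientAddGroup.eq_iff_sub_mem).1 h
  exact ⟨n, eq_add_of_sub_eq' hn.symm⟩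

theorem integral_comp_rotate {E : Type*} [NormedAddCommGroup E] [NormedSpace ℝ E] {L : ℝ} (q : ℝ)
    [hL : Fact (0 < L)] {F : ℝ → E} (hF : AEStronglyMeasurable F (perMeasure L)) :
    ∫ x in (0 : ℝ)..L, F (rotate L q x) = ∫ x in (0 : ℝ)..L, F x := by
  have h := measurePreserving_rotate L q
  rw [intervalIntegral.integral_of_le hL.out.le, intervalIntegral.integral_of_le hL.out.le,
    ← integral_map h.measurable.aemeasurable (by rwa [h.map_eq]), h.map_eq]

theorem coeff_comp_rotate {L : ℝ} (q : ℝ) [hL : Fact (0 < L)] {g : ℝ → ℝ}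
    (hg : AEStronglyMeasurable g (perMeasure L)) (k : ℤ) :
    coeff L (fun x => g (rotate L q x)) k = char L k q * coeff L g k := by
  have h := integral_comp_rotate q (F := fun x => (g x : ℂ) * char L (-k) x)
    ((Complex.continuous_ofReal.comp_aestronglyMeasurable hg).mul
      (continuous_char L (-k)).aestronglyMeasurable)
  rw [coeff_eq, coeff_eq, ← h, mul_left_comm, ← intervalIntegral.integral_const_mul (char L k q)]
  congr 1
  refine intervalIntegral.integral_congr fun x _ => ?_
  obtain ⟨n, hn⟩ := exists_rotate_eq L q x
  have : char L (-k) (rotate L q x) = char L (-k) x * char L (-k) q := by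
    rw [hn, char_add, char_add, char_zsmul hL.out, mul_one]
  have h1 : char L k q * char L (-k) q = 1 := by
    rw [char_mul, add_neg_cancel, char_zero]
  simp only [this]
  linear_combination (-(g (rotate L q x) : ℂ) * char L (-k) x) * h1

/-- Counterpart of `coeff_comp_rotate` for functions periodic on the whole line, such as the wave,
whose translates in `orbitDist` are not wrapped. -/
theorem coeff_comp_add {L : ℝ} (hL : 0 < L) {g : ℝ → ℝ} (hg : Function.Periodic g L)
    (q : ℝ) (k : ℤ) : coeff L (fun x => g (x + q)) k = char L k q * coeff L g k := by
  have hper : Function.Periodic (fun x => (g x : ℂ) * char L (-k) x) L := fun x => by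
    simp only [hg x, char_add, char_self hL, mul_one]
  have h1 : char L k q * char L (-k) q = 1 := by
    rw [char_mul, add_neg_cancel, char_zero]
  have h := hper.intervalIntegral_add_eq q 0
  rw [zero_add] at h
  have h2 := intervalIntegral.integral_comp_add_right (a := 0) (b := L)
    (fun x => (g x : ℂ) * char L (-k) x) q
  rw [zero_add, add_comm L q, h] at h2
  rw [coeff_eq, coeff_eq, ← h2, mul_left_comm, ← intervalIntegral.integral_const_mul (char L k q)]
  congr 1
  refine intervalIntegral.integral_congr fun x _ => ?_
  simp only [char_add]
  linear_combination (-(g (x + q) : ℂ) * char L (-k) x) * h1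

/-! ### The Hilbert space H^s: representatives and coefficients -/

namespace Hper

variable {L r s : ℝ} [hL : Fact (0 < L)]

theorem memLp (u : Hper L s) : MemLp u 2 (perMeasure L) := Lp.memLp u.toL2

theorem aestronglyMeasurable (u : Hper L s) : AEStronglyMeasurable u (perMeasure L) :=
  (memLp u).aestronglyMeasurable

theorem intervalIntegrable (u : Hper L s) : IntervalIntegrable u volume 0 L :=
  MemLp.intervalIntegrable_per hL.out u.memLp

theorem summable (u : Hper L s) :
    Summable fun k : ℤ => (1 + (k : ℝ) ^ 2) ^ s * ‖coeff L u k‖ ^ 2 := u.2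

theorem toL2_add (u v : Hper L s) : (u + v).toL2 = u.toL2 + v.toL2 := rfl

theorem toL2_zero : (0 : Hper L s).toL2 = 0 := rfl

theorem toL2_sub (u v : Hper L s) : (u - v).toL2 = u.toL2 - v.toL2 := rfl

theorem toL2_smul (c : ℝ) (u : Hper L s) : (c • u).toL2 = c • u.toL2 := rfl

theorem coe_add (u v : Hper L s) : ⇑(u + v).toL2 =ᵐ[perMeasure L] fun x => u x + v x := by
  rw [toL2_add]
  exact Lp.coeFn_add u.toL2 v.toL2

theorem coe_sub (u v : Hper L s) : ⇑(u - v).toL2 =ᵐ[perMeasure L] fun x => u x - v x := by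
  rw [toL2_sub]
  exact Lp.coeFn_sub u.toL2 v.toL2

theorem coe_smul (c : ℝ) (u : Hper L s) : ⇑(c • u).toL2 =ᵐ[perMeasure L] fun x => c * u x := by
  rw [toL2_smul]
  exact Lp.coeFn_smul c u.toL2

theorem coeff_add (u v : Hper L s) (k : ℤ) :
    coeff L (u + v).toL2 k = coeff L u k + coeff L v k := by
  rw [toL2_add]
  exact PeriodicWaves.coeff_add hL.out u.toL2 v.toL2 k

theorem coeff_smul (c : ℝ) (u : Hper L s) (k : ℤ) :
    coeff L (c • u).toL2 k = c * coeff L u k := by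
  rw [toL2_smul]
  exact PeriodicWaves.coeff_smul hL.out c u.toL2 k

theorem coeff_sub (u v : Hper L s) (k : ℤ) : coeff L (u - v).toL2 k = coeff L u k - coeff L v k := by
  rw [coeff_congr hL.out (coe_sub u v), coeff_fun_sub u.intervalIntegrable v.intervalIntegrable]

/-- The element of `H^s` with a given representative. -/
def ofFun (g : ℝ → ℝ) (hg : MemLp g 2 (perMeasure L))
    (hs : Summable fun k : ℤ => (1 + (k : ℝ) ^ 2) ^ s * ‖coeff L g k‖ ^ 2) : Hper L s :=
  ⟨hg.toLp g, by
    refine hs.congr fun k => ?_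
    rw [coeff_congr hL.out hg.coeFn_toLp]⟩

theorem toL2_ofFun (g : ℝ → ℝ) (hg : MemLp g 2 (perMeasure L))
    (hs : Summable fun k : ℤ => (1 + (k : ℝ) ^ 2) ^ s * ‖coeff L g k‖ ^ 2) :
    (ofFun g hg hs : Hper L s).toL2 = hg.toLp g := rfl

theorem coe_ofFun (g : ℝ → ℝ) (hg : MemLp g 2 (perMeasure L))
    (hs : Summable fun k : ℤ => (1 + (k : ℝ) ^ 2) ^ s * ‖coeff L g k‖ ^ 2) :
    ⇑(ofFun g hg hs).toL2 =ᵐ[perMeasure L] g := by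
  rw [toL2_ofFun]
  exact hg.coeFn_toLp

theorem coeff_ofFun (g : ℝ → ℝ) (hg : MemLp g 2 (perMeasure L))
    (hs : Summable fun k : ℤ => (1 + (k : ℝ) ^ 2) ^ s * ‖coeff L g k‖ ^ 2) (k : ℤ) :
    coeff L (ofFun g hg hs) k = coeff L g k := coeff_congr hL.out (coe_ofFun g hg hs) k

theorem ext_ae {u v : Hper L s} (h : ⇑u.toL2 =ᵐ[perMeasure L] v.toL2) : u = v :=
  Subtype.ext (Lp.ext h)

/-! ### The inner product -/

/-- The norm is pulled back along `toSeq`, and so is the inner product. The real part appears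
because ℓ² is complex while H^s is real. -/
instance : InnerProductSpace ℝ (Hper L s) where
  inner u v := (inner ℂ (toSeq u) (toSeq v)).re
  norm_sq_eq_re_inner u := by
    have h : ‖u‖ = ‖(toSeq u : lp (fun _ : ℤ => ℂ) 2)‖ := rfl
    rw [h]
    exact norm_sq_eq_re_inner (𝕜 := ℂ) (toSeq u : lp (fun _ : ℤ => ℂ) 2)
  conj_inner_symm u v := by
    rw [conj_trivial, ← inner_conj_symm, Complex.conj_re]
  add_left u v w := by
    rw [map_add, inner_add_left, Complex.add_re]
  smul_left u v c := by
    have h : (toSeq (c • u) : lp (fun _ : ℤ => ℂ) 2) = (c : ℂ) • toSeq u := by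
      rw [map_smul]
      rfl
    rw [h, inner_smul_left, Complex.conj_ofReal, Complex.re_ofReal_mul]
    rfl

theorem hasSum_inner (u v : Hper L s) :
    HasSum (fun k : ℤ => L * ((1 + (k : ℝ) ^ 2) ^ s *
      ((starRingEnd ℂ) (coeff L u k) * coeff L v k).re)) (inner ℝ u v) := by
  have h := Complex.hasSum_re (lp.hasSum_inner (𝕜 := ℂ) (toSeq u) (toSeq v))
  refine h.congr_fun fun k => ?_
  change _ = ((inner ℂ (weighted L s u k) (weighted L s v k))).re
  have hp : 0 ≤ L * (1 + (k : ℝ) ^ 2) ^ s := mul_nonneg hL.out.le (by positivity)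
  have hs : (Real.sqrt (L * (1 + (k : ℝ) ^ 2) ^ s) : ℂ) * Real.sqrt (L * (1 + (k : ℝ) ^ 2) ^ s)
      = ((L * (1 + (k : ℝ) ^ 2) ^ s : ℝ) : ℂ) := by
    rw [← Complex.ofReal_mul, Real.mul_self_sqrt hp]
  rw [RCLike.inner_apply, weighted, weighted, map_mul, Complex.conj_ofReal, mul_mul_mul_comm, hs,
    Complex.re_ofReal_mul, mul_comm (coeff L v k), mul_assoc]

theorem hasSum_norm_sq (u : Hper L s) :
    HasSum (fun k : ℤ => L * ((1 + (k : ℝ) ^ 2) ^ s * ‖coeff L u k‖ ^ 2)) (‖u‖ ^ 2) := by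
  have h := hasSum_inner u u
  rw [real_inner_self_eq_norm_sq] at h
  refine h.congr_fun fun k => ?_
  rw [← Complex.normSq_eq_conj_mul_self, Complex.ofReal_re, Complex.normSq_eq_norm_sq]

theorem inner_zero_eq (u v : Hper L 0) : inner ℝ u v = ∫ x in (0 : ℝ)..L, u x * v x := by
  have h := hasSum_inner u v
  simp only [Real.rpow_zero, one_mul] at h
  exact h.unique (parseval_inner hL.out u.memLp v.memLp)

theorem term_le_norm_sq (u : Hper L s) (k : ℤ) :
    L * ((1 + (k : ℝ) ^ 2) ^ s * ‖coeff L u k‖ ^ 2) ≤ ‖u‖ ^ 2 :=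
  le_hasSum u.hasSum_norm_sq k fun j _ => mul_nonneg hL.out.le (by positivity)

theorem norm_coeff_le (hs : 0 ≤ s) (u : Hper L s) (k : ℤ) :
    ‖coeff L u k‖ ≤ ‖u‖ / Real.sqrt L := by
  have h1 := u.term_le_norm_sq k
  have h2 : 1 ≤ (1 + (k : ℝ) ^ 2) ^ s := Real.one_le_rpow (by nlinarith [sq_nonneg (k : ℝ)]) hs
  have h3 : L * ‖coeff L u k‖ ^ 2 ≤ ‖u‖ ^ 2 :=
    (mul_le_mul_of_nonneg_left (le_mul_of_one_le_left (sq_nonneg _) h2) hL.out.le).trans h1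
  rw [le_div_iff₀ (Real.sqrt_pos.2 hL.out)]
  refine abs_le_of_sq_le_sq' ?_ (norm_nonneg _) |>.2
  rw [mul_pow, Real.sq_sqrt hL.out.le]
  linarith

/-! ### Inclusions -/

theorem ext_toL2 {u v : Hper L s} (h : u.toL2 = v.toL2) : u = v := Subtype.ext h

theorem exists_toL2_eq {u : L2per L} (h : u ∈ hperSubmodule L s) : ∃ v : Hper L s, v.toL2 = u :=
  ⟨⟨u, h⟩, rfl⟩

theorem mem_of_le (h : r ≤ s) (u : Hper L s) : u.toL2 ∈ hperSubmodule L r :=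
  u.summable.of_nonneg_of_le (fun k => by positivity) fun k => by
    have : (1 : ℝ) ≤ 1 + (k : ℝ) ^ 2 := by nlinarith [sq_nonneg (k : ℝ)]
    gcongr

/-- The function underlying the inclusion of `H^s` in `H^r`. -/
def inclFun (h : r ≤ s) (u : Hper L s) : Hper L r := ⟨u.toL2, mem_of_le h u⟩

theorem toL2_mk {w : L2per L} (hw : w ∈ hperSubmodule L s) :
    toL2 (⟨w, hw⟩ : Hper L s) = w := rfl

theorem toL2_inclFun (h : r ≤ s) (u : Hper L s) : (inclFun h u).toL2 = u.toL2 :=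
  toL2_mk (mem_of_le h u)

theorem norm_inclFun_le (h : r ≤ s) (u : Hper L s) : ‖inclFun h u‖ ≤ ‖u‖ := by
  have h1 := hasSum_norm_sq (inclFun h u)
  rw [toL2_inclFun] at h1
  have h2 := hasSum_norm_sq u
  generalize ‖inclFun h u‖ = a at h1 ⊢
  have ha : a ^ 2 ≤ ‖u‖ ^ 2 := by
    refine hasSum_le (fun k => ?_) h1 h2
    have : (1 : ℝ) ≤ 1 + (k : ℝ) ^ 2 := by nlinarith [sq_nonneg (k : ℝ)]
    have := hL.out.le
    gcongr
  exact (abs_le_of_sq_le_sq' ha (norm_nonneg u)).2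

theorem inclFun_add (h : r ≤ s) (u v : Hper L s) :
    inclFun h (u + v) = inclFun h u + inclFun h v := by
  apply ext_toL2
  rw [toL2_inclFun, toL2_add, toL2_add, toL2_inclFun, toL2_inclFun]

theorem inclFun_smul (h : r ≤ s) (c : ℝ) (u : Hper L s) :
    inclFun h (c • u) = c • inclFun h u := by
  apply ext_toL2
  rw [toL2_inclFun, toL2_smul, toL2_smul, toL2_inclFun]

/-- The inclusion of `H^s` in `H^r`, `r ≤ s`, as a linear map. -/
def inclLinear (h : r ≤ s) : Hper L s →ₗ[ℝ] Hper L r where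
  toFun := inclFun h
  map_add' := inclFun_add h
  map_smul' := inclFun_smul h

/-- The inclusion of `H^s` in `H^r` for `r ≤ s`. -/
def incl (h : r ≤ s) : Hper L s →L[ℝ] Hper L r :=
  (inclLinear h).mkContinuous 1 fun u => (norm_inclFun_le h u).trans_eq (one_mul _).symm

theorem incl_apply (h : r ≤ s) (u : Hper L s) : incl h u = inclFun h u := rfl

@[simp] theorem toL2_incl (h : r ≤ s) (u : Hper L s) : (incl h u).toL2 = u.toL2 := by
  rw [incl_apply, toL2_inclFun]

theorem norm_incl_le (h : r ≤ s) (u : Hper L s) : ‖incl h u‖ ≤ ‖u‖ := by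
  rw [incl_apply]
  exact norm_inclFun_le h u

theorem incl_injective (h : r ≤ s) : Function.Injective (incl (L := L) h) := fun u v huv =>
  ext_toL2 (by rw [← toL2_incl h u, huv, toL2_incl])

/-! ### Completeness -/

theorem norm_toL2 (hs : 0 ≤ s) (u : Hper L s) : ‖u.toL2‖ = ‖incl hs u‖ := by
  have h1 : ‖u.toL2‖ ^ 2 = ∫ x in (0 : ℝ)..L, u x * u x := by
    rw [← real_inner_self_eq_norm_sq, L2.inner_def, intervalIntegral.integral_of_le hL.out.le]
    refine integral_congr_ae (Eventually.of_forall fun x => ?_)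
    simp only [RCLike.inner_apply, conj_trivial]
  have h2 : ‖incl hs u‖ ^ 2 = ∫ x in (0 : ℝ)..L, u x * u x := by
    rw [← real_inner_self_eq_norm_sq, inner_zero_eq, toL2_incl]
  exact (pow_left_inj₀ (norm_nonneg _) (norm_nonneg _) two_ne_zero).1 (h1.trans h2.symm)

theorem tendsto_coeff {u : ℕ → L2per L} {v : L2per L} (h : Tendsto u atTop (𝓝 v)) (k : ℤ) :
    Tendsto (fun n => coeff L (u n) k) atTop (𝓝 (coeff L v k)) := by
  have hmem : ∀ w : L2per L, w ∈ hperSubmodule L 0 := fun w => by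
    have := (parseval hL.out (Lp.memLp w)).summable
    rw [summable_mul_left_iff hL.out.ne'] at this
    exact this.congr fun k => by rw [Real.rpow_zero, one_mul]
  choose e he using fun w => exists_toL2_eq (hmem w)
  rw [tendsto_iff_norm_sub_tendsto_zero] at h ⊢
  have h' := h.div_const (Real.sqrt L)
  rw [zero_div] at h'
  refine squeeze_zero (fun _ => norm_nonneg _) (fun n => ?_) h'
  have h1 := norm_coeff_le le_rfl (e (u n) - e v) k
  rw [coeff_sub, he, he] at h1
  have h2 := norm_toL2 le_rfl (e (u n) - e v)
  have h3 : (e (u n) - e v).toL2 = u n - v := by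
    rw [toL2_sub, he, he]
  rw [h3] at h2
  rw [h2]
  exact h1

/-- The range of `toSeq` is closed: a Cauchy sequence converges in ℓ² and also in L², and comparison
of coefficients shows that the ℓ² limit is the weighted coefficient sequence of the L² limit. -/
theorem completeSpace (hs : 0 ≤ s) : CompleteSpace (Hper L s) := by
  refine Metric.complete_of_cauchySeq_tendsto fun u hu => ?_
  have hiso : ∀ a b : Hper L s,
      ‖a - b‖ = ‖(toSeq a : lp (fun _ : ℤ => ℂ) 2) - toSeq b‖ := fun a b => by
    rw [← map_sub]
    rfl
  have h1 : CauchySeq fun n => (toSeq (u n) : lp (fun _ : ℤ => ℂ) 2) := by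
    rw [Metric.cauchySeq_iff] at hu ⊢
    simpa only [dist_eq_norm, hiso] using hu
  have h2 : CauchySeq fun n => (u n).toL2 := by
    rw [Metric.cauchySeq_iff] at hu ⊢
    refine fun ε hε => (hu ε hε).imp fun N hN m hm n hn => lt_of_le_of_lt ?_ (hN m hm n hn)
    rw [dist_eq_norm, dist_eq_norm]
    exact (norm_toL2 hs (u m - u n)).trans_le (norm_incl_le hs _)
  obtain ⟨a, ha⟩ := cauchySeq_tendsto_of_complete h1
  obtain ⟨b, hb⟩ := cauchySeq_tendsto_of_complete h2
  have hab : ∀ k, a k = weighted L s b k := fun k => by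
    have t1 : Tendsto (fun n => weighted L s (u n) k) atTop (𝓝 (a k)) := by
      have := (lp.uniformContinuous_coe (p := 2) (E := fun _ : ℤ => ℂ)).continuous.tendsto a
      exact ((continuous_apply k).tendsto _).comp (this.comp ha)
    exact tendsto_nhds_unique t1 ((tendsto_coeff hb k).const_mul _)
  have hmem : b ∈ hperSubmodule L s := by
    refine (memlp_weighted_iff hL.out s b).1 ?_
    rw [← funext hab]
    exact a.2
  obtain ⟨w, rfl⟩ := exists_toL2_eq hmem
  refine ⟨w, ?_⟩
  have : (toSeq w : lp (fun _ : ℤ => ℂ) 2) = a :=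
    Subtype.ext (funext fun k => (hab k).symm)
  rw [tendsto_iff_norm_sub_tendsto_zero] at ha ⊢
  simpa only [hiso, this] using ha

/-! ### Compactness of the inclusion in `L²` -/

theorem tendsto_weight_cofinite (hr : r < 0) :
    Tendsto (fun k : ℤ => (1 + (k : ℝ) ^ 2) ^ r) cofinite (𝓝 0) := by
  have h1 : Tendsto (fun k : ℤ => |(k : ℝ)|) cofinite atTop :=
    tendsto_norm_cocompact_atTop.comp Int.tendsto_coe_cofinite
  have h2 : Tendsto (fun k : ℤ => 1 + (k : ℝ) ^ 2) cofinite atTop := by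
    refine tendsto_atTop_mono (fun k => ?_) h1
    rw [← sq_abs (k : ℝ)]
    nlinarith [sq_nonneg (|(k : ℝ)| - 1), abs_nonneg (k : ℝ)]
  have h3 := (tendsto_rpow_neg_atTop (neg_pos.2 hr)).comp h2
  simpa only [neg_neg, Function.comp_def] using h3

/-- Quantitative core of Rellich's theorem: (1 + k²)^(-r) < ε off a finite set of frequencies, so
the high modes contribute at most ε‖w‖² to the L² norm. -/
theorem norm_incl_sq_le (hr : 0 < r) {ε : ℝ} (hε : 0 < ε) : ∃ F : Finset ℤ, ∀ w : Hper L r,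
    ‖incl hr.le w‖ ^ 2 ≤ ∑ k ∈ F, L * ‖coeff L w k‖ ^ 2 + ε * ‖w‖ ^ 2 := by
  have h := (tendsto_weight_cofinite (neg_lt_zero.2 hr)).eventually_lt_const hε
  rw [eventually_cofinite] at h
  refine ⟨h.toFinset, fun w => ?_⟩
  have h1 := (hasSum_sum_of_ne_finset_zero (s := h.toFinset)
    (f := fun k => if k ∈ h.toFinset then L * ‖coeff L w k‖ ^ 2 else 0)
    fun k hk => by simp only [hk, if_false]).add (w.hasSum_norm_sq.mul_left ε)
  have e : ∑ k ∈ h.toFinset, (if k ∈ h.toFinset then L * ‖coeff L w k‖ ^ 2 else 0)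
      = ∑ k ∈ h.toFinset, L * ‖coeff L w k‖ ^ 2 :=
    Finset.sum_congr rfl fun k hk => by simp only [hk, if_true]
  rw [e] at h1
  refine hasSum_le (fun k => ?_) (incl hr.le w).hasSum_norm_sq h1
  have hLp := hL.out
  have hpos : 0 < (1 + (k : ℝ) ^ 2) ^ r := by positivity
  rw [Real.rpow_zero, one_mul, toL2_incl]
  split_ifs with hk
  · exact le_add_of_nonneg_right (by positivity)
  · have hk' : (1 + (k : ℝ) ^ 2) ^ (-r) < ε := by simpa using hk
    rw [Real.rpow_neg (by positivity), inv_lt_iff_one_lt_mul₀ hpos] at hk'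
    rw [zero_add]
    have : 0 ≤ L * ‖coeff L w k‖ ^ 2 := by positivity
    nlinarith

/-- Rellich compactness. Bounded coefficient sequences lie in a compact product of discs, so a
subsequence converges at every frequency; `norm_incl_sq_le` makes the tails uniformly small. A
Cauchy subsequence is all that `IsGardingForm` requires. -/
theorem exists_subseq_cauchy (hr : 0 < r) (u : ℕ → Hper L r) {C : ℝ} (hC : ∀ n, ‖u n‖ ≤ C) :
    ∃ ψ : ℕ → ℕ, StrictMono ψ ∧ CauchySeq fun n => incl hr.le (u (ψ n)) := by
  have hK : IsCompact (Set.pi univ fun _ : ℤ => Metric.closedBall (0 : ℂ) (C / Real.sqrt L)) :=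
    isCompact_univ_pi fun _ => isCompact_closedBall _ _
  obtain ⟨a, -, ψ, hψ, ha⟩ := hK.tendsto_subseq (x := fun n k => coeff L (u n) k) fun n k _ => by
    rw [mem_closedBall_zero_iff]
    exact (norm_coeff_le hr.le (u n) k).trans (by gcongr; exact hC n)
  refine ⟨ψ, hψ, Metric.cauchySeq_iff.2 fun ε hε => ?_⟩
  have hC0 : 0 ≤ C := (norm_nonneg _).trans (hC 0)
  -- Differences of the sequence have norm at most 2C, so with this choice the tail costs at most
  -- ε²/2.
  obtain ⟨F, hF⟩ := norm_incl_sq_le (L := L) hr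
    (ε := ε ^ 2 / 2 / ((2 * C) ^ 2 + 1)) (by positivity)
  have hc : ∀ k, CauchySeq fun n => coeff L (u (ψ n)) k := fun k =>
    ((tendsto_pi_nhds.1 ha) k).cauchySeq
  have hsum : ∃ N, ∀ m ≥ N, ∀ n ≥ N,
      ∑ k ∈ F, L * ‖coeff L (u (ψ m)) k - coeff L (u (ψ n)) k‖ ^ 2 < ε ^ 2 / 2 := by
    have ht : Tendsto (fun p : ℕ × ℕ =>
        ∑ k ∈ F, L * ‖coeff L (u (ψ p.1)) k - coeff L (u (ψ p.2)) k‖ ^ 2) atTop (𝓝 0) := by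
      have h0 : Tendsto (fun p : ℕ × ℕ =>
          ∑ k ∈ F, L * ‖coeff L (u (ψ p.1)) k - coeff L (u (ψ p.2)) k‖ ^ 2) atTop
          (𝓝 (∑ k ∈ F, L * (0 : ℝ) ^ 2)) := by
        refine tendsto_finsetSum _ fun k _ => ((Tendsto.pow ?_ 2).const_mul L)
        simpa only [dist_eq_norm] using cauchySeq_iff_tendsto_dist_atTop_0.1 (hc k)
      simpa using h0
    have := ht.eventually_lt_const (show (0 : ℝ) < ε ^ 2 / 2 by positivity)
    rw [eventually_atTop_prod_self'] at this
    exact this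
  obtain ⟨N, hN⟩ := hsum
  refine ⟨N, fun m hm n hn => ?_⟩
  rw [dist_eq_norm, ← map_sub]
  refine lt_of_pow_lt_pow_left₀ 2 hε.le ((hF _).trans_lt ?_)
  have h1 := hN m hm n hn
  simp only [coeff_sub]
  have h2 : ‖u (ψ m) - u (ψ n)‖ ≤ 2 * C :=
    (norm_sub_le _ _).trans (by linarith [hC (ψ m), hC (ψ n)])
  have h3 : ε ^ 2 / 2 / ((2 * C) ^ 2 + 1) * ‖u (ψ m) - u (ψ n)‖ ^ 2 ≤ ε ^ 2 / 2 := by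
    rw [div_mul_eq_mul_div, div_le_iff₀ (by positivity)]
    refine mul_le_mul_of_nonneg_left ?_ (by positivity)
    nlinarith [norm_nonneg (u (ψ m) - u (ψ n))]
  linarith

/-! ### Summability of Fourier coefficients -/

theorem summable_weight {p : ℝ} (hp : 1 / 2 < p) :
    Summable fun k : ℤ => (1 + (k : ℝ) ^ 2) ^ (-p) := by
  -- With the convention 0^(-2p) = 0 the term k = 0 is not dominated by |k|^(-2p); the indicator of
  -- 0 supplies it.
  have h1 := (Real.summable_abs_int_rpow (b := 2 * p) (by linarith)).add
    (hasSum_ite_eq (0 : ℤ) (1 : ℝ)).summable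
  refine h1.of_nonneg_of_le (fun k => by positivity) fun k => ?_
  split_ifs with hk
  · subst hk
    simp only [Int.cast_zero]
    norm_num
    exact Real.rpow_nonneg le_rfl _
  · have hk' : 0 < |(k : ℝ)| := abs_pos.2 (by exact_mod_cast hk)
    rw [add_zero, ← mul_neg, Real.rpow_mul hk'.le, Real.rpow_two, sq_abs]
    refine Real.rpow_le_rpow_of_nonpos (by positivity) (by linarith) (by linarith)

/-- The constant in the bound of a weighted `ℓ¹` norm of the Fourier coefficients by the norm
of `H^r`. -/
theorem exists_summable_bound (L : ℝ) [hL : Fact (0 < L)] {a r : ℝ} (h : 2 * a + 1 / 2 < r) :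
    ∃ C, 0 < C ∧ ∀ u : Hper L r,
      (Summable fun k : ℤ => (1 + (k : ℝ) ^ 2) ^ a * ‖coeff L u k‖) ∧
      ∑' k : ℤ, (1 + (k : ℝ) ^ 2) ^ a * ‖coeff L u k‖ ≤ C * ‖u‖ := by
  have hw := summable_weight (p := r - 2 * a) (by linarith)
  set S := ∑' k : ℤ, (1 + (k : ℝ) ^ 2) ^ (-(r - 2 * a)) with hS
  have hLp := hL.out
  have hS0 : 0 ≤ S := tsum_nonneg fun k => by positivity
  refine ⟨Real.sqrt (S / L) + 1, by positivity, fun u => ?_⟩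
  have hu : HasSum (fun k : ℤ => (1 + (k : ℝ) ^ 2) ^ r * ‖coeff L u k‖ ^ 2) (‖u‖ ^ 2 / L) := by
    have := u.hasSum_norm_sq.div_const L
    simpa only [mul_div_cancel_left₀ _ hLp.ne'] using this
  -- The weight is split for Cauchy–Schwarz: the first factor is square summable because r − 2a >
  -- 1/2, the second because u is in H^r.
  have key : ∀ k : ℤ, (1 + (k : ℝ) ^ 2) ^ a * ‖coeff L u k‖ =
      (1 + (k : ℝ) ^ 2) ^ (-(r - 2 * a) / 2) * ((1 + (k : ℝ) ^ 2) ^ (r / 2) * ‖coeff L u k‖) := by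
    intro k
    rw [← mul_assoc, ← Real.rpow_add (by positivity)]
    ring_nf
  have e1 : ∀ k : ℤ, ((1 + (k : ℝ) ^ 2) ^ (-(r - 2 * a) / 2)) ^ (2 : ℝ)
      = (1 + (k : ℝ) ^ 2) ^ (-(r - 2 * a)) := fun k => by
    rw [← Real.rpow_mul (by positivity)]
    ring_nf
  have e2 : ∀ k : ℤ, ((1 + (k : ℝ) ^ 2) ^ (r / 2) * ‖coeff L u k‖) ^ (2 : ℝ)
      = (1 + (k : ℝ) ^ 2) ^ r * ‖coeff L u k‖ ^ 2 := fun k => by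
    rw [Real.mul_rpow (by positivity) (norm_nonneg _), ← Real.rpow_mul (by positivity),
      Real.rpow_two]
    ring_nf
  have hCS := Real.summable_and_inner_le_Lp_mul_Lq_tsum_of_nonneg (p := 2) (q := 2)
    (f := fun k : ℤ => (1 + (k : ℝ) ^ 2) ^ (-(r - 2 * a) / 2))
    (g := fun k : ℤ => (1 + (k : ℝ) ^ 2) ^ (r / 2) * ‖coeff L u k‖)
    (by rw [Real.holderConjugate_iff]; norm_num) (fun k => by positivity) (fun k => by positivity)
    (by simpa only [e1] using hw) (by simpa only [e2] using hu.summable)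
  simp only [e1, e2, ← key, ← hS, hu.tsum_eq] at hCS
  refine ⟨hCS.1, hCS.2.trans ?_⟩
  rw [← Real.sqrt_eq_rpow, ← Real.sqrt_eq_rpow, ← Real.sqrt_mul hS0, ← mul_div_assoc,
    mul_div_right_comm, Real.sqrt_mul (by positivity), Real.sqrt_sq (norm_nonneg _)]
  nlinarith [norm_nonneg u]

/-- Sobolev embedding: above order 1/2 the Fourier coefficients are absolutely summable, and their
ℓ¹ norm bounds the function. -/
theorem exists_sup_bound (L : ℝ) [hL : Fact (0 < L)] {r : ℝ} (h : 1 / 2 < r) :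
    ∃ C, 0 < C ∧ ∀ u : Hper L r, ∀ᵐ x ∂perMeasure L, |u x| ≤ C * ‖u‖ := by
  obtain ⟨C, hC, hu⟩ := exists_summable_bound L (a := 0) (r := r) (by linarith)
  refine ⟨C, hC, fun u => ?_⟩
  have h1 := hu u
  simp only [Real.rpow_zero, one_mul] at h1
  filter_upwards [ae_eq_synth hL.out u.memLp h1.1] with x hx
  rw [hx]
  exact (abs_synth_le h1.1 x).trans h1.2

/-! ### Trigonometric polynomials -/

/-- Real trigonometric polynomials with prescribed coefficients, used as test functions and as
approximants. The symmetry of F preserves the Hermitian symmetry under truncation. -/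
theorem exists_trigPoly (F : Finset ℤ) (hF : ∀ k ∈ F, -k ∈ F) (c : ℤ → ℂ)
    (hc : ∀ k, c (-k) = (starRingEnd ℂ) (c k)) :
    ∃ g : L2per L, (∀ s, g ∈ hperSubmodule L s) ∧ (∃ C, ∀ᵐ x ∂perMeasure L, |g x| ≤ C) ∧
      ∀ k, coeff L g k = if k ∈ F then c k else 0 := by
  set d : ℤ → ℂ := fun k => if k ∈ F then c k else 0 with hd
  have hsym : ∀ k, d (-k) = (starRingEnd ℂ) (d k) := fun k => by
    by_cases hk : k ∈ F
    · simp only [hd, hk, hF k hk, if_true, hc]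
    · have : -k ∉ F := fun h => hk (by simpa using hF _ h)
      simp only [hd, hk, this, if_false, map_zero]
  have hsum : Summable fun k => ‖d k‖ :=
    summable_of_ne_finset_zero (s := F) fun k hk => by simp only [hd, hk, if_false, norm_zero]
  have hm := memLp_of_continuous (L := L) (continuous_synth (L := L) hsum)
  have hco : ∀ k, coeff L (hm.toLp _) k = d k := fun k => by
    rw [coeff_congr hL.out hm.coeFn_toLp, coeff_synth hL.out hsum hsym]
  refine ⟨hm.toLp _, fun s => ?_, ⟨∑' k, ‖d k‖, ?_⟩, hco⟩
  · refine summable_of_ne_finset_zero (s := F) fun k hk => ?_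
    rw [hco]
    simp only [hd, hk, if_false, norm_zero]
    ring
  · filter_upwards [hm.coeFn_toLp] with x hx
    rw [hx]
    exact abs_synth_le hsum x

/-- Bounded functions all of whose Sobolev norms are finite are dense in `H^s`. -/
theorem exists_approx (u : Hper L s) {ε : ℝ} (hε : 0 < ε) : ∃ v : Hper L s,
    (∀ r, v.toL2 ∈ hperSubmodule L r) ∧ (∃ C, ∀ᵐ x ∂perMeasure L, |v x| ≤ C) ∧ ‖v - u‖ < ε := by
  have hsum := u.hasSum_norm_sq
  have htend : Tendsto (fun F : Finset ℤ =>
      ∑ k ∈ F, L * ((1 + (k : ℝ) ^ 2) ^ s * ‖coeff L u k‖ ^ 2)) atTop (𝓝 (‖u‖ ^ 2)) := hsum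
  obtain ⟨F₀, hF₀⟩ := ((tendsto_order.1 htend).1 (‖u‖ ^ 2 - ε ^ 2)
    (sub_lt_self _ (by positivity))).exists_forall_of_atTop
  -- The frequency set is symmetrized to keep the truncation real; enlarging it can only shrink the
  -- tail.
  set F := F₀ ∪ F₀.image (fun k => -k) with hF
  have hsub := hF₀ F Finset.subset_union_left
  obtain ⟨g, hg, hb, hco⟩ := exists_trigPoly (L := L) F (fun k hk => by
    simp only [hF, Finset.mem_union, Finset.mem_image] at hk ⊢
    rcases hk with hk | ⟨j, hj, rfl⟩
    · exact Or.inr ⟨k, hk, rfl⟩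
    · exact Or.inl (by simpa using hj)) (coeff L u) (coeff_neg_index u)
  obtain ⟨v, rfl⟩ := exists_toL2_eq (hg s)
  refine ⟨v, hg, hb, lt_of_pow_lt_pow_left₀ 2 hε.le ?_⟩
  have h1 := hasSum_sum_of_ne_finset_zero (L := SummationFilter.unconditional ℤ) (s := F)
    (f := fun k => if k ∈ F then L * ((1 + (k : ℝ) ^ 2) ^ s * ‖coeff L u k‖ ^ 2) else 0)
    fun k hk => by simp only [hk, if_false]
  have e : ∑ k ∈ F, (if k ∈ F then L * ((1 + (k : ℝ) ^ 2) ^ s * ‖coeff L u k‖ ^ 2) else 0)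
      = ∑ k ∈ F, L * ((1 + (k : ℝ) ^ 2) ^ s * ‖coeff L u k‖ ^ 2) :=
    Finset.sum_congr rfl fun k hk => by simp only [hk, if_true]
  rw [e] at h1
  have h2 := (v - u).hasSum_norm_sq.unique ((hsum.sub h1).congr_fun fun k => by
    rw [coeff_sub, hco]
    split_ifs
    · simp
    · simp)
  rw [h2]
  linarith

/-! ### Translations -/

theorem exists_rotation (q : ℝ) (u : Hper L s) : ∃ v : Hper L s,
    (⇑v.toL2 =ᵐ[perMeasure L] fun x => u (rotate L q x)) ∧
      ∀ k, coeff L v k = char L k q * coeff L u k := by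
  have hco := coeff_comp_rotate (L := L) q u.aestronglyMeasurable
  have hm : MemLp (fun x => u (rotate L q x)) 2 (perMeasure L) :=
    u.memLp.comp_measurePreserving (measurePreserving_rotate L q)
  refine ⟨ofFun _ hm ?_, coe_ofFun _ _ _, fun k => (coeff_ofFun _ _ _ k).trans (hco k)⟩
  refine u.summable.congr fun k => ?_
  rw [hco, norm_mul, norm_char, one_mul]

end Hper

/-! ### Quadratic forms bounded below relative to a compact embedding -/

theorem eq_zero_of_forall_quadratic_nonneg {a b : ℝ} (h : ∀ t : ℝ, 0 ≤ 2 * t * a + t ^ 2 * b) :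
    a = 0 := by
  have h1 := discrim_le_zero (a := b) (b := 2 * a) (c := 0) fun t => by nlinarith [h t]
  simp only [discrim, mul_zero, sub_zero] at h1
  nlinarith [sq_nonneg (2 * a)]

theorem sq_le_mul_of_forall_quadratic_nonneg {a b c : ℝ}
    (h : ∀ t : ℝ, 0 ≤ a + 2 * t * b + t ^ 2 * c) : b ^ 2 ≤ a * c := by
  have h1 := discrim_le_zero (a := c) (b := 2 * b) (c := a) fun t => by nlinarith [h t]
  simp only [discrim] at h1
  nlinarith

/-- A symmetric continuous bilinear form `B` on `V` which satisfies a Gårding inequality with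
respect to a compact embedding `ι : V → H`. -/
structure IsGardingForm {V H : Type*} [NormedAddCommGroup V] [InnerProductSpace ℝ V]
    [NormedAddCommGroup H] [InnerProductSpace ℝ H] (ι : V →L[ℝ] H) (B : V →L[ℝ] V →L[ℝ] ℝ)
    (c₁ c₂ : ℝ) : Prop where
  symm : ∀ u v, B u v = B v u
  pos : 0 < c₁
  nonneg : 0 ≤ c₂
  garding : ∀ v, c₁ * ‖v‖ ^ 2 ≤ B v v + c₂ * ‖ι v‖ ^ 2
  compact : ∀ (u : ℕ → V) (C : ℝ), (∀ n, ‖u n‖ ≤ C) →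
    ∃ ψ : ℕ → ℕ, StrictMono ψ ∧ CauchySeq fun n => ι (u (ψ n))

namespace IsGardingForm

variable {V H : Type*} [NormedAddCommGroup V] [InnerProductSpace ℝ V]
  [NormedAddCommGroup H] [InnerProductSpace ℝ H] {ι : V →L[ℝ] H} {B : V →L[ℝ] V →L[ℝ] ℝ}
  {c₁ c₂ : ℝ}

theorem apply_add (h : IsGardingForm ι B c₁ c₂) (u v : V) :
    B (u + v) (u + v) = B u u + 2 * B u v + B v v := by
  simp only [map_add, add_apply]
  rw [h.symm v u]
  ring

theorem apply_add_smul (h : IsGardingForm ι B c₁ c₂) (u v : V) (t : ℝ) :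
    B (u + t • v) (u + t • v) = B u u + 2 * t * B u v + t ^ 2 * B v v := by
  rw [h.apply_add]
  simp only [map_smul, smul_apply, smul_eq_mul]
  ring

theorem norm_add_smul_sq (u v : H) (t : ℝ) :
    ‖u + t • v‖ ^ 2 = ‖u‖ ^ 2 + 2 * t * inner ℝ u v + t ^ 2 * ‖v‖ ^ 2 := by
  rw [norm_add_sq_real, inner_smul_right, norm_smul, mul_pow, Real.norm_eq_abs, sq_abs]
  ring

/-- Direct method for the Rayleigh quotient. The Gårding inequality bounds a minimizing sequence in
V, compactness makes a subsequence Cauchy in H, and the parallelogram law then makes it Cauchy in V,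
so no weak limits are needed. -/
theorem exists_isMinOn [CompleteSpace V] (h : IsGardingForm ι B c₁ c₂) (S : Submodule ℝ V)
    (hS : IsClosed (S : Set V)) (hne : ∃ v ∈ S, ι v ≠ 0) :
    ∃ w ∈ S, ‖ι w‖ = 1 ∧ ∀ v ∈ S, B w w * ‖ι v‖ ^ 2 ≤ B v v := by
  set X : Set ℝ := (fun v => B v v) '' {v | v ∈ S ∧ ‖ι v‖ = 1} with hX
  have hscale : ∀ v ∈ S, ι v ≠ 0 → ‖ι v‖⁻¹ • v ∈ S ∧ ‖ι (‖ι v‖⁻¹ • v)‖ = 1 := fun v hv hv0 =>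
    ⟨S.smul_mem _ hv, by
      rw [map_smul, norm_smul, norm_inv, norm_norm, inv_mul_cancel₀ (norm_ne_zero_iff.2 hv0)]⟩
  have hXne : X.Nonempty := by
    obtain ⟨v, hv, hv0⟩ := hne
    exact ⟨_, _, hscale v hv hv0, rfl⟩
  have hXb : BddBelow X := by
    refine ⟨-c₂, ?_⟩
    rintro _ ⟨v, ⟨-, hv⟩, rfl⟩
    have := h.garding v
    rw [hv] at this
    have := h.pos
    change -c₂ ≤ B v v
    nlinarith [mul_nonneg h.pos.le (sq_nonneg ‖v‖)]
  set μ := sInf X with hμ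
  have hmin : ∀ v ∈ S, μ * ‖ι v‖ ^ 2 ≤ B v v := by
    intro v hv
    by_cases hv0 : ι v = 0
    · have := h.garding v
      rw [hv0, norm_zero] at this ⊢
      nlinarith [mul_nonneg h.pos.le (sq_nonneg ‖v‖)]
    · have h1 : μ ≤ B (‖ι v‖⁻¹ • v) (‖ι v‖⁻¹ • v) := csInf_le hXb ⟨_, hscale v hv hv0, rfl⟩
      simp only [map_smul, smul_apply, smul_eq_mul] at h1
      have hp : 0 < ‖ι v‖ := norm_pos_iff.2 hv0
      calc μ * ‖ι v‖ ^ 2 ≤ ‖ι v‖⁻¹ * (‖ι v‖⁻¹ * B v v) * ‖ι v‖ ^ 2 := by gcongr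
        _ = B v v := by field_simp
  obtain ⟨x, -, hxlim, hxX⟩ := exists_seq_tendsto_sInf hXne hXb
  choose w hw hwx using hxX
  have hlim : Tendsto (fun n => B (w n) (w n)) atTop (𝓝 μ) := by
    simpa only [hwx] using hxlim
  obtain ⟨M, hM⟩ := hlim.bddAbove_range
  have hbdd : ∀ n, ‖w n‖ ≤ Real.sqrt ((M + c₂) / c₁) := fun n => by
    refine Real.le_sqrt_of_sq_le ?_
    rw [le_div_iff₀ h.pos]
    have h1 := h.garding (w n)
    rw [(hw n).2] at h1
    have h2 : B (w n) (w n) ≤ M := hM ⟨n, rfl⟩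
    linarith
  obtain ⟨ψ, hψ, hcau⟩ := h.compact w _ hbdd
  set z := fun n => w (ψ n) with hz
  have hzlim : Tendsto (fun n => B (z n) (z n)) atTop (𝓝 μ) := hlim.comp hψ.tendsto_atTop
  -- By the parallelogram law, B at the difference is 2B(z n) + 2B(z m) minus B at the sum. The
  -- latter is at least μ‖ι(z n + z m)‖² = μ(4 − ‖ι(z n) − ι(z m)‖²); Gårding does the rest.
  have hkey : ∀ n m, c₁ * ‖z n - z m‖ ^ 2 ≤ 2 * (B (z n) (z n) - μ) + 2 * (B (z m) (z m) - μ)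
      + (μ + c₂) * ‖ι (z n) - ι (z m)‖ ^ 2 := by
    intro n m
    have h1 := h.garding (z n - z m)
    have h2 := hmin (z n + z m) (S.add_mem (hw _).1 (hw _).1)
    have h3 : B (z n - z m) (z n - z m)
        = 2 * B (z n) (z n) + 2 * B (z m) (z m) - B (z n + z m) (z n + z m) := by
      simp only [map_add, map_sub, add_apply, sub_apply]
      ring
    have h4 := parallelogram_law_with_norm ℝ (ι (z n)) (ι (z m))
    rw [map_add ι] at h2
    rw [map_sub ι] at h1
    have h5 : ‖ι (z n)‖ = 1 := (hw _).2
    have h6 : ‖ι (z m)‖ = 1 := (hw _).2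
    rw [h5, h6] at h4
    have h7 : ‖ι (z n) + ι (z m)‖ ^ 2 = 4 - ‖ι (z n) - ι (z m)‖ ^ 2 := by linarith
    rw [h7] at h2
    linarith
  have hcauV : CauchySeq z := by
    rw [cauchySeq_iff_tendsto_dist_atTop_0] at hcau ⊢
    have hr : Tendsto (fun p : ℕ × ℕ => (2 * (B (z p.1) (z p.1) - μ) + 2 * (B (z p.2) (z p.2) - μ)
        + (μ + c₂) * ‖ι (z p.1) - ι (z p.2)‖ ^ 2) / c₁) atTop (𝓝 0) := by
      have e : (0 : ℝ) = (2 * (μ - μ) + 2 * (μ - μ) + (μ + c₂) * 0 ^ 2) / c₁ := by simp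
      rw [e]
      rw [← prod_atTop_atTop_eq] at hcau ⊢
      refine Tendsto.div_const (((((hzlim.comp tendsto_fst).sub_const μ).const_mul 2).add
        (((hzlim.comp tendsto_snd).sub_const μ).const_mul 2)).add
        (Tendsto.const_mul _ (Tendsto.pow ?_ 2))) c₁
      simpa only [dist_eq_norm] using hcau
    have hr2 := hr.sqrt
    rw [Real.sqrt_zero] at hr2
    refine squeeze_zero (fun _ => dist_nonneg) (fun p => ?_) hr2
    rw [dist_eq_norm]
    refine Real.le_sqrt_of_sq_le ?_
    rw [le_div_iff₀ h.pos, mul_comm]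
    exact hkey p.1 p.2
  obtain ⟨w', hw'⟩ := cauchySeq_tendsto_of_complete hcauV
  have hwS : w' ∈ S := hS.mem_of_tendsto hw' (Eventually.of_forall fun n => (hw _).1)
  have hw1 : ‖ι w'‖ = 1 := by
    have t : Tendsto (fun n => ‖ι (z n)‖) atTop (𝓝 ‖ι w'‖) :=
      ((ι.continuous.tendsto w').comp hw').norm
    have e : (fun n => ‖ι (z n)‖) = fun _ => 1 := funext fun n => (hw _).2
    rw [e] at t
    exact tendsto_nhds_unique t tendsto_const_nhds |>.symm ▸ rfl
  have hBw : B w' w' = μ := by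
    have t : Tendsto (fun n => B (z n) (z n)) atTop (𝓝 (B w' w')) := by
      have hc : Continuous fun v => B v v := by fun_prop
      exact (hc.tendsto w').comp hw'
    exact tendsto_nhds_unique t hzlim
  exact ⟨w', hwS, hw1, fun v hv => hBw ▸ hmin v hv⟩

/-- Euler–Lagrange equation: along w + t z the defect of the minimality inequality is a nonnegative
quadratic in t without constant term, so its linear coefficient vanishes. -/
theorem apply_eq_of_isMinOn (h : IsGardingForm ι B c₁ c₂) {S : Submodule ℝ V} {w : V}
    (hw : w ∈ S) (hw1 : ‖ι w‖ = 1) (hmin : ∀ v ∈ S, B w w * ‖ι v‖ ^ 2 ≤ B v v) {z : V}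
    (hz : z ∈ S) : B w z = B w w * inner ℝ (ι w) (ι z) := by
  refine sub_eq_zero.1 (eq_zero_of_forall_quadratic_nonneg
    (b := B z z - B w w * ‖ι z‖ ^ 2) fun t => ?_)
  have h1 := hmin (w + t • z) (S.add_mem hw (S.smul_mem t hz))
  rw [h.apply_add_smul, map_add, map_smul, norm_add_smul_sq, hw1] at h1
  linarith

/-- If `χ` spans the eigenspaces with negative eigenvalues and `e` the kernel, the form is
positive on the orthogonal complement of `χ` and `e`. -/
theorem exists_pos_lower_bound [CompleteSpace V] (h : IsGardingForm ι B c₁ c₂) {e χ : V} {lam : ℝ}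
    (he : ∀ v, B e v = 0) (he0 : ι e ≠ 0)
    (hχ : ∀ v, B χ v = lam * inner ℝ (ι χ) (ι v)) (hlam : lam < 0) (hχ0 : ι χ ≠ 0)
    (hneg : ∀ μ < 0, ∀ w, (∀ z, B w z = μ * inner ℝ (ι w) (ι z)) → ∃ c : ℝ, w = c • χ)
    (hzero : ∀ w, (∀ z, B w z = 0) → ∃ c : ℝ, w = c • e) :
    ∃ κ > 0, ∀ w, inner ℝ (ι w) (ι χ) = 0 → inner ℝ (ι w) (ι e) = 0 → κ * ‖ι w‖ ^ 2 ≤ B w w := by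
  let S : Submodule ℝ V :=
    { carrier := {w | inner ℝ (ι w) (ι χ) = 0 ∧ inner ℝ (ι w) (ι e) = 0}
      add_mem' := fun {u v} hu hv => by
        simp only [mem_ofPred_eq, map_add, inner_add_left] at hu hv ⊢
        rw [hu.1, hu.2, hv.1, hv.2]
        simp
      zero_mem' := by simp
      smul_mem' := fun c u hu => by
        simp only [mem_ofPred_eq, map_smul, inner_smul_left] at hu ⊢
        rw [hu.1, hu.2]
        simp }
  have hSc : IsClosed (S : Set V) := by
    have c1 : Continuous fun w => inner ℝ (ι w) (ι χ) := by fun_prop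
    have c2 : Continuous fun w => inner ℝ (ι w) (ι e) := by fun_prop
    exact (isClosed_eq c1 continuous_const).inter (isClosed_eq c2 continuous_const)
  by_cases hne : ∃ v ∈ S, ι v ≠ 0
  · obtain ⟨w, hw, hw1, hmin⟩ := h.exists_isMinOn S hSc hne
    have hχe : inner ℝ (ι χ) (ι e) = 0 := by
      have := hχ e
      rw [h.symm, he] at this
      exact (mul_eq_zero.1 this.symm).resolve_left hlam.ne
    -- Minimality tests only against S. The directions χ and e add nothing, since both sides vanish
    -- there by orthogonality, so w is a weak eigenvector on all of V. A minimum ≤ 0 would then make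
    -- w a multiple of χ or of e, to both of which it is orthogonal.
    have heul : ∀ z, B w z = B w w * inner ℝ (ι w) (ι z) := by
      intro z
      set α := inner ℝ (ι z) (ι χ) / ‖ι χ‖ ^ 2 with hα
      set β := inner ℝ (ι z) (ι e) / ‖ι e‖ ^ 2 with hβ
      have n1 : ‖ι χ‖ ^ 2 ≠ 0 := pow_ne_zero 2 (norm_ne_zero_iff.2 hχ0)
      have n2 : ‖ι e‖ ^ 2 ≠ 0 := pow_ne_zero 2 (norm_ne_zero_iff.2 he0)
      have hz : z - α • χ - β • e ∈ S := by
        constructor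
        · simp only [map_sub, map_smul, inner_sub_left, inner_smul_left, conj_trivial,
            real_inner_self_eq_norm_sq, real_inner_comm (ι χ) (ι e), hχe, hα]
          field_simp
          ring
        · simp only [map_sub, map_smul, inner_sub_left, inner_smul_left, conj_trivial,
            real_inner_self_eq_norm_sq, hχe, hβ]
          field_simp
          ring
      have h1 := h.apply_eq_of_isMinOn hw hw1 hmin hz
      simp only [map_sub, map_smul, smul_eq_mul, inner_sub_right, inner_smul_right, hw.1, hw.2,
        h.symm w χ, h.symm w e, he, hχ, real_inner_comm (ι w) (ι χ)] at h1
      linarith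
    refine ⟨B w w, ?_, fun v h1 h2 => hmin v ⟨h1, h2⟩⟩
    by_contra hcon
    rcases (not_lt.1 hcon).lt_or_eq with hlt | heq
    · obtain ⟨c, hc⟩ := hneg _ hlt w heul
      have h1 := hw.1
      rw [hc, map_smul, inner_smul_left, real_inner_self_eq_norm_sq, mul_eq_zero] at h1
      rcases h1 with h1 | h1
      · have : c = 0 := h1
        rw [hc, this, zero_smul, map_zero, norm_zero] at hw1
        exact zero_ne_one hw1
      · exact hχ0 (norm_eq_zero.1 (pow_eq_zero_iff two_ne_zero |>.1 h1))
    · obtain ⟨c, hc⟩ := hzero w fun z => by rw [heul, heq, zero_mul]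
      have h1 := hw.2
      rw [hc, map_smul, inner_smul_left, real_inner_self_eq_norm_sq, mul_eq_zero] at h1
      rcases h1 with h1 | h1
      · have : c = 0 := h1
        rw [hc, this, zero_smul, map_zero, norm_zero] at hw1
        exact zero_ne_one hw1
      · exact he0 (norm_eq_zero.1 (pow_eq_zero_iff two_ne_zero |>.1 h1))
  · push Not at hne
    refine ⟨1, one_pos, fun w h1 h2 => ?_⟩
    have h3 := h.garding w
    rw [hne w ⟨h1, h2⟩, norm_zero] at h3 ⊢
    nlinarith [mul_nonneg h.pos.le (sq_nonneg ‖w‖)]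

-- Decompose η = q + βχ + γe and z = p + αχ with p, q in the positive subspace, and put n = −B(χ,χ).
-- Then B(q,q) = nβ² − Δ, and the constraint B(η,z) = 0 reads B(p,q) = nαβ. Cauchy–Schwarz for B
-- gives n²α²β² ≤ B(p,p)(nβ² − Δ), that is nα² ≤ (1 − ϑ)B(p,p) with ϑ = Δ/(nβ²). Hence B(z,z) =
-- B(p,p) − nα² ≥ ϑB(p,p).
set_option maxHeartbeats 800000 in
theorem exists_pos_on_constraint [CompleteSpace V] (h : IsGardingForm ι B c₁ c₂) {e χ η : V}
    {y : H} {lam κ : ℝ}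
    (he : ∀ v, B e v = 0) (he0 : ι e ≠ 0)
    (hχ : ∀ v, B χ v = lam * inner ℝ (ι χ) (ι v)) (hlam : lam < 0) (hχ0 : ι χ ≠ 0)
    (hκ : 0 < κ)
    (hpos : ∀ w, inner ℝ (ι w) (ι χ) = 0 → inner ℝ (ι w) (ι e) = 0 → κ * ‖ι w‖ ^ 2 ≤ B w w)
    (hη : ∀ v, B η v = -inner ℝ y (ι v)) (hΔ : 0 < inner ℝ y (ι η)) :
    ∃ ε > 0, ∀ z, inner ℝ y (ι z) = 0 → inner ℝ (ι z) (ι e) = 0 → ε * ‖ι z‖ ^ 2 ≤ B z z := by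
  have hχe : inner ℝ (ι χ) (ι e) = 0 := by
    have := hχ e
    rw [h.symm, he] at this
    exact (mul_eq_zero.1 this.symm).resolve_left hlam.ne
  have hN : 0 < ‖ι χ‖ ^ 2 := by positivity
  have hE : 0 < ‖ι e‖ ^ 2 := by positivity
  set N := ‖ι χ‖ ^ 2 with hNdef
  set Δ := inner ℝ y (ι η) with hΔdef
  set n := -lam * N with hn
  have hn0 : 0 < n := mul_pos (neg_pos.2 hlam) hN
  set β := inner ℝ (ι η) (ι χ) / N with hβ
  set γ := inner ℝ (ι η) (ι e) / ‖ι e‖ ^ 2 with hγ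
  set q := η - β • χ - γ • e with hq
  have hβN : inner ℝ (ι η) (ι χ) = β * N := by rw [hβ]; field_simp
  have hγE : inner ℝ (ι η) (ι e) = γ * ‖ι e‖ ^ 2 := by rw [hγ]; field_simp
  have hq1 : inner ℝ (ι q) (ι χ) = 0 := by
    simp only [hq, map_sub, map_smul, inner_sub_left, inner_smul_left, conj_trivial,
      real_inner_self_eq_norm_sq, real_inner_comm (ι χ) (ι e), hχe, ← hNdef, hβN]
    ring
  have hq2 : inner ℝ (ι q) (ι e) = 0 := by
    simp only [hq, map_sub, map_smul, inner_sub_left, inner_smul_left, conj_trivial,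
      real_inner_self_eq_norm_sq, hχe, hγE]
    ring
  have hBχχ : B χ χ = -n := by
    rw [hχ, real_inner_self_eq_norm_sq, hn]
    ring
  have hηdec : η = q + β • χ + γ • e := by
    rw [hq]
    abel
  have hQ : B q q = n * β ^ 2 - Δ := by
    have h1 : B η η = -Δ := by rw [hη]
    have h2 : B η η = B q q + β ^ 2 * B χ χ := by
      conv_lhs => rw [hηdec]
      simp only [map_add, map_smul, add_apply, smul_apply,
        smul_eq_mul, h.symm q χ, h.symm q e, h.symm χ e, he, hχ χ, hχ q,
        real_inner_comm (ι q) (ι χ), hq1]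
      ring
    rw [hBχχ] at h2
    linarith
  have hQ0 : 0 ≤ B q q := (by positivity : 0 ≤ κ * ‖ι q‖ ^ 2).trans (hpos q hq1 hq2)
  -- B is nonnegative at q while Δ > 0: η must have a component along χ, so the division defining ϑ
  -- is legitimate.
  have hβ0 : 0 < n * β ^ 2 := by linarith
  set ϑ := Δ / (n * β ^ 2) with hϑ
  have hϑ0 : 0 < ϑ := div_pos hΔ hβ0
  have hS0 : 0 < (-lam)⁻¹ + κ⁻¹ := add_pos (inv_pos.2 (neg_pos.2 hlam)) (inv_pos.2 hκ)
  -- The denominator comes from ‖ιz‖² = ‖ιp‖² + α²N, whose terms are at most κ⁻¹B(p,p) and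
  -- (−lam)⁻¹B(p,p).
  refine ⟨ϑ / ((-lam)⁻¹ + κ⁻¹), div_pos hϑ0 hS0, fun z hz1 hz2 => ?_⟩
  set α := inner ℝ (ι z) (ι χ) / N with hα
  set p := z - α • χ with hp
  have hαN : inner ℝ (ι z) (ι χ) = α * N := by rw [hα]; field_simp
  have hp1 : inner ℝ (ι p) (ι χ) = 0 := by
    simp only [hp, map_sub, map_smul, inner_sub_left, inner_smul_left, conj_trivial,
      real_inner_self_eq_norm_sq, ← hNdef, hαN]
    ring
  have hp2 : inner ℝ (ι p) (ι e) = 0 := by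
    simp only [hp, map_sub, map_smul, inner_sub_left, inner_smul_left, conj_trivial, hχe, hz2]
    ring
  have hzdec : z = p + α • χ := by
    rw [hp]
    abel
  have hBz : B z z = B p p - n * α ^ 2 := by
    conv_lhs => rw [hzdec]
    rw [h.apply_add_smul, h.symm p χ, hχ p, real_inner_comm (ι p) (ι χ), hp1, hBχχ]
    ring
  have hBpq : B p q = n * (α * β) := by
    have h1 : B η z = 0 := by rw [hη, hz1, neg_zero]
    rw [hηdec, hzdec] at h1
    simp only [map_add, map_smul, add_apply, smul_apply,
      smul_eq_mul, h.symm q χ, h.symm q p, he, hBχχ, hχ q, hχ p,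
      real_inner_comm (ι q) (ι χ), real_inner_comm (ι p) (ι χ), hq1, hp1] at h1
    linarith
  have hP0 : κ * ‖ι p‖ ^ 2 ≤ B p p := hpos p hp1 hp2
  have hCS : (n * (α * β)) ^ 2 ≤ B p p * B q q := by
    rw [← hBpq]
    refine sq_le_mul_of_forall_quadratic_nonneg fun t => ?_
    rw [← h.apply_add_smul]
    refine (by positivity : 0 ≤ κ * ‖ι (p + t • q)‖ ^ 2).trans (hpos _ ?_ ?_)
    · rw [map_add, map_smul, inner_add_left, inner_smul_left, hp1, hq1, mul_zero, add_zero]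
    · rw [map_add, map_smul, inner_add_left, inner_smul_left, hp2, hq2, mul_zero, add_zero]
  rw [hQ] at hCS
  have hα2 : n * α ^ 2 ≤ B p p * (1 - ϑ) := by
    have h1 : B p p * (1 - ϑ) = B p p * (n * β ^ 2 - Δ) / (n * β ^ 2) := by
      rw [hϑ, one_sub_div hβ0.ne', mul_div_assoc]
    rw [h1, le_div_iff₀ hβ0]
    refine le_trans (le_of_eq ?_) hCS
    ring
  have hPnn : 0 ≤ B p p := (by positivity : 0 ≤ κ * ‖ι p‖ ^ 2).trans hP0
  have hα3 : n * α ^ 2 ≤ B p p := by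
    have := mul_nonneg hPnn hϑ0.le
    linarith
  have hnorm : ‖ι z‖ ^ 2 = ‖ι p‖ ^ 2 + α ^ 2 * N := by
    conv_lhs => rw [hzdec, map_add, map_smul, norm_add_smul_sq, hp1]
    ring
  have hb1 : ‖ι p‖ ^ 2 ≤ κ⁻¹ * B p p := by
    rw [le_inv_mul_iff₀ hκ]
    exact hP0
  have hb2 : α ^ 2 * N ≤ (-lam)⁻¹ * B p p := by
    rw [le_inv_mul_iff₀ (neg_pos.2 hlam)]
    rw [hn] at hα3
    linarith
  have hb3 : ‖ι z‖ ^ 2 ≤ ((-lam)⁻¹ + κ⁻¹) * B p p := by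
    rw [hnorm]
    linarith
  calc ϑ / ((-lam)⁻¹ + κ⁻¹) * ‖ι z‖ ^ 2
      ≤ ϑ / ((-lam)⁻¹ + κ⁻¹) * (((-lam)⁻¹ + κ⁻¹) * B p p) := by gcongr
    _ = ϑ * B p p := by rw [← mul_assoc, div_mul_cancel₀ _ hS0.ne']
    _ ≤ B z z := by
      rw [hBz]
      linarith

set_option maxHeartbeats 800000 in
/-- Coercivity, transversally to the kernel, of the form penalized by the constraint `y`. -/
theorem exists_coercive [CompleteSpace V] (h : IsGardingForm ι B c₁ c₂) {e χ η : V}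
    {y : H} {lam : ℝ}
    (he : ∀ v, B e v = 0) (he0 : ι e ≠ 0)
    (hχ : ∀ v, B χ v = lam * inner ℝ (ι χ) (ι v)) (hlam : lam < 0) (hχ0 : ι χ ≠ 0)
    (hneg : ∀ μ < 0, ∀ w, (∀ z, B w z = μ * inner ℝ (ι w) (ι z)) → ∃ c : ℝ, w = c • χ)
    (hzero : ∀ w, (∀ z, B w z = 0) → ∃ c : ℝ, w = c • e)
    (hη : ∀ v, B η v = -inner ℝ y (ι v)) (hΔ : 0 < inner ℝ y (ι η)) :
    ∃ K c, 0 < K ∧ 0 < c ∧ ∀ v, inner ℝ v e = 0 →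
      c * ‖v‖ ^ 2 ≤ B v v + K * inner ℝ y (ι v) ^ 2 := by
  obtain ⟨κ, hκ, hpos⟩ := h.exists_pos_lower_bound he he0 hχ hlam hχ0 hneg hzero
  obtain ⟨ε, hε, hz⟩ := h.exists_pos_on_constraint he he0 hχ hlam hχ0 hκ hpos hη hΔ
  have hE : 0 < ‖ι e‖ ^ 2 := by positivity
  have hye : inner ℝ y (ι e) = 0 := by
    have := hη e
    rw [h.symm, he] at this
    linarith
  set Δ := inner ℝ y (ι η) with hΔdef
  set γ := inner ℝ (ι η) (ι e) / ‖ι e‖ ^ 2 with hγ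
  set ζ := η - γ • e with hζ
  have hγE : inner ℝ (ι η) (ι e) = γ * ‖ι e‖ ^ 2 := by rw [hγ]; field_simp
  have hζe : inner ℝ (ι ζ) (ι e) = 0 := by
    simp only [hζ, map_sub, map_smul, inner_sub_left, inner_smul_left, conj_trivial,
      real_inner_self_eq_norm_sq, hγE]
    ring
  have hBζ : ∀ v, B ζ v = -inner ℝ y (ι v) := fun v => by
    simp only [hζ, map_sub, map_smul, sub_apply,
      smul_apply, he, smul_zero, sub_zero, hη]
  have hyζ : inner ℝ y (ι ζ) = Δ := by
    simp only [hζ, map_sub, map_smul, inner_sub_right, inner_smul_right, hye, mul_zero, sub_zero,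
      hΔdef]
  -- Gårding combined with positivity in H: c₁‖z‖² ≤ B(z,z) + c₂‖ιz‖² ≤ (1 + c₂/ε)B(z,z).
  set c₃ := c₁ / (1 + c₂ / ε) with hc₃
  have hc₂ := h.nonneg
  have hc₃0 : 0 < c₃ := div_pos h.pos (by positivity)
  have hcoer : ∀ z, inner ℝ y (ι z) = 0 → inner ℝ (ι z) (ι e) = 0 → c₃ * ‖z‖ ^ 2 ≤ B z z := by
    intro z h1 h2
    have h3 := hz z h1 h2
    have h4 := h.garding z
    have h5 : ‖ι z‖ ^ 2 ≤ B z z / ε := by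
      rw [le_div_iff₀ hε]
      linarith
    rw [hc₃, div_mul_eq_mul_div, div_le_iff₀ (by positivity)]
    have : c₂ * ‖ι z‖ ^ 2 ≤ c₂ * (B z z / ε) := by gcongr
    calc c₁ * ‖z‖ ^ 2 ≤ B z z + c₂ * (B z z / ε) := h4.trans (by linarith)
      _ = B z z * (1 + c₂ / ε) := by ring
  have hD : 0 < 2 / c₃ + 2 * ‖ζ‖ ^ 2 / Δ := by positivity
  -- Along ζ the form equals −Δ and the penalty 2Δ, so their sum is +Δ. The second constant comes
  -- from ‖w‖² ≤ 2‖z‖² + 2τ²‖ζ‖² for w = z + τζ.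
  refine ⟨2 / Δ, 1 / (2 / c₃ + 2 * ‖ζ‖ ^ 2 / Δ), by positivity, by positivity, fun v hv => ?_⟩
  set α := inner ℝ (ι v) (ι e) / ‖ι e‖ ^ 2 with hα
  have hαE : inner ℝ (ι v) (ι e) = α * ‖ι e‖ ^ 2 := by rw [hα]; field_simp
  -- Orthogonality of v to e holds in V, whereas `hcoer` asks for it in H. Subtracting a multiple of
  -- e changes neither B nor the pairing with y, and cannot decrease the V-norm because v is
  -- V-orthogonal to e.
  set w := v - α • e with hw
  have hwe : inner ℝ (ι w) (ι e) = 0 := by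
    simp only [hw, map_sub, map_smul, inner_sub_left, inner_smul_left, conj_trivial,
      real_inner_self_eq_norm_sq, hαE]
    ring
  have hvw : v = w + α • e := by rw [hw]; abel
  have hBv : B v v = B w w := by
    conv_lhs => rw [hvw, h.apply_add_smul, h.symm w e, he, he]
    ring
  have hyv : inner ℝ y (ι v) = inner ℝ y (ι w) := by
    simp only [hw, map_sub, map_smul, inner_sub_right, inner_smul_right, hye, mul_zero, sub_zero]
  have hnv : ‖v‖ ^ 2 ≤ ‖w‖ ^ 2 := by
    have h1 : ‖w‖ ^ 2 = ‖v‖ ^ 2 + 2 * (-α) * inner ℝ v e + (-α) ^ 2 * ‖e‖ ^ 2 := by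
      rw [← norm_add_smul_sq, hw, neg_smul, sub_eq_add_neg]
    rw [h1, hv]
    nlinarith [mul_nonneg (sq_nonneg α) (sq_nonneg ‖e‖)]
  -- Subtracting τζ restores the constraint, and the cross term B(z,ζ) = −(y,z) then vanishes.
  set τ := inner ℝ y (ι w) / Δ with hτ
  have hτΔ : inner ℝ y (ι w) = τ * Δ := by rw [hτ]; field_simp
  set z := w - τ • ζ with hzdef
  have hyz : inner ℝ y (ι z) = 0 := by
    simp only [hzdef, map_sub, map_smul, inner_sub_right, inner_smul_right, hyζ, hτΔ]
    ring
  have hze : inner ℝ (ι z) (ι e) = 0 := by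
    simp only [hzdef, map_sub, map_smul, inner_sub_left, inner_smul_left, conj_trivial, hwe, hζe]
    ring
  have hwz : w = z + τ • ζ := by rw [hzdef]; abel
  have hBw : B w w = B z z - τ ^ 2 * Δ := by
    conv_lhs => rw [hwz, h.apply_add_smul, h.symm z ζ, hBζ, hBζ, hyz, hyζ]
    ring
  have h1 := hcoer z hyz hze
  have h2 : ‖w‖ ^ 2 ≤ 2 * ‖z‖ ^ 2 + 2 * (τ ^ 2 * ‖ζ‖ ^ 2) := by
    have h3 : ‖w‖ ≤ ‖z‖ + |τ| * ‖ζ‖ := by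
      rw [hwz]
      refine (norm_add_le _ _).trans_eq ?_
      rw [norm_smul, Real.norm_eq_abs]
    have h4 : ‖w‖ ^ 2 ≤ (‖z‖ + |τ| * ‖ζ‖) ^ 2 := by gcongr
    have h5 : (|τ| * ‖ζ‖) ^ 2 = τ ^ 2 * ‖ζ‖ ^ 2 := by rw [mul_pow, sq_abs]
    nlinarith [sq_nonneg (‖z‖ - |τ| * ‖ζ‖)]
  rw [hBv, hyv, hτΔ, one_div, inv_mul_le_iff₀ hD, hBw]
  have e1 : B z z - τ ^ 2 * Δ + 2 / Δ * (τ * Δ) ^ 2 = B z z + τ ^ 2 * Δ := by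
    field_simp
    ring
  rw [e1]
  have h6 : 2 * ‖z‖ ^ 2 ≤ 2 / c₃ * B z z := by
    rw [div_mul_eq_mul_div, le_div_iff₀ hc₃0]
    linarith
  have h7 : 2 * (τ ^ 2 * ‖ζ‖ ^ 2) = 2 * ‖ζ‖ ^ 2 / Δ * (τ ^ 2 * Δ) := by
    field_simp
  have h8 : 0 ≤ 2 / c₃ * (τ ^ 2 * Δ) := by positivity
  have h9 : 0 ≤ 2 * ‖ζ‖ ^ 2 / Δ * B z z :=
    mul_nonneg (by positivity) ((by positivity : 0 ≤ c₃ * ‖z‖ ^ 2).trans h1)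
  rw [add_mul, mul_add, mul_add]
  linarith

end IsGardingForm

/-! ### Bounds of the symbol -/

theorem IsSymbol.exists_abs_le {θ : ℝ → ℝ} {m : ℝ} (hθ : IsSymbol θ m) :
    ∃ C, 0 < C ∧ ∀ κ : ℝ, |θ κ| ≤ C * (1 + κ ^ 2) ^ (m / 2) := by
  obtain ⟨v₁, v₂, κ₀, h1, h2, h⟩ := hθ.growth
  obtain ⟨M, hM⟩ := (isCompact_Icc (a := -|κ₀|) (b := |κ₀|)).exists_bound_of_continuousOn
    hθ.cont.continuousOn
  have hm := hθ.pos
  refine ⟨v₂ + |M|, by positivity, fun κ => ?_⟩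
  have hone : 1 ≤ (1 + κ ^ 2) ^ (m / 2) :=
    Real.one_le_rpow (by nlinarith [sq_nonneg κ]) (by linarith)
  by_cases hκ : κ₀ ≤ |κ|
  · obtain ⟨ha, hb⟩ := h κ hκ
    have h0 : 0 ≤ θ κ := (by positivity : 0 ≤ v₁ * |κ| ^ m).trans ha
    have hle : |κ| ^ m ≤ (1 + κ ^ 2) ^ (m / 2) := by
      have e : |κ| ^ m = (|κ| ^ 2) ^ (m / 2) := by
        rw [← Real.rpow_natCast, ← Real.rpow_mul (abs_nonneg _)]
        congr 1
        push_cast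
        ring
      rw [e, sq_abs]
      gcongr
      linarith
    rw [abs_of_nonneg h0]
    calc θ κ ≤ v₂ * |κ| ^ m := hb
      _ ≤ v₂ * (1 + κ ^ 2) ^ (m / 2) := by gcongr
      _ ≤ (v₂ + |M|) * (1 + κ ^ 2) ^ (m / 2) := by gcongr; linarith [abs_nonneg M]
  · have hκ' : |κ| ≤ |κ₀| := (not_le.1 hκ).le.trans (le_abs_self _)
    have := hM κ (abs_le.1 hκ')
    rw [Real.norm_eq_abs] at this
    have h3 := this.trans (le_abs_self M)
    nlinarith [abs_nonneg M]

/-- Ellipticity of the symbol. For |κ| > R, with R ≥ 1, one has 1 + κ² ≤ 2κ², which explains the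
factor 2^(m/2) in c₁; the compact range |κ| ≤ R is absorbed in c₂. -/
theorem IsSymbol.exists_le_add {θ : ℝ → ℝ} {m : ℝ} (hθ : IsSymbol θ m) :
    ∃ c₁ c₂, 0 < c₁ ∧ 0 ≤ c₂ ∧ ∀ κ : ℝ, c₁ * (1 + κ ^ 2) ^ (m / 2) ≤ θ κ + c₂ := by
  obtain ⟨v₁, v₂, κ₀, h1, h2, h⟩ := hθ.growth
  have hm := hθ.pos
  set R := max |κ₀| 1 with hR
  have hR1 : 1 ≤ R := le_max_right _ _
  obtain ⟨M, hM⟩ := (isCompact_Icc (a := -R) (b := R)).exists_bound_of_continuousOn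
    hθ.cont.continuousOn
  have h2m : 0 < (2 : ℝ) ^ (m / 2) := by positivity
  set c₁ := v₁ / 2 ^ (m / 2) with hc₁
  have hc₁0 : 0 < c₁ := by positivity
  refine ⟨c₁, c₁ * (1 + R ^ 2) ^ (m / 2) + |M|, hc₁0, by positivity, fun κ => ?_⟩
  by_cases hκ : |κ| ≤ R
  · have h3 := hM κ (abs_le.1 hκ)
    rw [Real.norm_eq_abs] at h3
    have h4 := neg_le_of_abs_le (h3.trans (le_abs_self M))
    have h5 : (1 + κ ^ 2) ^ (m / 2) ≤ (1 + R ^ 2) ^ (m / 2) := by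
      rw [← sq_abs κ]
      gcongr
    have h6 : c₁ * (1 + κ ^ 2) ^ (m / 2) ≤ c₁ * (1 + R ^ 2) ^ (m / 2) := by gcongr
    linarith
  · have hκ' := not_le.1 hκ
    have ha := (h κ ((le_abs_self κ₀).trans ((le_max_left _ _).trans hκ'.le))).1
    have e : |κ| ^ m = (|κ| ^ 2) ^ (m / 2) := by
      rw [← Real.rpow_natCast, ← Real.rpow_mul (abs_nonneg _)]
      congr 1
      push_cast
      ring
    have h5 : (1 + κ ^ 2) ^ (m / 2) ≤ 2 ^ (m / 2) * |κ| ^ m := by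
      rw [e, sq_abs, ← Real.mul_rpow (by norm_num) (sq_nonneg _)]
      gcongr
      rw [← sq_abs κ]
      nlinarith
    have h6 : c₁ * (1 + κ ^ 2) ^ (m / 2) ≤ v₁ * |κ| ^ m := by
      calc c₁ * (1 + κ ^ 2) ^ (m / 2) ≤ c₁ * (2 ^ (m / 2) * |κ| ^ m) := by gcongr
        _ = v₁ * |κ| ^ m := by
          rw [hc₁]
          field_simp
    have h7 : 0 ≤ c₁ * (1 + R ^ 2) ^ (m / 2) + |M| := by positivity
    linarith

/-- Elliptic regularity: v and 𝓜v in L² force v into H^m. It places the wave, its derivatives and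
weak eigenfunctions in the space where the spectral hypothesis applies. -/
theorem summable_of_isMul {L : ℝ} (hL : 0 < L) {θ : ℝ → ℝ} {m : ℝ} (hθ : IsSymbol θ m)
    {v g : ℝ → ℝ} (hv : MemLp v 2 (perMeasure L)) (hg : IsMul L θ v g) :
    Summable fun k : ℤ => (1 + (k : ℝ) ^ 2) ^ m * ‖coeff L v k‖ ^ 2 := by
  obtain ⟨c₁, c₂, hc₁, hc₂, h⟩ := hθ.exists_le_add
  have s1 := (parseval hL hg.1).summable
  have s2 := (parseval hL hv).summable
  rw [summable_mul_left_iff hL.ne'] at s1 s2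
  refine Summable.of_nonneg_of_le (fun k => by positivity) (fun k => ?_)
    ((s1.mul_left (2 / c₁ ^ 2)).add (s2.mul_left (2 / c₁ ^ 2 * c₂ ^ 2)))
  rw [hg.2 k, norm_mul, Complex.norm_real, Real.norm_eq_abs, mul_pow, sq_abs]
  have e : (1 + (k : ℝ) ^ 2) ^ m = ((1 + (k : ℝ) ^ 2) ^ (m / 2)) ^ 2 := by
    rw [← Real.rpow_mul_natCast (by positivity)]
    congr 1
    push_cast
    ring
  have h1 : c₁ ^ 2 * (1 + (k : ℝ) ^ 2) ^ m ≤ 2 * (θ k ^ 2 + c₂ ^ 2) := by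
    rw [e, ← mul_pow]
    calc (c₁ * (1 + (k : ℝ) ^ 2) ^ (m / 2)) ^ 2 ≤ (θ k + c₂) ^ 2 := by
          have := h k
          gcongr
      _ ≤ 2 * (θ k ^ 2 + c₂ ^ 2) := by nlinarith [sq_nonneg (θ k - c₂)]
  have h2 : (1 + (k : ℝ) ^ 2) ^ m ≤ 2 / c₁ ^ 2 * (θ k ^ 2 + c₂ ^ 2) := by
    rw [div_mul_eq_mul_div, le_div_iff₀ (by positivity), mul_comm]
    exact h1
  calc (1 + (k : ℝ) ^ 2) ^ m * ‖coeff L v k‖ ^ 2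
      ≤ 2 / c₁ ^ 2 * (θ k ^ 2 + c₂ ^ 2) * ‖coeff L v k‖ ^ 2 := by gcongr
    _ = _ := by ring

/-! ### The quadratic form of the linearized operator -/

theorem intervalIntegrable_sq_of_memLp {L : ℝ} (hL : 0 < L) {g : ℝ → ℝ}
    (hg : MemLp g 2 (perMeasure L)) : IntervalIntegrable (fun x => g x ^ 2) volume 0 L := by
  simpa only [sq] using intervalIntegrable_mul_of_memLp hL hg hg

theorem sq_integral_mul_le {L : ℝ} (hL : 0 < L) {g h : ℝ → ℝ} (hg : MemLp g 2 (perMeasure L))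
    (hh : MemLp h 2 (perMeasure L)) :
    (∫ x in (0 : ℝ)..L, g x * h x) ^ 2
      ≤ (∫ x in (0 : ℝ)..L, g x ^ 2) * ∫ x in (0 : ℝ)..L, h x ^ 2 := by
  refine sq_le_mul_of_forall_quadratic_nonneg fun t => ?_
  have i1 := intervalIntegrable_sq_of_memLp hL hg
  have i2 := (intervalIntegrable_mul_of_memLp hL hg hh).const_mul (2 * t)
  have i3 := (intervalIntegrable_sq_of_memLp hL hh).const_mul (t ^ 2)
  rw [← intervalIntegral.integral_const_mul, ← intervalIntegral.integral_const_mul,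
    ← intervalIntegral.integral_add i1 i2, ← intervalIntegral.integral_add (i1.add i2) i3]
  refine intervalIntegral.integral_nonneg hL.le fun x _ => ?_
  nlinarith [sq_nonneg (g x + t * h x)]

theorem memLp_continuous_mul {L : ℝ} {p g : ℝ → ℝ} (hp : Continuous p)
    (hg : MemLp g 2 (perMeasure L)) : MemLp (fun x => p x * g x) 2 (perMeasure L) := by
  obtain ⟨C, hC⟩ := (isCompact_Icc (a := 0) (b := L)).exists_bound_of_continuousOn hp.continuousOn
  refine MemLp.of_le_mul (c := C) hg (hp.aestronglyMeasurable.mul hg.aestronglyMeasurable) ?_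
  filter_upwards [ae_restrict_mem measurableSet_Ioc] with x hx
  rw [norm_mul]
  have := hC x ⟨hx.1.le, hx.2⟩
  gcongr

namespace Hper

variable {L r s : ℝ} [hL : Fact (0 < L)]

theorem summable_mul_norm (u v : Hper L s) :
    (Summable fun k : ℤ => L * ((1 + (k : ℝ) ^ 2) ^ s * (‖coeff L u k‖ * ‖coeff L v k‖))) ∧
      ∑' k : ℤ, L * ((1 + (k : ℝ) ^ 2) ^ s * (‖coeff L u k‖ * ‖coeff L v k‖)) ≤ ‖u‖ * ‖v‖ := by
  have h := lp.tsum_mul_le_mul_norm (p := 2) (q := 2) (by rw [Real.holderConjugate_iff]; norm_num)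
    (toSeq u) (toSeq v)
  have e : ∀ k : ℤ, ‖(toSeq u : lp (fun _ : ℤ => ℂ) 2) k‖ * ‖(toSeq v : lp (fun _ : ℤ => ℂ) 2) k‖
      = L * ((1 + (k : ℝ) ^ 2) ^ s * (‖coeff L u k‖ * ‖coeff L v k‖)) := by
    intro k
    change ‖weighted L s u k‖ * ‖weighted L s v k‖ = _
    have hp : 0 ≤ L * (1 + (k : ℝ) ^ 2) ^ s := mul_nonneg hL.out.le (by positivity)
    rw [weighted, weighted, norm_mul, norm_mul, Complex.norm_real, mul_mul_mul_comm,
      Real.norm_of_nonneg (Real.sqrt_nonneg _), Real.mul_self_sqrt hp, mul_assoc]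
  simp only [e] at h
  exact h

theorem integral_sq_eq (hs : 0 ≤ s) (u : Hper L s) :
    ∫ x in (0 : ℝ)..L, u x ^ 2 = ‖incl hs u‖ ^ 2 := by
  rw [← real_inner_self_eq_norm_sq, inner_zero_eq, toL2_incl]
  simp only [sq]

theorem integral_sq_le (hs : 0 ≤ s) (u : Hper L s) :
    ∫ x in (0 : ℝ)..L, u x ^ 2 ≤ ‖u‖ ^ 2 := by
  rw [integral_sq_eq hs]
  gcongr
  exact norm_incl_le hs u

end Hper

/-- The quadratic form of the Fourier multiplier with symbol `θ`. -/
def mulForm (L : ℝ) (θ : ℝ → ℝ) (u v : ℝ → ℝ) : ℝ :=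
  ∑' k : ℤ, L * (θ k * ((starRingEnd ℂ) (coeff L u k) * coeff L v k).re)

/-- The bilinear form of the operator `𝓜 + p`. -/
def opForm (L : ℝ) (θ p : ℝ → ℝ) (u v : ℝ → ℝ) : ℝ :=
  mulForm L θ u v + ∫ x in (0 : ℝ)..L, p x * u x * v x

theorem mulForm_symm (L : ℝ) (θ u v : ℝ → ℝ) : mulForm L θ u v = mulForm L θ v u := by
  refine tsum_congr fun k => ?_
  simp only [Complex.mul_re, Complex.conj_re, Complex.conj_im]
  ring

section form

variable {L m : ℝ} [hL : Fact (0 < L)] {θ : ℝ → ℝ}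

theorem exists_mulForm_bound (hθ : IsSymbol θ m) : ∃ C, 0 < C ∧ ∀ u v : Hper L (m / 2),
    (Summable fun k : ℤ => L * (θ k * ((starRingEnd ℂ) (coeff L u k) * coeff L v k).re)) ∧
      |mulForm L θ u v| ≤ C * ‖u‖ * ‖v‖ := by
  obtain ⟨C, hC, h⟩ := hθ.exists_abs_le
  refine ⟨C, hC, fun u v => ?_⟩
  obtain ⟨h1, h2⟩ := u.summable_mul_norm v
  have hb : ∀ k : ℤ, ‖L * (θ k * ((starRingEnd ℂ) (coeff L u k) * coeff L v k).re)‖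
      ≤ C * (L * ((1 + (k : ℝ) ^ 2) ^ (m / 2) * (‖coeff L u k‖ * ‖coeff L v k‖))) := by
    intro k
    have hr : |((starRingEnd ℂ) (coeff L u k) * coeff L v k).re| ≤ ‖coeff L u k‖ * ‖coeff L v k‖ := by
      refine (Complex.abs_re_le_norm _).trans_eq ?_
      rw [norm_mul, RCLike.norm_conj]
    rw [Real.norm_eq_abs, abs_mul, abs_mul, abs_of_pos hL.out]
    have := hL.out.le
    calc L * (|θ k| * |((starRingEnd ℂ) (coeff L u k) * coeff L v k).re|)
        ≤ L * (C * (1 + (k : ℝ) ^ 2) ^ (m / 2) * (‖coeff L u k‖ * ‖coeff L v k‖)) := by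
          gcongr
          exact h k
      _ = _ := by ring
  refine ⟨Summable.of_norm_bounded (h1.mul_left C) hb, ?_⟩
  have h3 := tsum_of_norm_bounded (h1.mul_left C).hasSum hb
  rw [tsum_mul_left (a := C)] at h3
  rw [mul_assoc]
  exact h3.trans (by gcongr)

theorem summable_mulForm (hθ : IsSymbol θ m) (u v : Hper L (m / 2)) :
    Summable fun k : ℤ => L * (θ k * ((starRingEnd ℂ) (coeff L u k) * coeff L v k).re) := by
  obtain ⟨C, -, h⟩ := exists_mulForm_bound (L := L) hθ
  exact (h u v).1

theorem mulForm_add_left (hθ : IsSymbol θ m) (u v w : Hper L (m / 2)) :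
    mulForm L θ (u + v).toL2 w = mulForm L θ u w + mulForm L θ v w := by
  rw [mulForm, mulForm, mulForm, ← (summable_mulForm hθ u w).tsum_add (summable_mulForm hθ v w)]
  refine tsum_congr fun k => ?_
  rw [Hper.coeff_add, map_add, add_mul, Complex.add_re]
  ring

theorem mulForm_smul_left (c : ℝ) (u w : Hper L (m / 2)) :
    mulForm L θ (c • u).toL2 w = c * mulForm L θ u w := by
  rw [mulForm, mulForm, ← tsum_mul_left]
  refine tsum_congr fun k => ?_
  rw [Hper.coeff_smul, map_mul, Complex.conj_ofReal, mul_assoc, Complex.re_ofReal_mul]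
  ring

theorem intervalIntegrable_potential {p : ℝ → ℝ} (hp : Continuous p) {r : ℝ} (u v : Hper L r) :
    IntervalIntegrable (fun x => p x * u x * v x) volume 0 L :=
  intervalIntegrable_mul_of_memLp hL.out (memLp_continuous_mul hp u.memLp) v.memLp

theorem integral_congr_per {g h : ℝ → ℝ} (H : g =ᵐ[perMeasure L] h) :
    ∫ x in (0 : ℝ)..L, g x = ∫ x in (0 : ℝ)..L, h x := by
  rw [intervalIntegral.integral_of_le hL.out.le, intervalIntegral.integral_of_le hL.out.le]
  exact integral_congr_ae H

theorem potential_add_left {p : ℝ → ℝ} (hp : Continuous p) {r : ℝ} (u v w : Hper L r) :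
    ∫ x in (0 : ℝ)..L, p x * (u + v).toL2 x * w x
      = (∫ x in (0 : ℝ)..L, p x * u x * w x) + ∫ x in (0 : ℝ)..L, p x * v x * w x := by
  rw [← intervalIntegral.integral_add (intervalIntegrable_potential hp u w)
    (intervalIntegrable_potential hp v w)]
  refine integral_congr_per ?_
  filter_upwards [Hper.coe_add u v] with x hx
  rw [hx]
  ring

theorem potential_smul_left {p : ℝ → ℝ} {r : ℝ} (c : ℝ) (u w : Hper L r) :
    ∫ x in (0 : ℝ)..L, p x * (c • u).toL2 x * w x = c * ∫ x in (0 : ℝ)..L, p x * u x * w x := by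
  rw [← intervalIntegral.integral_const_mul]
  refine integral_congr_per ?_
  filter_upwards [Hper.coe_smul c u] with x hx
  rw [hx]
  ring

theorem exists_potential_bound {p : ℝ → ℝ} (hp : Continuous p) : ∃ P, 0 < P ∧
    ∀ {r : ℝ} (hr : 0 ≤ r) (u v : Hper L r),
      |∫ x in (0 : ℝ)..L, p x * u x * v x| ≤ P * ‖Hper.incl hr u‖ * ‖Hper.incl hr v‖ := by
  obtain ⟨C, hC⟩ := (isCompact_Icc (a := 0) (b := L)).exists_bound_of_continuousOn hp.continuousOn
  refine ⟨|C| + 1, by positivity, fun {r} hr u v => ?_⟩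
  refine abs_le_of_sq_le_sq ?_ (by positivity)
  refine (sq_integral_mul_le hL.out (memLp_continuous_mul hp u.memLp) v.memLp).trans ?_
  rw [Hper.integral_sq_eq hr v, mul_pow, mul_pow, ← Hper.integral_sq_eq hr u,
    ← intervalIntegral.integral_const_mul]
  gcongr
  refine intervalIntegral.integral_mono_on hL.out.le
    (intervalIntegrable_sq_of_memLp hL.out (memLp_continuous_mul hp u.memLp))
    ((intervalIntegrable_sq_of_memLp hL.out u.memLp).const_mul _) fun x hx => ?_
  · rw [mul_pow]
    have h1 := hC x hx
    rw [Real.norm_eq_abs] at h1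
    have h2 : p x ^ 2 ≤ (|C| + 1) ^ 2 := by
      rw [← sq_abs (p x)]
      have := h1.trans (le_abs_self C)
      gcongr
      linarith
    gcongr

theorem exists_opForm (hθ : IsSymbol θ m) {p : ℝ → ℝ} (hp : Continuous p) :
    ∃ B : Hper L (m / 2) →L[ℝ] Hper L (m / 2) →L[ℝ] ℝ, ∀ u v, B u v = opForm L θ p u v := by
  obtain ⟨C, hC, hb⟩ := exists_mulForm_bound (L := L) hθ
  obtain ⟨P, hP, hpb⟩ := exists_potential_bound (L := L) hp
  have hm : 0 ≤ m / 2 := by linarith [hθ.pos]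
  have hcomm : ∀ u v : Hper L (m / 2), opForm L θ p u v = opForm L θ p v u := fun u v => by
    rw [opForm, opForm, mulForm_symm]
    congr 1
    exact intervalIntegral.integral_congr fun x _ => by ring
  have hadd : ∀ u v w : Hper L (m / 2),
      opForm L θ p (u + v).toL2 w = opForm L θ p u w + opForm L θ p v w := fun u v w => by
    rw [opForm, opForm, opForm, mulForm_add_left hθ, potential_add_left hp]
    ring
  have hsmul : ∀ (c : ℝ) (u w : Hper L (m / 2)),
      opForm L θ p (c • u).toL2 w = c * opForm L θ p u w := fun c u w => by
    rw [opForm, opForm, mulForm_smul_left, potential_smul_left]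
    ring
  let F : Hper L (m / 2) →ₗ[ℝ] Hper L (m / 2) →ₗ[ℝ] ℝ :=
    LinearMap.mk₂ ℝ (fun u v => opForm L θ p u v) hadd hsmul
      (fun u v w => by rw [hcomm u, hadd, hcomm v, hcomm w])
      (fun c u v => by rw [hcomm u, hsmul, hcomm v, smul_eq_mul])
  refine ⟨F.mkContinuous₂ (C + P) fun u v => ?_, fun u v => rfl⟩
  change |mulForm L θ u v + ∫ x in (0 : ℝ)..L, p x * u x * v x| ≤ _
  have h1 := (hb u v).2
  have h2 := hpb hm u v
  have h3 : P * ‖Hper.incl hm u‖ * ‖Hper.incl hm v‖ ≤ P * ‖u‖ * ‖v‖ := by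
    have := Hper.norm_incl_le hm u
    have := Hper.norm_incl_le hm v
    gcongr
  calc _ ≤ |mulForm L θ u v| + |∫ x in (0 : ℝ)..L, p x * u x * v x| := abs_add_le _ _
    _ ≤ C * ‖u‖ * ‖v‖ + P * ‖u‖ * ‖v‖ := add_le_add h1 (h2.trans h3)
    _ = (C + P) * ‖u‖ * ‖v‖ := by ring

/-- The lower bound of the symbol controls the H^{m/2} norm up to a multiple of the L² norm, and the
bounded potential costs only another such multiple. Compactness is Rellich's theorem. -/
theorem exists_isGardingForm (hθ : IsSymbol θ m) {p : ℝ → ℝ} (hp : Continuous p)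
    (hm : 0 ≤ m / 2)
    (B : Hper L (m / 2) →L[ℝ] Hper L (m / 2) →L[ℝ] ℝ) (hB : ∀ u v, B u v = opForm L θ p u v) :
    ∃ c₁ c₂, IsGardingForm (Hper.incl hm) B c₁ c₂ := by
  obtain ⟨c₁, c₂, hc₁, hc₂, h⟩ := hθ.exists_le_add
  obtain ⟨P, hP, hpb⟩ := exists_potential_bound (L := L) hp
  refine ⟨c₁, c₂ + P, ⟨fun u v => ?_, hc₁, by positivity, fun v => ?_, fun u C hC => ?_⟩⟩
  · rw [hB, hB, opForm, opForm, mulForm_symm]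
    congr 1
    exact intervalIntegral.integral_congr fun x _ => by ring
  · have h1 : c₁ * ‖v‖ ^ 2 ≤ mulForm L θ v v + c₂ * ‖Hper.incl hm v‖ ^ 2 := by
      refine hasSum_le (fun k => ?_) (v.hasSum_norm_sq.mul_left c₁)
        ((summable_mulForm hθ v v).hasSum.add
          (((Hper.incl hm v).hasSum_norm_sq).mul_left c₂))
      rw [Hper.toL2_incl, Real.rpow_zero, one_mul, ← Complex.normSq_eq_conj_mul_self,
        Complex.ofReal_re, Complex.normSq_eq_norm_sq]
      have := h k
      have hLp := hL.out.le
      calc c₁ * (L * ((1 + (k : ℝ) ^ 2) ^ (m / 2) * ‖coeff L v k‖ ^ 2))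
          = L * ((c₁ * (1 + (k : ℝ) ^ 2) ^ (m / 2)) * ‖coeff L v k‖ ^ 2) := by ring
        _ ≤ L * ((θ k + c₂) * ‖coeff L v k‖ ^ 2) := by gcongr
        _ = _ := by ring
    have h2 := neg_le_of_abs_le (hpb hm v v)
    rw [hB, opForm]
    nlinarith
  · have hm' : 0 < m / 2 := by linarith [hθ.pos]
    exact Hper.exists_subseq_cauchy hm' u hC

theorem opForm_eq_of_isLin {f φ w : ℝ → ℝ} {ω : ℝ}
    (hp : Continuous fun x => ω - deriv f (φ x))
    (v z : Hper L (m / 2)) (h : IsLin L f θ ω φ v w) :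
    opForm L θ (fun x => ω - deriv f (φ x)) v z = ∫ x in (0 : ℝ)..L, w x * z x := by
  have h1 := parseval_inner hL.out h.1 z.memLp
  have h2 : mulForm L θ v z
      = ∫ x in (0 : ℝ)..L, (w x - ω * v x + deriv f (φ x) * v x) * z x := by
    refine HasSum.tsum_eq (h1.congr_fun fun k => ?_)
    rw [h.2 k, map_mul, Complex.conj_ofReal, mul_assoc, Complex.re_ofReal_mul]
  rw [opForm, h2, ← intervalIntegral.integral_add
    (intervalIntegrable_mul_of_memLp hL.out h.1 z.memLp) (intervalIntegrable_potential hp v z)]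
  exact intervalIntegral.integral_congr fun x _ => by ring

/-- Weak solutions are strong. The test function has as its coefficients at ±k₀ the defect c itself,
which turns the weak identity into a vanishing sum of terms L‖c k‖². Evenness of θ makes c
Hermitian, so that the test function is real. -/
theorem isLin_of_opForm_eq (hθ : IsSymbol θ m) {f φ w : ℝ → ℝ} {ω : ℝ}
    (hp : Continuous fun x => ω - deriv f (φ x)) (hw : MemLp w 2 (perMeasure L))
    (v : Hper L (m / 2))
    (h : ∀ z : Hper L (m / 2),
      opForm L θ (fun x => ω - deriv f (φ x)) v z = ∫ x in (0 : ℝ)..L, w x * z x) :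
    IsLin L f θ ω φ v w := by
  have hg : MemLp (fun x => w x - ω * v x + deriv f (φ x) * v x) 2 (perMeasure L) := by
    have := hw.sub (memLp_continuous_mul hp v.memLp)
    refine (memLp_congr_ae (Eventually.of_forall fun x => ?_)).1 this
    simp only [Pi.sub_apply]
    ring
  refine ⟨hg, fun k₀ => ?_⟩
  set g := fun x => w x - ω * v x + deriv f (φ x) * v x with hgdef
  set c : ℤ → ℂ := fun k => θ k * coeff L v k - coeff L g k with hc
  have hcsym : ∀ k, c (-k) = (starRingEnd ℂ) (c k) := fun k => by
    simp only [hc, map_sub, map_mul, Complex.conj_ofReal, coeff_neg_index]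
    push_cast
    rw [hθ.even]
  obtain ⟨z₀, hz₀, -, hco⟩ := Hper.exists_trigPoly (L := L) {k₀, -k₀} (fun k hk => by
    simp only [Finset.mem_insert, Finset.mem_singleton] at hk ⊢
    rcases hk with rfl | rfl
    · exact Or.inr rfl
    · exact Or.inl (neg_neg _)) c hcsym
  obtain ⟨z, rfl⟩ := Hper.exists_toL2_eq (hz₀ (m / 2))
  have h1 := (summable_mulForm hθ v z).hasSum.sub (parseval_inner hL.out hg z.memLp)
  have h2 : mulForm L θ v z - ∫ x in (0 : ℝ)..L, g x * z x = 0 := by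
    have := h z
    rw [opForm] at this
    have e : ∫ x in (0 : ℝ)..L, g x * z x = (∫ x in (0 : ℝ)..L, w x * z x)
        - ∫ x in (0 : ℝ)..L, (ω - deriv f (φ x)) * v x * z x := by
      rw [← intervalIntegral.integral_sub (intervalIntegrable_mul_of_memLp hL.out hw z.memLp)
        (intervalIntegrable_potential hp v z)]
      exact intervalIntegral.integral_congr fun x _ => by
        simp only [hgdef]
        ring
    rw [e]
    linarith
  change HasSum _ (mulForm L θ v z - _) at h1
  rw [h2] at h1
  have hterm : ∀ k : ℤ, L * (θ k * ((starRingEnd ℂ) (coeff L v k) * coeff L z k).re)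
      - L * ((starRingEnd ℂ) (coeff L g k) * coeff L z k).re
      = if k ∈ ({k₀, -k₀} : Finset ℤ) then L * ‖c k‖ ^ 2 else 0 := by
    intro k
    rw [hco]
    split_ifs
    · have : (‖c k‖ ^ 2 : ℝ) = ((starRingEnd ℂ) (c k) * c k).re := by
        rw [← Complex.normSq_eq_conj_mul_self, Complex.ofReal_re, Complex.normSq_eq_norm_sq]
      rw [this]
      conv_rhs => rw [hc]
      simp only [map_sub, map_mul, Complex.conj_ofReal, sub_mul, Complex.sub_re, mul_assoc,
        Complex.re_ofReal_mul]
      simp only [hc]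
      ring
    · simp
  simp only [hterm] at h1
  have hnn : ∀ k, 0 ≤ if k ∈ ({k₀, -k₀} : Finset ℤ) then L * ‖c k‖ ^ 2 else 0 := fun k => by
    have := hL.out.le
    split_ifs <;> positivity
  have h3 := (hasSum_zero_iff_of_nonneg hnn).1 h1
  have h4 := congrFun h3 k₀
  simp only [Finset.mem_insert, true_or, if_true, Pi.zero_apply] at h4
  have h5 : c k₀ = 0 := by
    rcases mul_eq_zero.1 h4 with h5 | h5
    · exact absurd h5 hL.out.ne'
    · exact norm_eq_zero.1 (pow_eq_zero_iff two_ne_zero |>.1 h5)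
  exact (sub_eq_zero.1 h5).symm

end form

/-! ### Coercivity of the second variation under the constraint -/

theorem summable_half {L m : ℝ} {g : ℝ → ℝ} (hm : 0 ≤ m)
    (h : Summable fun k : ℤ => (1 + (k : ℝ) ^ 2) ^ m * ‖coeff L g k‖ ^ 2) :
    Summable fun k : ℤ => (1 + (k : ℝ) ^ 2) ^ (m / 2) * ‖coeff L g k‖ ^ 2 := by
  refine h.of_nonneg_of_le (fun k => by positivity) fun k => ?_
  have : (1 : ℝ) ≤ 1 + (k : ℝ) ^ 2 := by nlinarith [sq_nonneg (k : ℝ)]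
  gcongr
  linarith

section coercive

variable {L m : ℝ} [hL : Fact (0 < L)] {θ : ℝ → ℝ}

theorem summable_zero_of_memLp {g : ℝ → ℝ} (hg : MemLp g 2 (perMeasure L)) :
    Summable fun k : ℤ => (1 + (k : ℝ) ^ 2) ^ (0 : ℝ) * ‖coeff L g k‖ ^ 2 := by
  have := (parseval hL.out hg).summable
  rw [summable_mul_left_iff hL.out.ne'] at this
  simpa only [Real.rpow_zero, one_mul] using this

theorem IsMul.congr {u u' g g' : ℝ → ℝ} (h : IsMul L θ u g) (hu : u =ᵐ[perMeasure L] u')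
    (hg : g =ᵐ[perMeasure L] g') : IsMul L θ u' g' :=
  ⟨(memLp_congr_ae hg).1 h.1, fun k => by
    rw [← coeff_congr hL.out hg, ← coeff_congr hL.out hu, h.2]⟩

theorem IsLin.congr {f φ v v' w w' : ℝ → ℝ} {ω : ℝ} (h : IsLin L f θ ω φ v w)
    (hv : v =ᵐ[perMeasure L] v') (hw : w =ᵐ[perMeasure L] w') : IsLin L f θ ω φ v' w' := by
  refine IsMul.congr h hv ?_
  filter_upwards [hv, hw] with x h1 h2
  rw [h1, h2]

/-- The abstract coercivity with V = H^{m/2}, H = L², e = φ' and y as the constraint. The spectral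
hypothesis concerns H^m, so weak eigenvectors have to be regularized before it can be used. -/
theorem exists_coercive_opForm (hθ : IsSymbol θ m) {f φ η y : ℝ → ℝ} {ω : ℝ}
    (hp : Continuous fun x => ω - deriv f (φ x)) (hφ' : Continuous (deriv φ))
    (hper : Function.Periodic (deriv φ) L)
    (hspec : SpectralCondition L f θ m ω φ) (hy : MemLp y 2 (perMeasure L))
    (hη : MemLp η 2 (perMeasure L)) (hηy : IsLin L f θ ω φ η fun x => -y x)
    (hΔ : 0 < ∫ x in (0 : ℝ)..L, y x * η x) :
    ∃ (K c : ℝ) (e : Hper L (m / 2)), 0 < K ∧ 0 < c ∧ ⇑e.toL2 =ᵐ[perMeasure L] deriv φ ∧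
      ∀ v : Hper L (m / 2), inner ℝ v e = 0 →
        c * ‖v‖ ^ 2 ≤ opForm L θ (fun x => ω - deriv f (φ x)) v v
          + K * (∫ x in (0 : ℝ)..L, y x * v x) ^ 2 := by
  have hm0 := hθ.pos
  have hm : 0 ≤ m / 2 := by linarith
  have hmm : m / 2 ≤ m := by linarith
  obtain ⟨B, hB⟩ := exists_opForm (L := L) hθ hp
  obtain ⟨c₁, c₂, hG⟩ := exists_isGardingForm hθ hp hm B hB
  have := Hper.completeSpace (L := L) hm
  have hφL := memLp_of_continuous (L := L) hφ'
  let e : Hper L (m / 2) := Hper.ofFun (deriv φ) hφL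
    (summable_half hm0.le (summable_of_isMul hL.out hθ hφL hspec.zero_eigenvalue))
  have he : ⇑e.toL2 =ᵐ[perMeasure L] deriv φ := Hper.coe_ofFun _ _ _
  let h : Hper L (m / 2) := Hper.ofFun η hη
    (summable_half hm0.le (summable_of_isMul hL.out hθ hη hηy))
  have hh : ⇑h.toL2 =ᵐ[perMeasure L] η := Hper.coe_ofFun _ _ _
  let Y : Hper L 0 := Hper.ofFun y hy (summable_zero_of_memLp hy)
  have hY : ⇑Y.toL2 =ᵐ[perMeasure L] y := Hper.coe_ofFun _ _ _
  have hYi : ∀ v : Hper L (m / 2), inner ℝ Y (Hper.incl hm v) = ∫ x in (0 : ℝ)..L, y x * v x := by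
    intro v
    rw [Hper.inner_zero_eq, Hper.toL2_incl]
    refine integral_congr_per ?_
    filter_upwards [hY] with x hx
    rw [hx]
  obtain ⟨lam, χ, hlam, hχ0, hχ, hχs, hχu⟩ := hspec.negative
  -- A weak eigenvector in H^{m/2} solves the equation in L², hence lies in H^m.
  have hlin : ∀ (μ : ℝ) (w : Hper L (m / 2)),
      (∀ z, B w z = μ * inner ℝ (Hper.incl hm w) (Hper.incl hm z)) →
        ∃ W : Hper L m, W.toL2 = w.toL2 ∧ IsLin L f θ ω φ W fun x => μ * W x := by
    intro μ w hw
    have h1 : IsLin L f θ ω φ w fun x => μ * w x := by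
      refine isLin_of_opForm_eq hθ hp (w.memLp.const_mul μ) w fun z => ?_
      rw [← hB, hw, Hper.inner_zero_eq, Hper.toL2_incl, Hper.toL2_incl,
        ← intervalIntegral.integral_const_mul]
      simp only [mul_assoc]
    obtain ⟨W, hW⟩ := Hper.exists_toL2_eq (L := L) (s := m) (u := w.toL2)
      (summable_of_isMul hL.out hθ w.memLp h1)
    exact ⟨W, hW, by rw [hW]; exact h1⟩
  have hinj : ∀ w : Hper L (m / 2), w ≠ 0 → Hper.incl hm w ≠ 0 := fun w hw h0 =>
    hw (Hper.incl_injective hm (by rw [h0, map_zero]))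
  have he0 : e ≠ 0 := by
    intro h0
    obtain ⟨x₀, hx₀⟩ := hspec.zero_ne
    obtain ⟨x₁, hx₁, hx₁'⟩ := hper.exists_mem_Ioc hL.out x₀ 0
    have hae : deriv φ =ᵐ[perMeasure L] 0 := by
      rw [h0, Hper.toL2_zero] at he
      exact he.symm.trans (Lp.coeFn_zero ℝ 2 (perMeasure L))
    rw [zero_add] at hx₁
    have := Measure.eqOn_Ioc_of_ae_eq volume hae hφ'.continuousOn
      continuousOn_const hx₁
    exact hx₀ (hx₁'.trans this)
  obtain ⟨K, c, hK, hc, hcoer⟩ := hG.exists_coercive (e := e) (χ := Hper.incl hmm χ) (η := h)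
    (y := Y) (lam := lam)
    (fun v => by
      rw [hB, opForm_eq_of_isLin hp e v (hspec.zero_eigenvalue.congr he.symm EventuallyEq.rfl)]
      simp)
    (hinj e he0)
    (fun v => by
      rw [hB, opForm_eq_of_isLin hp _ v (by rw [Hper.toL2_incl]; exact hχ), Hper.inner_zero_eq,
        Hper.toL2_incl, Hper.toL2_incl, Hper.toL2_incl, ← intervalIntegral.integral_const_mul]
      simp only [mul_assoc])
    hlam
    (hinj _ fun h0 => hχ0 (Hper.incl_injective hmm (by rw [h0, map_zero])))
    (fun μ hμ w hw => by
      obtain ⟨W, hW, hWl⟩ := hlin μ w hw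
      by_cases hw0 : W = 0
      · refine ⟨0, Hper.ext_toL2 ?_⟩
        rw [← hW, hw0, zero_smul, Hper.toL2_zero, Hper.toL2_zero]
      · have hμl := hχu μ W hμ hw0 hWl
        subst hμl
        obtain ⟨c, hc⟩ := hχs W hWl
        refine ⟨c, Hper.ext_toL2 ?_⟩
        rw [← hW, hc, Hper.toL2_smul, Hper.toL2_smul, Hper.toL2_incl])
    (fun w hw => by
      obtain ⟨W, hW, hWl⟩ := hlin 0 w fun z => by rw [hw, zero_mul]
      simp only [zero_mul] at hWl
      obtain ⟨c, hc⟩ := hspec.zero_simple W hWl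
      refine ⟨c, Hper.ext_ae ?_⟩
      rw [← hW]
      filter_upwards [hc, he, Hper.coe_smul c e] with x h1 h2 h3
      rw [h1, h3, h2])
    (fun v => by
      rw [hB, opForm_eq_of_isLin hp h v (hηy.congr hh.symm EventuallyEq.rfl), hYi,
        ← intervalIntegral.integral_neg]
      simp only [neg_mul])
    (by
      rw [hYi]
      refine hΔ.trans_eq (integral_congr_per ?_)
      filter_upwards [hh] with x hx
      rw [hx])
  refine ⟨K, c, e, hK, hc, he, fun v hv => ?_⟩
  have := hcoer v hv
  rwa [hB, hYi] at this

end coercive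

/-! ### Taylor expansion of the potential energy -/

theorem abs_le_of_hasDerivAt {F F' : ℝ → ℝ} {M h : ℝ} (hF : ∀ x, HasDerivAt F (F' x) x)
    (h0 : F 0 = 0) (hM : ∀ x, |x| ≤ |h| → |F' x| ≤ M) : |F h| ≤ M * |h| := by
  have h1 := (convex_Icc (-|h|) |h|).norm_image_sub_le_of_norm_hasDerivWithin_le
    (f := F) (f' := F') (C := M) (x := 0) (y := h) (fun x _ => (hF x).hasDerivWithinAt)
    (fun x hx => hM x (abs_le.2 hx)) ⟨neg_nonpos.2 (abs_nonneg h), abs_nonneg h⟩ (abs_le.1 le_rfl)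
  rwa [h0, sub_zero, sub_zero] at h1

section taylor

variable {f : ℝ → ℝ}

theorem hasDerivAt_primitive (hf : Continuous f) (x : ℝ) :
    HasDerivAt (primitive f) (f x) x :=
  intervalIntegral.integral_hasDerivAt_right (hf.intervalIntegrable _ _)
    (hf.stronglyMeasurableAtFilter _ _) hf.continuousAt

theorem continuous_primitive (hf : Continuous f) : Continuous (primitive f) :=
  continuous_iff_continuousAt.2 fun x => (hasDerivAt_primitive hf x).continuousAt

theorem exists_abs_le_of_continuous {g : ℝ → ℝ} (hg : Continuous g) (R : ℝ) :
    ∃ C, 0 < C ∧ ∀ x, |x| ≤ R → |g x| ≤ C := by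
  obtain ⟨C, hC⟩ := (isCompact_Icc (a := -R) (b := R)).exists_bound_of_continuousOn hg.continuousOn
  refine ⟨|C| + 1, by positivity, fun x hx => ?_⟩
  have := hC x (abs_le.1 hx)
  rw [Real.norm_eq_abs] at this
  linarith [le_abs_self C]

theorem exists_lipschitz {g : ℝ → ℝ} (hg : ContDiff ℝ 1 g) (R : ℝ) :
    ∃ C, 0 < C ∧ ∀ a h, |a| ≤ R → |h| ≤ R → |g (a + h) - g a| ≤ C * |h| := by
  obtain ⟨C, hC, hb⟩ := exists_abs_le_of_continuous (hg.continuous_deriv le_rfl) (R + R)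
  refine ⟨C, hC, fun a h ha hh => ?_⟩
  refine abs_le_of_hasDerivAt (F := fun s => g (a + s) - g a) (F' := fun s => deriv g (a + s))
    (fun x => ?_) (by simp) fun x hx => hb _ ?_
  · exact (((hg.differentiable one_ne_zero _).hasDerivAt.comp_const_add a x)).sub_const _
  · exact (abs_add_le _ _).trans (add_le_add ha (hx.trans hh))

theorem exists_taylor_one (hf : ContDiff ℝ (⊤ : ℕ∞) f) (R : ℝ) :
    ∃ C, 0 < C ∧ ∀ a h, |a| ≤ R → |h| ≤ R →
      |primitive f (a + h) - primitive f a - f a * h| ≤ C * |h| ^ 2 := by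
  obtain ⟨C, hC, hb⟩ := exists_lipschitz (hf.of_le (by exact_mod_cast le_top)) R
  refine ⟨C, hC, fun a h ha hh => ?_⟩
  have h1 := abs_le_of_hasDerivAt (h := h) (M := C * |h|)
    (F := fun s => primitive f (a + s) - primitive f a - f a * s)
    (F' := fun s => f (a + s) - f a)
    (fun x => by
      have := (((hasDerivAt_primitive hf.continuous (a + x)).comp_const_add a x).sub_const
        (primitive f a)).sub ((hasDerivAt_id x).const_mul (f a))
      exact this.congr_deriv (by simp)) (by simp)
    fun x hx => (hb a x ha (hx.trans hh)).trans (by gcongr)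
  calc _ ≤ C * |h| * |h| := h1
    _ = _ := by ring

theorem exists_taylor_two (hf : ContDiff ℝ (⊤ : ℕ∞) f) (R : ℝ) :
    ∃ C, 0 < C ∧ ∀ a h, |a| ≤ R → |h| ≤ R →
      |primitive f (a + h) - primitive f a - f a * h - 1 / 2 * (deriv f a * h ^ 2)|
        ≤ C * |h| ^ 3 := by
  have hf2 : ContDiff ℝ 1 (deriv f) :=
    (contDiff_infty_iff_deriv.1 hf).2.of_le (by exact_mod_cast le_top)
  obtain ⟨C, hC, hb⟩ := exists_lipschitz hf2 R
  refine ⟨C, hC, fun a h ha hh => ?_⟩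
  have hfd : Differentiable ℝ f := hf.differentiable (by simp)
  have h1 : ∀ s, |s| ≤ |h| → |f (a + s) - f a - deriv f a * s| ≤ C * |h| * |h| := fun s hs => by
    refine (abs_le_of_hasDerivAt (h := s) (M := C * |h|)
      (F := fun s => f (a + s) - f a - deriv f a * s)
      (F' := fun s => deriv f (a + s) - deriv f a) (fun x => ?_) (by simp)
      fun x hx => (hb a x ha ((hx.trans hs).trans hh)).trans ?_).trans (by gcongr)
    · have := (((hfd (a + x)).hasDerivAt.comp_const_add a x).sub_const (f a)).sub
        ((hasDerivAt_id x).const_mul (deriv f a))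
      exact this.congr_deriv (by simp)
    · have := hx.trans hs
      gcongr
  have h2 := abs_le_of_hasDerivAt (h := h) (M := C * |h| * |h|)
    (F := fun s => primitive f (a + s) - primitive f a - f a * s - 1 / 2 * (deriv f a * s ^ 2))
    (F' := fun s => f (a + s) - f a - deriv f a * s)
    (fun x => by
      have := ((((hasDerivAt_primitive hf.continuous (a + x)).comp_const_add a x).sub_const
        (primitive f a)).sub ((hasDerivAt_id x).const_mul (f a))).sub
        ((((hasDerivAt_id x).pow 2).const_mul (deriv f a)).const_mul (1 / 2))
      refine this.congr_deriv ?_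
      simp
      ring) (by simp) h1
  calc _ ≤ C * |h| * |h| * |h| := h2
    _ = _ := by ring

end taylor

/-! ### The potential energy on `H^{m/2}` -/

/-- The potential energy `∫₀ᴸ W(u) dx`. -/
def potential (L : ℝ) (f u : ℝ → ℝ) : ℝ := ∫ x in (0 : ℝ)..L, primitive f (u x)

/-- The remainder of the second order Taylor expansion of the potential energy at `φ`. -/
def potentialRem (L : ℝ) (f φ v u : ℝ → ℝ) : ℝ :=
  potential L f u - potential L f φ - (∫ x in (0 : ℝ)..L, f (φ x) * v x)
    - 1 / 2 * ∫ x in (0 : ℝ)..L, deriv f (φ x) * v x * v x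

theorem ae_abs_le_of_continuous (L : ℝ) {φ : ℝ → ℝ} (hφ : Continuous φ) :
    ∃ R, 0 < R ∧ ∀ᵐ x ∂perMeasure L, |φ x| ≤ R := by
  obtain ⟨C, hC⟩ := (isCompact_Icc (a := 0) (b := L)).exists_bound_of_continuousOn hφ.continuousOn
  refine ⟨|C| + 1, by positivity, ?_⟩
  filter_upwards [ae_restrict_mem measurableSet_Ioc] with x hx
  have := hC x ⟨hx.1.le, hx.2⟩
  rw [Real.norm_eq_abs] at this
  linarith [le_abs_self C]

section potential

variable {L : ℝ} [hL : Fact (0 < L)] {f : ℝ → ℝ}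

theorem intervalIntegrable_comp_of_bounded {g u : ℝ → ℝ} {R : ℝ} (hg : Continuous g)
    (hu : AEStronglyMeasurable u (perMeasure L)) (hR : ∀ᵐ x ∂perMeasure L, |u x| ≤ R) :
    IntervalIntegrable (fun x => g (u x)) volume 0 L := by
  obtain ⟨C, -, hC⟩ := exists_abs_le_of_continuous hg R
  rw [intervalIntegrable_iff_integrableOn_Ioc_of_le hL.out.le]
  refine Integrable.of_bound (hg.comp_aestronglyMeasurable hu) C ?_
  filter_upwards [hR] with x hx using hC _ hx

theorem integral_mono_per {g h : ℝ → ℝ} (hg : IntervalIntegrable g volume 0 L)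
    (hh : IntervalIntegrable h volume 0 L) (H : ∀ᵐ x ∂perMeasure L, g x ≤ h x) :
    ∫ x in (0 : ℝ)..L, g x ≤ ∫ x in (0 : ℝ)..L, h x := by
  rw [intervalIntegrable_iff_integrableOn_Ioc_of_le hL.out.le] at hg hh
  rw [intervalIntegral.integral_of_le hL.out.le, intervalIntegral.integral_of_le hL.out.le]
  exact integral_mono_ae hg hh H

theorem abs_integral_le_of_bound {g h : ℝ → ℝ} (hg : IntervalIntegrable g volume 0 L)
    (hh : IntervalIntegrable h volume 0 L) (H : ∀ᵐ x ∂perMeasure L, |g x| ≤ h x) :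
    |∫ x in (0 : ℝ)..L, g x| ≤ ∫ x in (0 : ℝ)..L, h x :=
  (intervalIntegral.abs_integral_le_integral_abs hL.out.le).trans (integral_mono_per hg.abs hh H)

/-- Taylor expansion of the potential energy in bounded directions. -/
theorem exists_potentialRem_le (hf : ContDiff ℝ (⊤ : ℕ∞) f) {φ : ℝ → ℝ} (hφ : Continuous φ)
    (R : ℝ) : ∃ C, 0 < C ∧ ∀ {r : ℝ} (_ : 0 ≤ r) (v : Hper L r) (u : ℝ → ℝ) (S : ℝ), S ≤ R →
      (u =ᵐ[perMeasure L] fun x => φ x + v x) → (∀ᵐ x ∂perMeasure L, |v x| ≤ S) →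
      |potentialRem L f φ v u| ≤ C * S * ‖v‖ ^ 2 := by
  obtain ⟨Rφ, hRφ, hφb⟩ := ae_abs_le_of_continuous L hφ
  obtain ⟨C, hC, hT⟩ := exists_taylor_two hf (max R Rφ)
  refine ⟨C, hC, fun {r} hr v u S hS hu hv => ?_⟩
  have hW := continuous_primitive hf.continuous
  have hf' : Continuous (deriv f) := hf.continuous_deriv (by exact_mod_cast le_top)
  have hum : AEStronglyMeasurable u (perMeasure L) :=
    (hφ.aestronglyMeasurable.add v.aestronglyMeasurable).congr hu.symm
  have i1 : IntervalIntegrable (fun x => primitive f (u x)) volume 0 L := by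
    refine intervalIntegrable_comp_of_bounded (R := Rφ + S) hW hum ?_
    filter_upwards [hu, hφb, hv] with x h1 h2 h3
    rw [h1]
    exact (abs_add_le _ _).trans (add_le_add h2 h3)
  have i2 : IntervalIntegrable (fun x => primitive f (φ x)) volume 0 L :=
    (hW.comp hφ).intervalIntegrable _ _
  have i3 : IntervalIntegrable (fun x => f (φ x) * v x) volume 0 L :=
    intervalIntegrable_mul_of_memLp hL.out (memLp_of_continuous (hf.continuous.comp hφ)) v.memLp
  have i4 : IntervalIntegrable (fun x => deriv f (φ x) * v x * v x) volume 0 L :=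
    intervalIntegrable_potential (hf'.comp hφ) v v
  have e : potentialRem L f φ v u = ∫ x in (0 : ℝ)..L, (primitive f (u x) - primitive f (φ x)
      - f (φ x) * v x - 1 / 2 * (deriv f (φ x) * v x * v x)) := by
    rw [intervalIntegral.integral_sub ((i1.sub i2).sub i3) (i4.const_mul _),
      intervalIntegral.integral_sub (i1.sub i2) i3, intervalIntegral.integral_sub i1 i2,
      intervalIntegral.integral_const_mul]
    rfl
  rw [e]
  refine (abs_integral_le_of_bound (((i1.sub i2).sub i3).sub (i4.const_mul _))
    ((intervalIntegrable_sq_of_memLp hL.out v.memLp).const_mul (C * S)) ?_).trans ?_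
  · filter_upwards [hu, hφb, hv] with x h1 h2 h3
    rw [h1]
    have h4 := hT (φ x) (v x) (h2.trans (le_max_right _ _)) ((h3.trans hS).trans (le_max_left _ _))
    have e2 : deriv f (φ x) * v x * v x = deriv f (φ x) * v x ^ 2 := by ring
    rw [e2]
    refine h4.trans ?_
    have e3 : |v x| ^ 3 = |v x| * v x ^ 2 := by rw [← sq_abs (v x)]; ring
    rw [e3, mul_assoc]
    gcongr
  · rw [intervalIntegral.integral_const_mul]
    by_cases hS0 : 0 ≤ S
    · have := v.integral_sq_le hr
      gcongr
    -- A negative S cannot bound |v| almost everywhere on a set of positive measure, so this case is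
    -- void.
    · have h0 : v = 0 := by
        exfalso
        have hne : NeBot (ae (perMeasure L)) := by
          rw [ae_neBot, Ne, Measure.restrict_eq_zero, Real.volume_Ioc, sub_zero,
            ENNReal.ofReal_eq_zero, not_le]
          exact hL.out
        obtain ⟨x, hx⟩ := hv.exists
        exact hS0 ((abs_nonneg _).trans hx)
      have e0 : ∫ x in (0 : ℝ)..L, (0 : Hper L r) x ^ 2 = 0 := by
        rw [Hper.integral_sq_eq hr, map_zero, norm_zero]
        ring
      rw [h0, e0, norm_zero]
      simp

theorem exists_potential_sub_le (hf : ContDiff ℝ (⊤ : ℕ∞) f) (R : ℝ) : ∃ C, 0 < C ∧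
    ∀ (u v : ℝ → ℝ) (S : ℝ), AEStronglyMeasurable u (perMeasure L) →
      AEStronglyMeasurable v (perMeasure L) → S ≤ R → (∀ᵐ x ∂perMeasure L, |u x| ≤ R) →
      (∀ᵐ x ∂perMeasure L, |v x - u x| ≤ S) → |potential L f v - potential L f u| ≤ C * S := by
  have hW1 : ContDiff ℝ 1 (primitive f) := contDiff_one_iff_deriv.2
    ⟨fun x => (hasDerivAt_primitive hf.continuous x).differentiableAt, by
      rw [funext fun x => (hasDerivAt_primitive hf.continuous x).deriv]
      exact hf.continuous⟩
  obtain ⟨C, hC, hT⟩ := exists_lipschitz hW1 R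
  have hLp := hL.out
  refine ⟨C * L, by positivity, fun u v S hu hv hS huR hvS => ?_⟩
  have hW := continuous_primitive hf.continuous
  have i1 := intervalIntegrable_comp_of_bounded hW hu huR
  have i2 : IntervalIntegrable (fun x => primitive f (v x)) volume 0 L := by
    refine intervalIntegrable_comp_of_bounded (R := R + R) hW hv ?_
    filter_upwards [huR, hvS] with x h1 h2
    have := abs_add_le (u x) (v x - u x)
    rw [add_sub_cancel] at this
    linarith
  rw [potential, potential, ← intervalIntegral.integral_sub i2 i1]
  refine (abs_integral_le_of_bound (i2.sub i1) (intervalIntegrable_const (c := C * S)) ?_).trans ?_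
  · filter_upwards [huR, hvS] with x h1 h2
    have := hT (u x) (v x - u x) h1 (h2.trans hS)
    rw [add_sub_cancel] at this
    exact this.trans (by gcongr)
  · rw [intervalIntegral.integral_const, sub_zero, smul_eq_mul]
    exact le_of_eq (by ring)

variable {m : ℝ}

theorem continuous_potential_of_sup (hf : ContDiff ℝ (⊤ : ℕ∞) f) {r : ℝ} (hr : 1 / 2 < r) :
    Continuous fun u : Hper L r => potential L f u := by
  obtain ⟨C, hC, hb⟩ := Hper.exists_sup_bound L hr
  refine continuous_iff_continuousAt.2 fun u => ?_
  obtain ⟨D, hD, hd⟩ := exists_potential_sub_le (L := L) hf (C * ‖u‖ + C)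
  rw [ContinuousAt, tendsto_iff_norm_sub_tendsto_zero]
  have ht : Tendsto (fun v => D * (C * ‖v - u‖)) (𝓝 u) (𝓝 0) := by
    have : Continuous fun v : Hper L r => D * (C * ‖v - u‖) := by fun_prop
    simpa using this.tendsto u
  refine squeeze_zero' (Eventually.of_forall fun _ => norm_nonneg _) ?_ ht
  filter_upwards [Metric.ball_mem_nhds u one_pos] with v hv
  rw [mem_ball_iff_norm] at hv
  refine hd u v (C * ‖v - u‖) u.aestronglyMeasurable v.aestronglyMeasurable ?_ ?_ ?_
  · nlinarith [norm_nonneg u]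
  · filter_upwards [hb u] with x hx
    linarith
  · filter_upwards [hb (v - u), Hper.coe_sub v u] with x hx h2
    rwa [h2] at hx

/-- The potential energy is continuous on `H^{m/2}`. -/
theorem continuous_potential (hf : ContDiff ℝ (⊤ : ℕ∞) f)
    (hE : m ≤ 1 → PotentialEnergyC2 L f (m / 2)) :
    Continuous fun u : Hper L (m / 2) => potential L f u := by
  by_cases hm1 : m ≤ 1
  · exact (hE hm1).2.continuous
  · exact continuous_potential_of_sup hf (by linarith)

/-- Mean value inequality for the remainder along t ↦ a + t v: its derivative is the first order
remainder of DN applied to v, which is at most ε‖t v‖‖v‖. -/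
theorem exists_taylor_of_contDiff {V : Type*} [NormedAddCommGroup V] [NormedSpace ℝ V]
    {N : V → ℝ} (hN : ContDiff ℝ 2 N) (a : V) {ε : ℝ} (hε : 0 < ε) : ∃ δ > 0, ∀ v, ‖v‖ < δ →
      |N (a + v) - N a - fderiv ℝ N a v - 1 / 2 * fderiv ℝ (fderiv ℝ N) a v v| ≤ ε * ‖v‖ ^ 2 := by
  have h2 : ContDiff ℝ (1 + 1) N := by rwa [one_add_one_eq_two]
  have hd : ContDiff ℝ 1 (fderiv ℝ N) := (contDiff_succ_iff_fderiv.1 h2).2.2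
  have hlin := (hd.differentiable one_ne_zero a).hasFDerivAt.isLittleO.def hε
  obtain ⟨δ, hδ, hb⟩ := Metric.eventually_nhds_iff_ball.1 hlin
  refine ⟨δ, hδ, fun v hv => ?_⟩
  have h1 := (convex_Icc (0 : ℝ) 1).norm_image_sub_le_of_norm_hasDerivWithin_le
    (f := fun t : ℝ => N (a + t • v) - N a - t * fderiv ℝ N a v
      - 1 / 2 * (t ^ 2 * fderiv ℝ (fderiv ℝ N) a v v))
    (f' := fun t : ℝ => (fderiv ℝ N (a + t • v) - fderiv ℝ N a
      - fderiv ℝ (fderiv ℝ N) a (t • v)) v)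
    (C := ε * ‖v‖ ^ 2) (x := 0) (y := 1) (fun t _ => by
      have e1 : HasDerivAt (fun t : ℝ => N (a + t • v)) (fderiv ℝ N (a + t • v) v) t := by
        have hc : HasDerivAt (fun t : ℝ => a + t • v) v t := by
          simpa using ((hasDerivAt_id t).smul_const v).const_add a
        exact ((hN.differentiable two_ne_zero (a + t • v)).hasFDerivAt.comp_hasDerivAt t hc)
      have e2 := ((e1.sub_const (N a)).sub ((hasDerivAt_id t).mul_const (fderiv ℝ N a v))).sub
        ((((hasDerivAt_id t).pow 2).mul_const (fderiv ℝ (fderiv ℝ N) a v v)).const_mul (1 / 2))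
      refine (e2.congr_deriv ?_).hasDerivWithinAt
      simp
      ring) (fun t ht => by
      have htv : ‖t • v‖ ≤ ‖v‖ := by
        rw [norm_smul, Real.norm_of_nonneg ht.1]
        exact mul_le_of_le_one_left (norm_nonneg _) ht.2
      have h3 := hb (a + t • v) (by
        rw [mem_ball_iff_norm, add_sub_cancel_left]
        exact htv.trans_lt hv)
      rw [add_sub_cancel_left] at h3
      refine (ContinuousLinearMap.le_opNorm _ _).trans ?_
      calc _ ≤ ε * ‖t • v‖ * ‖v‖ := by gcongr
        _ ≤ ε * ‖v‖ * ‖v‖ := by gcongr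
        _ = _ := by ring) (by simp) (by simp)
  simpa using h1

/-- Uniqueness of second order expansions, used to match two of them along a ray. -/
theorem eq_zero_of_quadratic_small {a b : ℝ}
    (h : ∀ ε > 0, ∃ δ > 0, ∀ t : ℝ, 0 < t → t < δ → |t * a + t ^ 2 * b| ≤ ε * t ^ 2) :
    a = 0 ∧ b = 0 := by
  have ha : a = 0 := by
    obtain ⟨δ, hδ, hb⟩ := h 1 one_pos
    by_contra hne
    have hp : 0 < |a| := abs_pos.2 hne
    set t := min (δ / 2) (|a| / (2 * (|b| + 1))) with ht
    have ht0 : 0 < t := lt_min (by linarith) (by positivity)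
    have h1 := hb t ht0 ((min_le_left _ _).trans_lt (by linarith))
    have h2 : t * (2 * (|b| + 1)) ≤ |a| := by
      rw [← le_div_iff₀ (by positivity)]
      exact min_le_right _ _
    have h3 : t * |a| ≤ |t * a + t ^ 2 * b| + t ^ 2 * |b| := by
      have := abs_sub (t * a + t ^ 2 * b) (t ^ 2 * b)
      rw [add_sub_cancel_right, abs_mul, abs_of_pos ht0, abs_mul (t ^ 2),
        abs_of_pos (by positivity : 0 < t ^ 2)] at this
      exact this
    have h4 : t * |a| ≤ t * (t * (|b| + 1)) := by linarith
    have h5 := le_of_mul_le_mul_left h4 ht0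
    nlinarith
  refine ⟨ha, ?_⟩
  by_contra hne
  have hp : 0 < |b| := abs_pos.2 hne
  obtain ⟨δ, hδ, hb⟩ := h (|b| / 2) (by positivity)
  have h1 := hb (δ / 2) (by linarith) (by linarith)
  have hq : 0 < (δ / 2) ^ 2 := by positivity
  rw [ha, mul_zero, zero_add, abs_mul, abs_of_pos hq] at h1
  nlinarith

/-- A difference of two continuous operator forms with the same multiplier and with potentials p and
0; the multiplier parts cancel. -/
theorem continuous_potentialForm (hθ : ∃ θ, IsSymbol θ m) {p : ℝ → ℝ}
    (hp : Continuous p) : Continuous fun v : Hper L (m / 2) => ∫ x in (0 : ℝ)..L, p x * v x * v x := by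
  obtain ⟨θ, hθ⟩ := hθ
  obtain ⟨B, hB⟩ := exists_opForm (L := L) hθ hp
  obtain ⟨B₀, hB₀⟩ := exists_opForm (L := L) hθ (continuous_const (y := (0 : ℝ)))
  have e : (fun v : Hper L (m / 2) => ∫ x in (0 : ℝ)..L, p x * v x * v x)
      = fun v => B v v - B₀ v v := by
    funext v
    rw [hB, hB₀, opForm, opForm]
    simp
  rw [e]
  fun_prop

theorem continuous_integral_mul {r : ℝ} (hr : 0 ≤ r) {g : ℝ → ℝ} (hg : MemLp g 2 (perMeasure L)) :
    Continuous fun v : Hper L r => ∫ x in (0 : ℝ)..L, g x * v x := by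
  have e : (fun v : Hper L r => ∫ x in (0 : ℝ)..L, g x * v x)
      = fun v => inner ℝ (Hper.ofFun g hg (summable_zero_of_memLp hg) : Hper L 0)
        (Hper.incl hr v) := by
    funext v
    rw [Hper.inner_zero_eq, Hper.toL2_incl]
    refine integral_congr_per ?_
    filter_upwards [Hper.coe_ofFun (s := 0) g hg (summable_zero_of_memLp hg)] with x hx
    rw [hx]
  rw [e]
  fun_prop

/-- Second order Taylor expansion of the potential energy in `H^{m/2}`. -/
theorem exists_taylor_potential (hθ : ∃ θ, IsSymbol θ m) (hf : ContDiff ℝ (⊤ : ℕ∞) f)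
    (hE : m ≤ 1 → PotentialEnergyC2 L f (m / 2)) {φ : ℝ → ℝ} (hφ : Continuous φ)
    (a : Hper L (m / 2)) (ha : ⇑a.toL2 =ᵐ[perMeasure L] φ) {ε : ℝ} (hε : 0 < ε) :
    ∃ δ > 0, ∀ v : Hper L (m / 2), ‖v‖ < δ →
      |potentialRem L f φ v (a + v).toL2| ≤ ε * ‖v‖ ^ 2 := by
  have hm0 : 0 < m := hθ.elim fun _ h => h.pos
  have hm : 0 ≤ m / 2 := by linarith
  have hav : ∀ v : Hper L (m / 2), ⇑(a + v).toL2 =ᵐ[perMeasure L] fun x => φ x + v x := fun v => by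
    filter_upwards [ha, Hper.coe_add a v] with x h1 h2
    rw [h2, h1]
  have hpa : potential L f a = potential L f φ := by
    refine integral_congr_per ?_
    filter_upwards [ha] with x hx
    rw [hx]
  by_cases hm1 : m ≤ 1
  · have hN : ContDiff ℝ 2 fun u : Hper L (m / 2) => potential L f u := (hE hm1).2
    set N := fun u : Hper L (m / 2) => potential L f u with hNdef
    have hf' : Continuous (deriv f) := hf.continuous_deriv (by exact_mod_cast le_top)
    have hQc := continuous_integral_mul (L := L) hm
      (memLp_of_continuous (L := L) (hf.continuous.comp hφ))
    have hqc := continuous_potentialForm (L := L) hθ (hf'.comp hφ)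
    -- Along t v with v bounded there are two expansions to order t²: the abstract one from C²
    -- regularity and the pointwise one from Taylor's formula for W. Matching them identifies both
    -- derivatives at a in bounded directions; density and continuity give all directions.
    have hbdd : ∀ v : Hper L (m / 2), (∃ C, ∀ᵐ x ∂perMeasure L, |v x| ≤ C) →
        fderiv ℝ N a v - (∫ x in (0 : ℝ)..L, f (φ x) * v x) = 0 ∧
        1 / 2 * fderiv ℝ (fderiv ℝ N) a v v
          - 1 / 2 * (∫ x in (0 : ℝ)..L, deriv f (φ x) * v x * v x) = 0 := by
      rintro v ⟨S, hS⟩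
      refine eq_zero_of_quadratic_small fun η hη => ?_
      obtain ⟨C, hC, hCb⟩ := exists_potentialRem_le (L := L) hf hφ |S|
      obtain ⟨δ, hδ, hT⟩ := exists_taylor_of_contDiff hN a
        (ε := η / 2 / (‖v‖ ^ 2 + 1)) (by positivity)
      -- These bounds keep t|S| within |S|, t v within the radius of the abstract expansion, and the
      -- cubic error C t³|S|‖v‖² below (η/2)t².
      refine ⟨min 1 (min (δ / (‖v‖ + 1)) (η / 2 / (C * |S| * ‖v‖ ^ 2 + 1))),
        lt_min one_pos (lt_min (by positivity) (by positivity)), fun t ht0 ht => ?_⟩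
      have ht1 : t < 1 := ht.trans_le (min_le_left _ _)
      have ht2 : t < δ / (‖v‖ + 1) :=
        ht.trans_le ((min_le_right _ _).trans (min_le_left _ _))
      have ht3 : t < η / 2 / (C * |S| * ‖v‖ ^ 2 + 1) :=
        ht.trans_le ((min_le_right _ _).trans (min_le_right _ _))
      rw [lt_div_iff₀ (by positivity)] at ht2 ht3
      have hnt : ‖t • v‖ = t * ‖v‖ := by rw [norm_smul, Real.norm_of_nonneg ht0.le]
      have h1 := hT (t • v) (by rw [hnt]; nlinarith [norm_nonneg v])
      have hsm := Hper.coe_smul t v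
      have h2 := hCb hm (t • v) (a + t • v).toL2 (t * |S|)
        (mul_le_of_le_one_left (abs_nonneg _) ht1.le) (hav _) (by
          filter_upwards [hS, hsm] with x hx h3
          rw [h3, abs_mul, abs_of_pos ht0]
          have := hx.trans (le_abs_self S)
          gcongr)
      have e1 : ∫ x in (0 : ℝ)..L, f (φ x) * (t • v).toL2 x
          = t * ∫ x in (0 : ℝ)..L, f (φ x) * v x := by
        rw [← intervalIntegral.integral_const_mul]
        refine integral_congr_per ?_
        filter_upwards [hsm] with x h3
        rw [h3]
        ring
      have e2 : ∫ x in (0 : ℝ)..L, deriv f (φ x) * (t • v).toL2 x * (t • v).toL2 x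
          = t ^ 2 * ∫ x in (0 : ℝ)..L, deriv f (φ x) * v x * v x := by
        rw [← intervalIntegral.integral_const_mul]
        refine integral_congr_per ?_
        filter_upwards [hsm] with x h3
        rw [h3]
        ring
      rw [potentialRem, e1, e2, hnt, ← hpa] at h2
      simp only [map_smul, smul_apply, smul_eq_mul, hnt] at h1
      change |N (a + t • v) - N a - _ - _| ≤ _ at h2
      have h3 : η / 2 / (‖v‖ ^ 2 + 1) * (t * ‖v‖) ^ 2 ≤ η / 2 * t ^ 2 := by
        rw [div_mul_eq_mul_div, div_le_iff₀ (by positivity), mul_pow]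
        nlinarith [mul_pos hη (pow_pos ht0 2)]
      have h4 : C * (t * |S|) * (t * ‖v‖) ^ 2 ≤ η / 2 * t ^ 2 := by
        have : t * (C * |S| * ‖v‖ ^ 2) ≤ η / 2 := by linarith
        calc C * (t * |S|) * (t * ‖v‖) ^ 2 = t * (C * |S| * ‖v‖ ^ 2) * t ^ 2 := by ring
          _ ≤ η / 2 * t ^ 2 := by gcongr
      have h5 := abs_sub
        (N (a + t • v) - N a - t * (∫ x in (0 : ℝ)..L, f (φ x) * v x)
          - 1 / 2 * (t ^ 2 * ∫ x in (0 : ℝ)..L, deriv f (φ x) * v x * v x))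
        (N (a + t • v) - N a - t * fderiv ℝ N a v
          - 1 / 2 * (t * (t * fderiv ℝ (fderiv ℝ N) a v v)))
      refine le_trans (le_of_eq ?_) (h5.trans ((add_le_add (h2.trans h4) (h1.trans h3)).trans
        (le_of_eq (by ring))))
      congr 1
      ring
    have hdense : Dense {v : Hper L (m / 2) | ∃ C, ∀ᵐ x ∂perMeasure L, |v x| ≤ C} := by
      refine Metric.dense_iff.2 fun u η hη => ?_
      obtain ⟨v, -, hv, hvu⟩ := u.exists_approx hη
      exact ⟨v, mem_ball_iff_norm.2 hvu, hv⟩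
    have hQ := Continuous.ext_on hdense (fderiv ℝ N a).continuous hQc
      fun v hv => sub_eq_zero.1 (hbdd v hv).1
    have hq := Continuous.ext_on hdense
      (f := fun v => 1 / 2 * fderiv ℝ (fderiv ℝ N) a v v) (by fun_prop) (hqc.const_mul (1 / 2))
      fun v hv => sub_eq_zero.1 (hbdd v hv).2
    obtain ⟨δ, hδ, hT⟩ := exists_taylor_of_contDiff hN a hε
    refine ⟨δ, hδ, fun v hv => ?_⟩
    have h1 := hT v hv
    rw [congrFun hQ v, show 1 / 2 * fderiv ℝ (fderiv ℝ N) a v v = _ from congrFun hq v] at h1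
    rw [potentialRem, ← hpa]
    exact h1
  · have hr : 1 / 2 < m / 2 := by linarith
    obtain ⟨D, hD, hb⟩ := Hper.exists_sup_bound L hr
    obtain ⟨C, hC, hCb⟩ := exists_potentialRem_le (L := L) hf hφ D
    -- For m > 1 every direction is bounded, by D‖v‖, so the remainder is at most C D‖v‖³.
    refine ⟨min 1 (ε / (C * D)), lt_min one_pos (by positivity), fun v hv => ?_⟩
    have h1 : ‖v‖ ≤ 1 := (hv.trans_le (min_le_left _ _)).le
    have h2 : ‖v‖ ≤ ε / (C * D) := (hv.trans_le (min_le_right _ _)).le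
    rw [le_div_iff₀ (by positivity)] at h2
    refine (hCb hm v _ (D * ‖v‖) (mul_le_of_le_one_right hD.le h1) (hav v) (hb v)).trans ?_
    have : C * (D * ‖v‖) ≤ ε := by linarith
    gcongr

end potential

/-! ### Conservation laws -/

/-- Termwise differentiation of a weighted pairing of coefficients. The weighted coefficients have a
summable majorant b and the time derivatives are merely bounded by C, so the differentiated terms
are dominated by 2LC b k. -/
theorem hasDerivAt_form {L : ℝ} (hL : 0 < L) {ρ : ℤ → ℝ} {c d c' d' : ℤ → ℝ → ℂ} {b : ℤ → ℝ} {C : ℝ} {U : Set ℝ}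
    (hU : IsOpen U) (hU' : IsPreconnected U) (hb : Summable b)
    (hc : ∀ k, ∀ t ∈ U, HasDerivAt (c k) (c' k t) t)
    (hd : ∀ k, ∀ t ∈ U, HasDerivAt (d k) (d' k t) t)
    (hcb : ∀ k, ∀ t ∈ U, |ρ k| * ‖c k t‖ ≤ b k) (hdb : ∀ k, ∀ t ∈ U, |ρ k| * ‖d k t‖ ≤ b k)
    (hc'C : ∀ k, ∀ t ∈ U, ‖c' k t‖ ≤ C) (hd'C : ∀ k, ∀ t ∈ U, ‖d' k t‖ ≤ C)
    {t : ℝ} (ht : t ∈ U)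
    (hs : Summable fun k => L * (ρ k * ((starRingEnd ℂ) (c k t) * d k t).re)) :
    (Summable fun k => L * (ρ k * ((starRingEnd ℂ) (c' k t) * d k t
      + (starRingEnd ℂ) (c k t) * d' k t).re)) ∧
    HasDerivAt (fun t => ∑' k, L * (ρ k * ((starRingEnd ℂ) (c k t) * d k t).re))
      (∑' k, L * (ρ k * ((starRingEnd ℂ) (c' k t) * d k t
        + (starRingEnd ℂ) (c k t) * d' k t).re)) t := by
  have hbound : ∀ k, ∀ t ∈ U, ‖L * (ρ k * ((starRingEnd ℂ) (c' k t) * d k t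
      + (starRingEnd ℂ) (c k t) * d' k t).re)‖ ≤ L * (2 * C) * b k := by
    intro k t ht
    rw [Real.norm_eq_abs, abs_mul, abs_of_pos hL, abs_mul]
    have h1 : |((starRingEnd ℂ) (c' k t) * d k t + (starRingEnd ℂ) (c k t) * d' k t).re|
        ≤ C * ‖d k t‖ + ‖c k t‖ * C := by
      refine (Complex.abs_re_le_norm _).trans ((norm_add_le _ _).trans ?_)
      rw [norm_mul, norm_mul, RCLike.norm_conj, RCLike.norm_conj]
      gcongr
      exacts [hc'C k t ht, hd'C k t ht]
    have hC : 0 ≤ C := (norm_nonneg _).trans (hc'C k t ht)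
    have h2 := mul_le_mul_of_nonneg_left h1 (abs_nonneg (ρ k))
    have h3 := mul_le_mul_of_nonneg_left (hcb k t ht) hC
    have h4 := mul_le_mul_of_nonneg_left (hdb k t ht) hC
    rw [mul_assoc]
    refine mul_le_mul_of_nonneg_left ?_ hL.le
    nlinarith
  refine ⟨Summable.of_norm_bounded (hb.mul_left _) fun k => hbound k t ht, ?_⟩
  refine hasDerivAt_tsum_of_isPreconnected (hb.mul_left (L * (2 * C))) hU hU' ?_ hbound ht hs ht
  intro k t ht
  have h1 : HasDerivAt (fun t => (starRingEnd ℂ) (c k t) * d k t)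
      ((starRingEnd ℂ) (c' k t) * d k t + (starRingEnd ℂ) (c k t) * d' k t) t :=
    ((hc k t ht).star).mul (hd k t ht)
  have h2 := (Complex.reCLM.hasFDerivAt.comp_hasDerivAt t h1)
  exact (h2.const_mul (ρ k)).const_mul L

theorem norm_freq {L : ℝ} (hL : 0 < L) (k : ℤ) :
    ‖(2 * Real.pi * Complex.I * k / L : ℂ)‖ = 2 * Real.pi / L * |(k : ℝ)| := by
  rw [norm_div, norm_mul, norm_mul, norm_mul, Complex.norm_I, Complex.norm_real,
    Complex.norm_real, Complex.norm_intCast, Real.norm_eq_abs, Real.norm_eq_abs,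
    abs_of_pos Real.pi_pos, abs_of_pos hL]
  norm_num
  ring

/-- The energy. -/
def energy (L : ℝ) (f θ u : ℝ → ℝ) : ℝ := 1 / 2 * mulForm L θ u u - potential L f u

section conservation

variable {L m r : ℝ} [hL : Fact (0 < L)] {f θ : ℝ → ℝ}

theorem continuous_mulForm (hθ : IsSymbol θ m) :
    Continuous fun u : Hper L (m / 2) => mulForm L θ u u := by
  obtain ⟨B, hB⟩ := exists_opForm (L := L) hθ (p := fun _ => 0) continuous_const
  have h : (fun u : Hper L (m / 2) => mulForm L θ u u) = fun u => B u u := by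
    funext u
    rw [hB, opForm]
    simp
  rw [h]
  fun_prop

theorem continuous_energy (hθ : IsSymbol θ m) (hf : ContDiff ℝ (⊤ : ℕ∞) f)
    (hE : m ≤ 1 → PotentialEnergyC2 L f (m / 2)) :
    Continuous fun u : Hper L (m / 2) => energy L f θ u :=
  ((continuous_mulForm hθ).const_mul _).sub (continuous_potential hf hE)

theorem continuous_integral_sq (hr : 0 ≤ r) :
    Continuous fun u : Hper L r => ∫ x in (0 : ℝ)..L, u x ^ 2 := by
  simp_rw [Hper.integral_sq_eq hr]
  fun_prop

/-- Decay of the Fourier coefficients. -/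
theorem exists_coeff_decay (hθ : IsSymbol θ m) (hr : m + 4 ≤ r) : ∃ C, 0 < C ∧
    ∀ (u : Hper L r) (k : ℤ), (1 + (k : ℝ) ^ 2) * ((1 + |θ k|) * ‖coeff L u k‖) ≤ C * ‖u‖ := by
  obtain ⟨C, hC, hθC⟩ := hθ.exists_abs_le
  have hm := hθ.pos
  refine ⟨(1 + C) / Real.sqrt L, div_pos (by positivity) (Real.sqrt_pos.2 hL.out), fun u k => ?_⟩
  set w : ℝ := 1 + (k : ℝ) ^ 2 with hw
  have hw1 : 1 ≤ w := by rw [hw]; nlinarith [sq_nonneg (k : ℝ)]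
  have hw0 : 0 < w := by linarith
  have h1 : w ^ (r / 2) * ‖coeff L u k‖ ≤ ‖u‖ / Real.sqrt L := by
    rw [le_div_iff₀ (Real.sqrt_pos.2 hL.out)]
    refine abs_le_of_sq_le_sq' ?_ (norm_nonneg _) |>.2
    have := u.term_le_norm_sq k
    refine le_trans (le_of_eq ?_) this
    rw [mul_pow, mul_pow, Real.sq_sqrt hL.out.le, ← Real.rpow_natCast (w ^ (r / 2)),
      ← Real.rpow_mul hw0.le]
    norm_num
    ring
  have h2 : w * (1 + |θ k|) ≤ (1 + C) * w ^ (r / 2) := by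
    have h3 : (1 : ℝ) ≤ w ^ (m / 2) := Real.one_le_rpow hw1 (by positivity)
    have h4 : w * w ^ (m / 2) ≤ w ^ (r / 2) := by
      rw [← Real.rpow_one_add' hw0.le (by positivity)]
      exact Real.rpow_le_rpow_of_exponent_le hw1 (by linarith)
    have h5 := hθC k
    calc w * (1 + |θ k|) ≤ w * ((1 + C) * w ^ (m / 2)) := by
          refine mul_le_mul_of_nonneg_left ?_ hw0.le
          linarith
      _ = (1 + C) * (w * w ^ (m / 2)) := by ring
      _ ≤ _ := by gcongr
  calc w * ((1 + |θ k|) * ‖coeff L u k‖) = w * (1 + |θ k|) * ‖coeff L u k‖ := by ring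
    _ ≤ (1 + C) * w ^ (r / 2) * ‖coeff L u k‖ := by gcongr
    _ = (1 + C) * (w ^ (r / 2) * ‖coeff L u k‖) := by ring
    _ ≤ (1 + C) * (‖u‖ / Real.sqrt L) := by gcongr
    _ = _ := by ring

theorem continuous_coeff_comp (hf : ContDiff ℝ (⊤ : ℕ∞) f) (hr : 1 / 2 < r) (k : ℤ) :
    Continuous fun u : Hper L r => coeff L (fun x => f (u x)) k := by
  obtain ⟨S, hS, hsup⟩ := Hper.exists_sup_bound L hr
  rw [continuous_iff_continuousAt]
  intro u
  obtain ⟨C, hC, hlip⟩ := exists_lipschitz (hf.of_le (by exact_mod_cast le_top))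
    (S * ‖u‖ + S)
  rw [ContinuousAt, tendsto_iff_norm_sub_tendsto_zero]
  have h0 : Tendsto (fun v : Hper L r => C * (S * ‖v - u‖)) (𝓝 u) (𝓝 0) := by
    have : Continuous fun v : Hper L r => C * (S * ‖v - u‖) := by fun_prop
    simpa using this.tendsto u
  refine squeeze_zero' (Eventually.of_forall fun _ => norm_nonneg _) ?_ h0
  filter_upwards [Metric.ball_mem_nhds u one_pos] with v hv
  rw [Metric.mem_ball, dist_eq_norm] at hv
  have b1 := hsup u
  have b2 := hsup (v - u)
  have b3 : ∀ᵐ x ∂perMeasure L, v x = u x + (v - u).toL2 x := by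
    filter_upwards [Hper.coe_sub v u] with x hx
    rw [hx]
    ring
  have i : ∀ w : Hper L r, IntervalIntegrable (fun x => f (w x)) volume 0 L := fun w =>
    intervalIntegrable_comp_of_bounded hf.continuous w.aestronglyMeasurable (hsup w)
  rw [← coeff_fun_sub (i v) (i u)]
  refine norm_coeff_le_of_bound hL.out ?_ k
  filter_upwards [b1, b2, b3] with x h1 h2 h3
  rw [h3]
  refine (hlip _ _ (by linarith) (h2.trans ?_)).trans (by gcongr)
  nlinarith [norm_nonneg u]

/-- The smooth representative of an element of `H^r`. -/
theorem exists_representative (hr : 5 / 2 < r) : ∃ C, 0 < C ∧ ∀ u : Hper L r,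
    ∃ U U' U'' : ℝ → ℝ, ⇑u.toL2 =ᵐ[perMeasure L] U ∧ Function.Periodic U L ∧
      (∀ x, HasDerivAt U (U' x) x) ∧ (∀ x, HasDerivAt U' (U'' x) x) ∧ Continuous U'' ∧
      Function.Periodic U' L ∧
      ∀ x, |U x| ≤ C * ‖u‖ ∧ |U' x| ≤ C * ‖u‖ ∧ |U'' x| ≤ C * ‖u‖ := by
  obtain ⟨C, hC, hsum⟩ := Hper.exists_summable_bound L (a := 1) (r := r) (by linarith)
  have hLp := hL.out
  set a : ℝ := 2 * Real.pi / L with ha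
  have ha0 : 0 < a := by positivity
  have hn : ∀ k : ℤ, ‖(2 * Real.pi * Complex.I * k / L : ℂ)‖ = a * |(k : ℝ)| := norm_freq hLp
  refine ⟨(1 + a + a ^ 2) * C, by positivity, fun u => ?_⟩
  obtain ⟨hs, hle⟩ := hsum u
  simp only [Real.rpow_one] at hs hle
  have hk1 : ∀ k : ℤ, |(k : ℝ)| ≤ 1 + (k : ℝ) ^ 2 := fun k => by
    rw [← sq_abs]; nlinarith [sq_nonneg (|(k : ℝ)| - 1), abs_nonneg (k : ℝ)]
  set c := coeff L u with hc
  set c1 : ℤ → ℂ := fun k => 2 * Real.pi * Complex.I * k / L * c k with hc1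
  set c2 : ℤ → ℂ := fun k => 2 * Real.pi * Complex.I * k / L * c1 k with hc2
  have s0 : Summable fun k => ‖c k‖ := by
    refine Summable.of_nonneg_of_le (fun _ => norm_nonneg _) (fun k => ?_) hs
    nlinarith [norm_nonneg (c k), sq_nonneg (k : ℝ)]
  have n1 : ∀ k, ‖c1 k‖ ≤ a * ((1 + (k : ℝ) ^ 2) * ‖c k‖) := by
    intro k
    rw [hc1]
    simp only [norm_mul]
    rw [hn, mul_assoc]
    have := hk1 k
    gcongr
  have s1 : Summable fun k => ‖c1 k‖ :=
    Summable.of_nonneg_of_le (fun _ => norm_nonneg _) n1 (hs.mul_left a)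
  have n2 : ∀ k, ‖c2 k‖ ≤ a ^ 2 * ((1 + (k : ℝ) ^ 2) * ‖c k‖) := by
    intro k
    rw [hc2, hc1]
    simp only [norm_mul]
    rw [hn]
    have : |(k : ℝ)| * |(k : ℝ)| ≤ 1 + (k : ℝ) ^ 2 := by rw [abs_mul_abs_self]; nlinarith
    calc a * |(k : ℝ)| * (a * |(k : ℝ)| * ‖c k‖) = a ^ 2 * ((|(k : ℝ)| * |(k : ℝ)|) * ‖c k‖) := by
          ring
      _ ≤ _ := by gcongr
  have s2 : Summable fun k => ‖c2 k‖ :=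
    Summable.of_nonneg_of_le (fun _ => norm_nonneg _) n2 (hs.mul_left _)
  have t1 : Summable fun k : ℤ => |(k : ℝ)| * ‖c k‖ :=
    Summable.of_nonneg_of_le (fun _ => by positivity)
      (fun k => mul_le_mul_of_nonneg_right (hk1 k) (norm_nonneg _)) hs
  have t2 : Summable fun k : ℤ => |(k : ℝ)| * ‖c1 k‖ := by
    refine (s2.mul_left a⁻¹).congr fun k => ?_
    rw [hc2]
    simp only [norm_mul]
    rw [hn]
    field_simp
  have hCu : 0 ≤ C * ‖u‖ := by positivity
  refine ⟨synth L c, synth L c1, synth L c2, ae_eq_synth hLp u.memLp s0, periodic_synth hLp c,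
    hasDerivAt_synth hLp s0 t1, hasDerivAt_synth hLp s1 t2, continuous_synth s2,
    periodic_synth hLp c1, fun x => ⟨?_, ?_, ?_⟩⟩
  · refine (abs_synth_le s0 x).trans ((s0.tsum_le_tsum (fun k => ?_) hs).trans (hle.trans ?_))
    · nlinarith [norm_nonneg (c k), sq_nonneg (k : ℝ)]
    · nlinarith
  · refine (abs_synth_le s1 x).trans ((s1.tsum_le_tsum n1 (hs.mul_left a)).trans ?_)
    rw [tsum_mul_left]
    have := mul_le_mul_of_nonneg_left hle ha0.le
    nlinarith [sq_nonneg a]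
  · refine (abs_synth_le s2 x).trans ((s2.tsum_le_tsum n2 (hs.mul_left _)).trans ?_)
    rw [tsum_mul_left]
    have := mul_le_mul_of_nonneg_left hle (sq_nonneg a)
    nlinarith [sq_nonneg a]

/-- Two integrations by parts on the C² representative U: the coefficients of (f ∘ U)'' are bounded,
and they equal −(2πk/L)² times those of f ∘ U. -/
theorem exists_coeff_comp_decay (hf : ContDiff ℝ (⊤ : ℕ∞) f) (hr : 5 / 2 < r) (R : ℝ) :
    ∃ C, 0 < C ∧ ∀ u : Hper L r, ‖u‖ ≤ R → ∀ k : ℤ,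
      (1 + (k : ℝ) ^ 2) * ‖coeff L (fun x => f (u x)) k‖ ≤ C := by
  obtain ⟨S, hS, hrep⟩ := exists_representative (L := L) hr
  have hLp := hL.out
  have hf1 : ContDiff ℝ (⊤ : ℕ∞) (deriv f) := by
    exact (contDiff_infty_iff_deriv.1 hf).2
  have hf2 : Continuous (deriv (deriv f)) := hf1.continuous_deriv (by exact_mod_cast le_top)
  obtain ⟨C0, hC0, b0⟩ := exists_abs_le_of_continuous hf.continuous (S * R)
  obtain ⟨C1, hC1, b1⟩ := exists_abs_le_of_continuous hf1.continuous (S * R)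
  obtain ⟨C2, hC2, b2⟩ := exists_abs_le_of_continuous hf2 (S * R)
  set a : ℝ := 2 * Real.pi / L with ha
  have ha0 : 0 < a := by positivity
  refine ⟨C0 + (C2 * (S * R) ^ 2 + C1 * |S * R|) / a ^ 2, by positivity, fun u hu k => ?_⟩
  obtain ⟨U, U', U'', hU, hper, d1, d2, hc, hper', hb⟩ := hrep u
  have hSR : S * ‖u‖ ≤ S * R := by gcongr
  have dU : ∀ x, HasDerivAt (fun x => f (U x)) (deriv f (U x) * U' x) x := fun x =>
    ((hf.differentiable (by simp)).differentiableAt.hasDerivAt).comp x (d1 x)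
  have dU' : ∀ x, HasDerivAt (fun x => deriv f (U x) * U' x)
      (deriv (deriv f) (U x) * U' x * U' x + deriv f (U x) * U'' x) x := fun x =>
    (((hf1.differentiable (by simp)).differentiableAt.hasDerivAt).comp x (d1 x)).mul (d2 x)
  have cU : Continuous U := continuous_iff_continuousAt.2 fun x => (d1 x).continuousAt
  have cU' : Continuous U' := continuous_iff_continuousAt.2 fun x => (d2 x).continuousAt
  have e1 := coeff_deriv hLp (g := fun x => f (U x)) (fun x => by simp only [hper x]) dU
    ((hf1.continuous.comp cU).mul cU') k
  have e2 := coeff_deriv hLp (g := fun x => deriv f (U x) * U' x)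
    (fun x => by simp only [hper x, hper' x]) dU'
    ((((hf2.comp cU).mul cU').mul cU').add ((hf1.continuous.comp cU).mul hc)) k
  have e0 : coeff L (fun x => f (u x)) k = coeff L (fun x => f (U x)) k := by
    refine coeff_congr hLp ?_ k
    filter_upwards [hU] with x hx
    rw [hx]
  rw [e0]
  have n0 : ‖coeff L (fun x => f (U x)) k‖ ≤ C0 :=
    norm_coeff_le_of_bound hLp (Eventually.of_forall fun x => b0 _ ((hb x).1.trans hSR)) k
  have n2 : ‖coeff L (fun x => deriv (deriv f) (U x) * U' x * U' x + deriv f (U x) * U'' x) k‖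
      ≤ C2 * (S * R) ^ 2 + C1 * |S * R| := by
    refine norm_coeff_le_of_bound hLp (Eventually.of_forall fun x => ?_) k
    have h0 := (hb x).1.trans hSR
    have h1 := (hb x).2.1.trans hSR
    have h2 := ((hb x).2.2.trans hSR).trans (le_abs_self _)
    refine (abs_add_le _ _).trans ?_
    rw [mul_assoc, abs_mul, abs_mul, abs_mul (deriv f (U x)), sq]
    have := b1 _ h0
    have := b2 _ h0
    gcongr
    exact (abs_nonneg _).trans h1
  rw [e2, e1, ← mul_assoc, norm_mul] at n2
  have hn : ‖(2 * Real.pi * Complex.I * k / L * (2 * Real.pi * Complex.I * k / L) : ℂ)‖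
      = a ^ 2 * (k : ℝ) ^ 2 := by
    rw [norm_mul, norm_freq hLp, ← sq_abs (k : ℝ)]
    ring
  rw [hn] at n2
  rw [add_mul, one_mul]
  refine add_le_add n0 ?_
  rw [le_div_iff₀ (by positivity)]
  linarith

end conservation

/-- The derivative is read off from a comparison function when the error is controlled by an R with
a double zero. It is applied with P the potential energy along the solution, Q(τ) = ∫f(u(t))u(τ) and
R(τ) = ‖u(τ) − u(t)‖² in L². -/
theorem hasDerivAt_of_abs_sub_le {P Q R : ℝ → ℝ} {Q' C t : ℝ} (hQ : HasDerivAt Q Q' t)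
    (hR : HasDerivAt R 0 t) (hRt : R t = 0)
    (h : ∀ᶠ τ in 𝓝 t, |P τ - P t - (Q τ - Q t)| ≤ C * |R τ|) : HasDerivAt P Q' t := by
  rw [hasDerivAt_iff_isLittleO] at hQ hR ⊢
  have h1 : (fun τ => P τ - P t - (Q τ - Q t)) =O[𝓝 t] fun τ => R τ - R t - (τ - t) • (0 : ℝ) := by
    refine Asymptotics.IsBigO.of_bound C ?_
    filter_upwards [h] with τ hτ
    simpa [hRt] using hτ
  exact ((h1.trans_isLittleO hR).add hQ).congr_left fun τ => by ring

/-- The time derivative of the `k`-th Fourier coefficient of a solution. -/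
def flux (L : ℝ) (f θ u : ℝ → ℝ) (k : ℤ) : ℂ :=
  -(2 * Real.pi * Complex.I * k / L) * (coeff L (fun x => f (u x)) k - (θ k : ℂ) * coeff L u k)

/-- Hamiltonian structure in one mode: the flux is 2πik/L times the coefficient of the energy
gradient 𝓜u − f(u), hence a quarter turn away from it. -/
theorem re_conj_mul_flux (L : ℝ) (f θ u : ℝ → ℝ) (k : ℤ) :
    ((starRingEnd ℂ) ((θ k : ℂ) * coeff L u k - coeff L (fun x => f (u x)) k)
      * flux L f θ u k).re = 0 := by
  have e : (starRingEnd ℂ) ((θ k : ℂ) * coeff L u k - coeff L (fun x => f (u x)) k)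
      * flux L f θ u k = ((2 * Real.pi * k / L *
        Complex.normSq ((θ k : ℂ) * coeff L u k - coeff L (fun x => f (u x)) k) : ℝ) : ℂ)
          * Complex.I := by
    push_cast
    rw [Complex.normSq_eq_conj_mul_self, flux]
    ring
  rw [e]
  simp

/-- The dispersive part contributes a purely imaginary multiple of |û(k)|² and drops out, leaving
one mode of (u_x, f(u)). -/
theorem re_conj_coeff_mul_flux (L : ℝ) (f θ u : ℝ → ℝ) (k : ℤ) :
    ((starRingEnd ℂ) (coeff L u k) * flux L f θ u k).re
      = ((starRingEnd ℂ) (2 * Real.pi * Complex.I * k / L * coeff L u k)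
        * coeff L (fun x => f (u x)) k).re := by
  have e : (starRingEnd ℂ) (coeff L u k) * flux L f θ u k
      = (starRingEnd ℂ) (2 * Real.pi * Complex.I * k / L * coeff L u k)
        * coeff L (fun x => f (u x)) k + ((2 * Real.pi * k / L * θ k *
          Complex.normSq (coeff L u k) : ℝ) : ℂ) * Complex.I := by
    push_cast
    rw [Complex.normSq_eq_conj_mul_self, flux]
    simp only [map_mul, map_div₀, Complex.conj_I, Complex.conj_ofReal, map_intCast, map_ofNat]
    ring
  rw [e]
  simp

theorem re_conj_mul_comm (a b : ℂ) : ((starRingEnd ℂ) a * b).re = ((starRingEnd ℂ) b * a).re := by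
  simp [Complex.mul_re]
  ring

theorem memLp_comp_of_bounded {L : ℝ} {g u : ℝ → ℝ} {R : ℝ} (hg : Continuous g)
    (hu : AEStronglyMeasurable u (perMeasure L)) (hR : ∀ᵐ x ∂perMeasure L, |u x| ≤ R) :
    MemLp (fun x => g (u x)) 2 (perMeasure L) := by
  obtain ⟨C, -, hC⟩ := exists_abs_le_of_continuous hg R
  refine MemLp.of_bound (hg.comp_aestronglyMeasurable hu) C ?_
  filter_upwards [hR] with x hx using hC _ hx

section conservation

variable {L m r : ℝ} [hL : Fact (0 < L)] {f θ : ℝ → ℝ}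

/-- The nonlinear term does not change the momentum. -/
theorem hasSum_conj_coeff_mul_flux (hf : ContDiff ℝ (⊤ : ℕ∞) f) (hr : 5 / 2 < r) (u : Hper L r) :
    HasSum (fun k => L * ((starRingEnd ℂ) (coeff L u k) * flux L f θ u k).re) 0 := by
  obtain ⟨C, hC, hrep⟩ := exists_representative (L := L) hr
  obtain ⟨U, U', U'', hU, hper, d1, d2, hc, hper', hb⟩ := hrep u
  have hLp := hL.out
  have cU : Continuous U := continuous_iff_continuousAt.2 fun x => (d1 x).continuousAt
  have cU' : Continuous U' := continuous_iff_continuousAt.2 fun x => (d2 x).continuousAt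
  have h := parseval_inner hLp (memLp_of_continuous cU')
    (memLp_of_continuous (hf.continuous.comp cU))
  have e : ∫ x in (0 : ℝ)..L, U' x * (f ∘ U) x = 0 := by
    have h1 : ∀ x, HasDerivAt (fun x => primitive f (U x)) (U' x * (f ∘ U) x) x := fun x =>
      ((hasDerivAt_primitive hf.continuous (U x)).comp x (d1 x)).congr_deriv (mul_comm _ _)
    rw [intervalIntegral.integral_eq_sub_of_hasDerivAt (fun x _ => h1 x)
      ((cU'.mul (hf.continuous.comp cU)).intervalIntegrable _ _)]
    have := hper 0
    rw [zero_add] at this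
    rw [this, sub_self]
  rw [e] at h
  refine h.congr_fun fun k => ?_
  have ec : coeff L (fun x => f (u x)) k = coeff L (f ∘ U) k := by
    refine coeff_congr hLp ?_ k
    filter_upwards [hU] with x hx
    simp [hx]
  rw [re_conj_coeff_mul_flux, coeff_deriv hLp hper d1 cU', coeff_congr hLp hU k, ec]

theorem exists_norm_flux_le (hθ : IsSymbol θ m) (hf : ContDiff ℝ (⊤ : ℕ∞) f) (hr : m + 4 ≤ r)
    (R : ℝ) : ∃ C, 0 < C ∧ ∀ u : Hper L r, ‖u‖ ≤ R → ∀ k : ℤ, ‖flux L f θ u k‖ ≤ C := by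
  have hm := hθ.pos
  obtain ⟨C1, hC1, h1⟩ := exists_coeff_decay (L := L) hθ hr
  obtain ⟨C2, hC2, h2⟩ := exists_coeff_comp_decay (L := L) hf (r := r) (by linarith) R
  have hLp := hL.out
  refine ⟨2 * Real.pi / L * (C2 + C1 * |R|), by positivity, fun u hu k => ?_⟩
  rw [flux, norm_mul, norm_neg, norm_freq hLp, mul_assoc]
  refine mul_le_mul_of_nonneg_left ?_ (by positivity)
  have hk1 : |(k : ℝ)| ≤ 1 + (k : ℝ) ^ 2 := by
    rw [← sq_abs]; nlinarith [sq_nonneg (|(k : ℝ)| - 1), abs_nonneg (k : ℝ)]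
  have h3 : ‖coeff L (fun x => f (u x)) k - (θ k : ℂ) * coeff L u k‖
      ≤ ‖coeff L (fun x => f (u x)) k‖ + (1 + |θ k|) * ‖coeff L u k‖ := by
    refine (norm_sub_le _ _).trans ?_
    rw [norm_mul, Complex.norm_real, Real.norm_eq_abs]
    linarith [norm_nonneg (coeff L u k)]
  have h4 : C1 * ‖u‖ ≤ C1 * |R| := by
    have := hu.trans (le_abs_self R)
    gcongr
  calc _ ≤ (1 + (k : ℝ) ^ 2) *
      (‖coeff L (fun x => f (u x)) k‖ + (1 + |θ k|) * ‖coeff L u k‖) := by gcongr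
    _ = (1 + (k : ℝ) ^ 2) * ‖coeff L (fun x => f (u x)) k‖
      + (1 + (k : ℝ) ^ 2) * ((1 + |θ k|) * ‖coeff L u k‖) := by ring
    _ ≤ _ := add_le_add (h2 u hu k) ((h1 u k).trans h4)

theorem summable_inv_one_add_sq (C : ℝ) : Summable fun k : ℤ => C / (1 + (k : ℝ) ^ 2) := by
  have := (Hper.summable_weight (p := 1) (by norm_num)).mul_left C
  refine this.congr fun k => ?_
  rw [Real.rpow_neg_one, div_eq_mul_inv]

/-- Momentum and energy of a smooth solution of the equation do not depend on time. -/
theorem conservation_of_smooth (hθ : IsSymbol θ m) (hf : ContDiff ℝ (⊤ : ℕ∞) f) (hr : m + 4 ≤ r)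
    {u : ℝ → Hper L r} (hu : ContinuousOn u (Ici 0))
    (heq : ∀ (k : ℤ) (t : ℝ), 0 ≤ t →
      coeff L (u t) k - coeff L (u 0) k = ∫ τ in (0 : ℝ)..t, flux L f θ (u τ) k)
    (hcE : Continuous fun v : Hper L r => energy L f θ v) {T : ℝ} (hT : 0 < T) :
    energy L f θ (u T) = energy L f θ (u 0) ∧
      ∫ x in (0 : ℝ)..L, u T x ^ 2 = ∫ x in (0 : ℝ)..L, u 0 x ^ 2 := by
  have hm := hθ.pos
  have hLp := hL.out
  have hr2 : 5 / 2 < r := by linarith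
  have hr1 : 1 / 2 < r := by linarith
  obtain ⟨R, hR⟩ := (isCompact_Icc (a := 0) (b := T)).exists_bound_of_continuousOn
    (hu.mono Icc_subset_Ici_self)
  obtain ⟨C, hC, hflux⟩ := exists_norm_flux_le (L := L) hθ hf hr R
  obtain ⟨C1, hC1, hdec⟩ := exists_coeff_decay (L := L) hθ hr
  obtain ⟨C2, hC2, hdec2⟩ := exists_coeff_comp_decay (L := L) hf hr2 R
  obtain ⟨S, hS, hsup⟩ := Hper.exists_sup_bound L hr1
  have hR0 : 0 ≤ R := (norm_nonneg _).trans (hR 0 ⟨le_rfl, hT.le⟩)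
  set U : Set ℝ := Ioo 0 T with hU
  have hUI : ∀ t ∈ U, t ∈ Icc 0 T := fun t ht => ⟨ht.1.le, ht.2.le⟩
  -- One majorant for all applications of `hasDerivAt_form`: C2 serves the coefficients of f(u), and
  -- the factor 2 serves differences of two coefficients of u.
  set b : ℤ → ℝ := fun k => (2 * C1 * R + C2) / (1 + (k : ℝ) ^ 2) with hb
  have hbs : Summable b := summable_inv_one_add_sq _
  have hpos : ∀ k : ℤ, 0 < 1 + (k : ℝ) ^ 2 := fun k => by positivity
  have hbu : ∀ (k : ℤ) (t : ℝ), t ∈ Icc 0 T →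
      (1 + |θ k|) * ‖coeff L (u t) k‖ ≤ C1 * R / (1 + (k : ℝ) ^ 2) := by
    intro k t ht
    rw [le_div_iff₀ (hpos k), mul_comm]
    refine (hdec (u t) k).trans ?_
    have := hR t ht
    gcongr
  have hb1 : ∀ k : ℤ, 2 * (C1 * R / (1 + (k : ℝ) ^ 2)) ≤ b k := by
    intro k
    rw [hb]
    simp only
    rw [← mul_div_assoc, div_le_div_iff_of_pos_right (hpos k)]
    linarith
  have hb0 : ∀ k : ℤ, 0 ≤ C1 * R / (1 + (k : ℝ) ^ 2) := fun k => by positivity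
  -- The flux is continuous in time, so the time-integrated equation may be differentiated by the
  -- fundamental theorem of calculus.
  have hder : ∀ (k : ℤ) (t : ℝ), t ∈ U →
      HasDerivAt (fun τ => coeff L (u τ) k) (flux L f θ (u t) k) t := by
    intro k t ht
    have hcG : ContinuousOn (fun τ => flux L f θ (u τ) k) (Ici 0) := by
      have c1 := (continuous_coeff_comp (L := L) hf hr1 k).comp_continuousOn hu
      have c2 := (continuous_coeff_comp (L := L) (f := fun y => y) contDiff_id hr1 k).comp_continuousOn
        hu
      exact (c1.sub (c2.const_smul (θ k : ℂ))).const_smul (-(2 * Real.pi * Complex.I * k / L) : ℂ)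
    have h1 : HasDerivAt (fun τ => ∫ σ in (0 : ℝ)..τ, flux L f θ (u σ) k)
        (flux L f θ (u t) k) t := by
      refine intervalIntegral.integral_hasDerivAt_right ?_ ?_ ?_
      · refine (hcG.mono ?_).intervalIntegrable
        rw [uIcc_of_le ht.1.le]
        exact Icc_subset_Ici_self
      · exact (hcG.mono Ioi_subset_Ici_self).stronglyMeasurableAtFilter isOpen_Ioi t ht.1
      · exact hcG.continuousAt (Ici_mem_nhds ht.1)
    refine (h1.add_const (coeff L (u 0) k)).congr_of_eventuallyEq ?_
    filter_upwards [Ioi_mem_nhds ht.1] with τ hτ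
    rw [← heq k τ (le_of_lt hτ), sub_add_cancel]
  have hCd : ∀ (k : ℤ) (t : ℝ), t ∈ U → ‖flux L f θ (u t) k‖ ≤ C := fun k t ht =>
    hflux (u t) (hR t (hUI t ht)) k
  have hz : ∀ (k : ℤ) (t : ℝ), t ∈ U → ‖(0 : ℂ)‖ ≤ C := fun _ _ _ => by simp [hC.le]
  have hbθ : ∀ k : ℤ, ∀ t ∈ U, |θ k| * ‖coeff L (u t) k‖ ≤ b k := fun k t ht => by
    have := hbu k t (hUI t ht)
    linarith [hb1 k, hb0 k, norm_nonneg (coeff L (u t) k)]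
  have hbo : ∀ k : ℤ, ∀ t ∈ U, |(1 : ℝ)| * ‖coeff L (u t) k‖ ≤ b k := fun k t ht => by
    have := hbu k t (hUI t ht)
    rw [abs_one]
    nlinarith [hb1 k, hb0 k, mul_nonneg (abs_nonneg (θ k)) (norm_nonneg (coeff L (u t) k))]
  have hmul := fun t (ht : t ∈ U) => hasDerivAt_form hLp (ρ := fun k => θ k) isOpen_Ioo
    isPreconnected_Ioo hbs hder hder hbθ hbθ hCd hCd ht (by
      have := summable_mulForm hθ (Hper.incl (L := L) (show m / 2 ≤ r by linarith) (u t))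
        (Hper.incl (L := L) (show m / 2 ≤ r by linarith) (u t))
      simpa only [Hper.toL2_incl] using this)
  have hsq : ∀ v : ℝ → ℝ, MemLp v 2 (perMeasure L) →
      HasSum (fun k => L * (1 * ((starRingEnd ℂ) (coeff L v k) * coeff L v k).re))
        (∫ x in (0 : ℝ)..L, v x * v x) := fun v hv => by
    simpa only [one_mul] using parseval_inner hLp hv hv
  have hmom := fun t (ht : t ∈ U) => hasDerivAt_form hLp (ρ := fun _ => 1) isOpen_Ioo
    isPreconnected_Ioo hbs hder hder hbo hbo hCd hCd ht (hsq _ (u t).memLp).summable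
  have hfm : ∀ t, MemLp (fun x => f (u t x)) 2 (perMeasure L) := fun t =>
    memLp_comp_of_bounded hf.continuous (u t).aestronglyMeasurable (hsup (u t))
  -- At fixed t the potential energy is compared with the linear functional u(τ) ↦ ∫f(u(t))u(τ),
  -- which can be differentiated mode by mode. Taylor's formula for W bounds the error by the
  -- squared L² distance, whose derivative at τ = t is zero.
  have hpot : ∀ t ∈ U, (Summable fun k => L * ((starRingEnd ℂ) (coeff L (fun x => f (u t x)) k)
        * flux L f θ (u t) k).re) ∧ HasDerivAt (fun τ => potential L f (u τ))
      (∑' k, L * ((starRingEnd ℂ) (coeff L (fun x => f (u t x)) k) * flux L f θ (u t) k).re) t := by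
    intro t ht
    have hbn : ∀ k : ℤ, ∀ τ ∈ U, |(1 : ℝ)| * ‖coeff L (fun x => f (u t x)) k‖ ≤ b k := by
      intro k τ _
      rw [abs_one, one_mul, hb]
      simp only
      rw [le_div_iff₀ (hpos k), mul_comm]
      have h1 := hdec2 (u t) (hR t (hUI t ht)) k
      have : 0 ≤ 2 * C1 * R := by positivity
      linarith
    have hQs : ∀ τ, HasSum (fun k => L * (1 * ((starRingEnd ℂ) (coeff L (fun x => f (u t x)) k)
        * coeff L (u τ) k).re)) (∫ x in (0 : ℝ)..L, f (u t x) * u τ x) := fun τ => by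
      simpa only [one_mul] using parseval_inner hLp (hfm t) (u τ).memLp
    have hQ := hasDerivAt_form hLp (ρ := fun _ => 1)
      (c := fun k _ => coeff L (fun x => f (u t x)) k) (c' := fun _ _ => 0) isOpen_Ioo
      isPreconnected_Ioo hbs (fun k τ _ => hasDerivAt_const _ _) hder hbn hbo hz hCd ht
      (hQs t).summable
    simp only [(hQs _).tsum_eq] at hQ
    simp only [map_zero, zero_mul, zero_add, one_mul] at hQ
    have hbd : ∀ k : ℤ, ∀ τ ∈ U, |(1 : ℝ)| * ‖coeff L (u τ) k - coeff L (u t) k‖ ≤ b k := by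
      intro k τ hτ
      have h1 := hbu k t (hUI t ht)
      have h2 := hbu k τ (hUI τ hτ)
      have := norm_sub_le (coeff L (u τ) k) (coeff L (u t) k)
      rw [abs_one, one_mul]
      nlinarith [hb1 k, mul_nonneg (abs_nonneg (θ k)) (norm_nonneg (coeff L (u t) k)),
        mul_nonneg (abs_nonneg (θ k)) (norm_nonneg (coeff L (u τ) k))]
    have hRs : ∀ τ, HasSum (fun k => L * (1 * ((starRingEnd ℂ)
        (coeff L (u τ) k - coeff L (u t) k) * (coeff L (u τ) k - coeff L (u t) k)).re))
        (∫ x in (0 : ℝ)..L, (u τ - u t).toL2 x * (u τ - u t).toL2 x) := fun τ => by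
      have := hsq _ (u τ - u t).memLp
      simpa only [Hper.coeff_sub] using this
    have hderd : ∀ (k : ℤ), ∀ τ ∈ U,
        HasDerivAt (fun τ => coeff L (u τ) k - coeff L (u t) k) (flux L f θ (u τ) k) τ :=
      fun k τ hτ => (hder k τ hτ).sub_const _
    have hRd := hasDerivAt_form hLp (ρ := fun _ => 1) isOpen_Ioo isPreconnected_Ioo hbs hderd hderd
      hbd hbd hCd hCd ht (hRs t).summable
    simp only [(hRs _).tsum_eq, sub_self, map_zero, zero_mul, mul_zero, add_zero, Complex.zero_re,
      tsum_zero] at hRd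
    refine ⟨hQ.1, ?_⟩
    obtain ⟨D, hD, htay⟩ := exists_taylor_one hf (2 * (S * R))
    refine hasDerivAt_of_abs_sub_le (C := D) hQ.2 hRd.2 ?_ ?_
    · have := (hRs t).tsum_eq
      simp only [sub_self, map_zero, mul_zero, Complex.zero_re, tsum_zero] at this
      rw [sub_self]
      exact this.symm
    · filter_upwards [isOpen_Ioo.mem_nhds ht] with τ hτ
      have st : ∀ᵐ x ∂perMeasure L, |u t x| ≤ S * R := by
        have := hR t (hUI t ht)
        filter_upwards [hsup (u t)] with x hx
        exact hx.trans (by gcongr)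
      have sτ : ∀ᵐ x ∂perMeasure L, |u τ x| ≤ S * R := by
        have := hR τ (hUI τ hτ)
        filter_upwards [hsup (u τ)] with x hx
        exact hx.trans (by gcongr)
      have hW := continuous_primitive hf.continuous
      have i1 := intervalIntegrable_comp_of_bounded hW (u τ).aestronglyMeasurable sτ
      have i2 := intervalIntegrable_comp_of_bounded hW (u t).aestronglyMeasurable st
      have i3 := intervalIntegrable_mul_of_memLp hLp (hfm t) (u τ).memLp
      have i4 := intervalIntegrable_mul_of_memLp hLp (hfm t) (u t).memLp
      have i5 := intervalIntegrable_mul_of_memLp hLp (u τ - u t).memLp (u τ - u t).memLp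
      rw [potential, potential, ← intervalIntegral.integral_sub i1 i2,
        ← intervalIntegral.integral_sub i3 i4,
        ← intervalIntegral.integral_sub (i1.sub i2) (i3.sub i4)]
      have h0 : 0 ≤ ∫ x in (0 : ℝ)..L, (u τ - u t).toL2 x * (u τ - u t).toL2 x :=
        intervalIntegral.integral_nonneg hLp.le fun x _ => mul_self_nonneg _
      rw [abs_of_nonneg h0, ← intervalIntegral.integral_const_mul (D)]
      refine abs_integral_le_of_bound ((i1.sub i2).sub (i3.sub i4)) (i5.const_mul D) ?_
      filter_upwards [st, sτ, Hper.coe_sub (u τ) (u t)] with x h1 h2 h3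
      rw [h3]
      have h4 := htay (u t x) (u τ x - u t x) (by nlinarith [mul_nonneg hS.le hR0])
        ((abs_sub _ _).trans (by linarith))
      rw [sq_abs, add_sub_cancel, sq] at h4
      rwa [← mul_sub]
  have hcont : ∀ {F : Hper L r → ℝ}, Continuous F → ContinuousOn (fun t => F (u t)) (Icc 0 T) :=
    fun hF => hF.comp_continuousOn (hu.mono Icc_subset_Ici_self)
  have hconst : ∀ {g : ℝ → ℝ}, ContinuousOn g (Icc 0 T) → (∀ t ∈ U, HasDerivAt g 0 t) →
      g T = g 0 := by
    intro g hg hg'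
    obtain ⟨c, hc, h⟩ := exists_hasDerivAt_eq_slope g (fun _ => 0) hT hg hg'
    rw [eq_comm, div_eq_zero_iff, or_iff_left (by linarith)] at h
    linarith
  constructor
  · refine hconst (g := fun t => energy L f θ (u t)) (hcont hcE) fun t ht => ?_
    have h1 := ((hmul t ht).2.const_mul (1 / 2)).sub (hpot t ht).2
    refine h1.congr_deriv ?_
    -- The derivative of the energy is the sum over modes of L Re(conj(θû − coefficient of f(u)) ·
    -- flux), and each term vanishes by `re_conj_mul_flux`.
    rw [← tsum_mul_left, ← ((hmul t ht).1.mul_left _).tsum_sub (hpot t ht).1]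
    refine (tsum_congr fun k => ?_).trans tsum_zero
    have h2 := re_conj_mul_flux L f θ (u t) k
    have h3 := re_conj_mul_comm (flux L f θ (u t) k) (coeff L (u t) k)
    rw [map_sub, map_mul, Complex.conj_ofReal, sub_mul, Complex.sub_re, mul_assoc,
      Complex.re_ofReal_mul] at h2
    rw [Complex.add_re, h3]
    linear_combination L * h2
  · have e : ∀ t, ∫ x in (0 : ℝ)..L, u t x ^ 2
        = ∑' k, L * (1 * ((starRingEnd ℂ) (coeff L (u t) k) * coeff L (u t) k).re) := fun t => by
      rw [(hsq _ (u t).memLp).tsum_eq]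
      simp only [sq]
    refine hconst (g := fun t => ∫ x in (0 : ℝ)..L, u t x ^ 2)
      (hcont (continuous_integral_sq (by linarith))) fun t ht => ?_
    simp only [e]
    refine (hmom t ht).2.congr_deriv ?_
    have h1 := (hasSum_conj_coeff_mul_flux (θ := θ) hf hr2 (u t)).mul_left 2
    rw [mul_zero] at h1
    refine (tsum_congr fun k => ?_).trans h1.tsum_eq
    rw [Complex.add_re, re_conj_mul_comm (flux L f θ (u t) k) (coeff L (u t) k)]
    ring

/-- A continuous functional that is conserved by smooth solutions is conserved by all solutions. -/
theorem IsGloballyWellPosed.conserved_of_smooth {s : ℝ} (hwp : IsGloballyWellPosed L f θ s)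
    {F : Hper L s → ℝ} (hF : Continuous F)
    (h : ∀ (u₀ : Hper L s) (u : ℝ → Hper L s), IsGlobalSolution L f θ s u₀ u →
      (∀ r, u₀.toL2 ∈ hperSubmodule L r) → ∀ t, 0 ≤ t → F (u t) = F u₀)
    {u₀ : Hper L s} {u : ℝ → Hper L s} (hu : IsGlobalSolution L f θ s u₀ u) {t : ℝ} (ht : 0 ≤ t) :
    F (u t) = F u₀ := by
  have hap : ∀ n : ℕ, ∃ v : Hper L s, (∀ r, v.toL2 ∈ hperSubmodule L r) ∧
      ‖v - u₀‖ < 1 / ((n : ℝ) + 1) := fun n => by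
    obtain ⟨v, h1, -, h2⟩ := Hper.exists_approx u₀ (ε := 1 / ((n : ℝ) + 1)) (by positivity)
    exact ⟨v, h1, h2⟩
  choose v₀ hv₀ hv₀' using hap
  choose v hv using fun n => hwp.exists_solution (v₀ n)
  have t0 : Tendsto v₀ atTop (𝓝 u₀) := by
    rw [tendsto_iff_norm_sub_tendsto_zero]
    exact squeeze_zero (fun _ => norm_nonneg _) (fun n => (hv₀' n).le)
      tendsto_one_div_add_atTop_nhds_zero_nat
  have t1 : Tendsto (fun n => v n t) atTop (𝓝 (u t)) := by
    rw [Metric.tendsto_atTop]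
    intro ε hε
    obtain ⟨δ, hδ, hd⟩ := hwp.continuous_dependence u₀ u hu (t + 1) (by linarith) ε hε
    obtain ⟨N, hN⟩ := Metric.tendsto_atTop.1 t0 δ hδ
    refine ⟨N, fun n hn => ?_⟩
    rw [dist_eq_norm]
    exact hd (v₀ n) (v n) (hv n) (by simpa [dist_eq_norm] using hN n hn) t ⟨ht, by linarith⟩
  refine tendsto_nhds_unique ((hF.tendsto _).comp t1) ?_
  refine ((hF.tendsto _).comp t0).congr fun n => ?_
  exact (h _ _ (hv n) (hv₀ n) t ht).symm

/-- Mass, momentum and energy are conserved. -/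
theorem IsGlobalSolution.conservation {s : ℝ} (hθ : IsSymbol θ m) (hf : ContDiff ℝ (⊤ : ℕ∞) f)
    (hE : m ≤ 1 → PotentialEnergyC2 L f (m / 2)) (hs : m / 2 ≤ s)
    (hwp : IsGloballyWellPosed L f θ s) {u₀ : Hper L s} {u : ℝ → Hper L s}
    (hu : IsGlobalSolution L f θ s u₀ u) {t : ℝ} (ht : 0 ≤ t) :
    energy L f θ (u t) = energy L f θ u₀ ∧
      (∫ x in (0 : ℝ)..L, u t x ^ 2) = (∫ x in (0 : ℝ)..L, u₀ x ^ 2) ∧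
      ∫ x in (0 : ℝ)..L, u t x = ∫ x in (0 : ℝ)..L, u₀ x := by
  have hm := hθ.pos
  have hs0 : 0 ≤ s := by linarith
  have hcE : ∀ {r : ℝ}, m / 2 ≤ r → Continuous fun v : Hper L r => energy L f θ v := by
    intro r hr
    have := (continuous_energy (L := L) hθ hf hE).comp (Hper.incl (L := L) hr).continuous
    simpa only [Function.comp_def, Hper.toL2_incl] using this
  have hsm : ∀ (u₀ : Hper L s) (u : ℝ → Hper L s), IsGlobalSolution L f θ s u₀ u →
      (∀ r, u₀.toL2 ∈ hperSubmodule L r) → ∀ t, 0 ≤ t →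
      energy L f θ (u t) = energy L f θ u₀ ∧
        (∫ x in (0 : ℝ)..L, u t x ^ 2) = ∫ x in (0 : ℝ)..L, u₀ x ^ 2 := by
    intro u₀ u hu hu₀ t ht
    -- Smooth data stay smooth, so the solution may be lifted to an order at which
    -- `conservation_of_smooth` applies.
    obtain ⟨v, hv, hvu⟩ := hwp.persistence u₀ u hu (fun r _ => hu₀ r) (max s (m + 4))
      (le_max_left _ _)
    have h0 : (v 0).toL2 = u₀.toL2 := by rw [hvu 0 le_rfl, hu.init]
    rcases ht.eq_or_lt with rfl | ht
    · rw [hu.init]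
      exact ⟨rfl, rfl⟩
    have h := conservation_of_smooth (L := L) hθ hf (le_max_right s (m + 4)) hv (fun k t ht => by
      rw [hvu t ht, h0, hu.equation k t ht]
      refine intervalIntegral.integral_congr fun τ hτ => ?_
      rw [uIcc_of_le ht] at hτ
      simp only [flux]
      rw [hvu τ hτ.1]) (hcE (by linarith [le_max_left s (m + 4)])) ht
    rwa [hvu t ht.le, h0] at h
  refine ⟨hwp.conserved_of_smooth (F := fun v => energy L f θ v) (hcE hs)
      (fun u₀ u hu h0 t ht => (hsm u₀ u hu h0 t ht).1) hu ht,
    hwp.conserved_of_smooth (F := fun v => ∫ x in (0 : ℝ)..L, v x ^ 2)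
      (continuous_integral_sq hs0) (fun u₀ u hu h0 t ht => (hsm u₀ u hu h0 t ht).2) hu ht, ?_⟩
  -- The mass is the mode k = 0, where the factor k in the equation vanishes; no approximation is
  -- needed.
  have h := hu.equation 0 t ht
  simp only [Int.cast_zero, mul_zero, zero_div, neg_zero, zero_mul,
    intervalIntegral.integral_zero] at h
  rw [integral_eq_coeff_zero hL.out, integral_eq_coeff_zero hL.out, sub_eq_zero.1 h]

end conservation

/-! ### Distance from the orbit -/

theorem bddBelow_sobolevNorm (L s : ℝ) (w φ : ℝ → ℝ) :
    BddBelow (range fun q : ℝ => sobolevNorm L s (fun x => w x - φ (x + q))) := by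
  refine ⟨0, ?_⟩
  rintro _ ⟨q, rfl⟩
  exact Real.sqrt_nonneg _

section orbit

variable {L s : ℝ} [hL : Fact (0 < L)] {φ : ℝ → ℝ} {Φ e : Hper L s}

theorem coeff_sub_translate (hφ : Continuous φ) (hper : Function.Periodic φ L)
    (hΦ : ⇑Φ.toL2 =ᵐ[perMeasure L] φ) (w : Hper L s) (q : ℝ) (k : ℤ) :
    coeff L (fun x => w x - φ (x + q)) k = coeff L w k - char L k q * coeff L Φ k := by
  have hi : IntervalIntegrable (fun x => φ (x + q)) volume 0 L :=
    (hφ.comp (continuous_add_const q)).intervalIntegrable _ _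
  rw [coeff_fun_sub w.intervalIntegrable hi, coeff_comp_add hL.out hper,
    coeff_congr hL.out hΦ k]

theorem norm_conj_mul_sub {z a b : ℂ} (hz : ‖z‖ = 1) :
    ‖(starRingEnd ℂ) z * a - b‖ = ‖a - z * b‖ := by
  have h : a - z * b = z * ((starRingEnd ℂ) z * a - b) := by
    have : z * (starRingEnd ℂ) z = 1 := by
      rw [Complex.mul_conj, Complex.normSq_eq_norm_sq, hz]
      simp
    linear_combination -a * this
  rw [h, norm_mul, hz, one_mul]

/-- The distance from the translate `φ(· + q)` is the distance of a translate from `φ`. -/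
theorem sobolevNorm_sub_translate (hφ : Continuous φ) (hper : Function.Periodic φ L)
    (hΦ : ⇑Φ.toL2 =ᵐ[perMeasure L] φ) {w w' : Hper L s} {q : ℝ}
    (hw : ∀ k, coeff L w' k = char L k (-q) * coeff L w k) :
    sobolevNorm L s (fun x => w x - φ (x + q)) = ‖w' - Φ‖ := by
  rw [Hper.norm_eq, sobolevNorm, sobolevNorm]
  congr 2
  refine tsum_congr fun k => ?_
  have h : char L k (-q) = (starRingEnd ℂ) (char L k q) := by
    rw [conj_char, char_eq, char_eq]
    congr 3
    push_cast
    ring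
  rw [coeff_sub_translate hφ hper hΦ, Hper.coeff_sub, hw, h, norm_conj_mul_sub (norm_char L k q)]

theorem orbitDist_le (hφ : Continuous φ) (hper : Function.Periodic φ L)
    (hΦ : ⇑Φ.toL2 =ᵐ[perMeasure L] φ) (w : Hper L s) : orbitDist L s w φ ≤ ‖w - Φ‖ := by
  refine (ciInf_le (bddBelow_sobolevNorm L s w φ) 0).trans (le_of_eq ?_)
  refine sobolevNorm_sub_translate hφ hper hΦ fun k => ?_
  rw [neg_zero, char_eq]
  simp

theorem orbitDist_sub_le (hφ : Continuous φ) (hper : Function.Periodic φ L)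
    (hΦ : ⇑Φ.toL2 =ᵐ[perMeasure L] φ) (w z : Hper L s) :
    orbitDist L s w φ ≤ orbitDist L s z φ + ‖w - z‖ := by
  rw [← sub_le_iff_le_add]
  refine le_ciInf fun q => ?_
  rw [sub_le_iff_le_add]
  refine (ciInf_le (bddBelow_sobolevNorm L s w φ) q).trans ?_
  obtain ⟨w', -, hw'⟩ := Hper.exists_rotation (-q) w
  obtain ⟨z', -, hz'⟩ := Hper.exists_rotation (-q) z
  rw [sobolevNorm_sub_translate hφ hper hΦ hw', sobolevNorm_sub_translate hφ hper hΦ hz']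
  have h : ‖w' - z'‖ = ‖w - z‖ := by
    rw [Hper.norm_eq, Hper.norm_eq, sobolevNorm, sobolevNorm]
    congr 2
    refine tsum_congr fun k => ?_
    rw [Hper.coeff_sub, Hper.coeff_sub, hw', hz', ← mul_sub, norm_mul, norm_char, one_mul]
  rw [← h]
  calc ‖w' - Φ‖ = ‖(z' - Φ) + (w' - z')‖ := by congr 1; abel
    _ ≤ _ := norm_add_le _ _

theorem continuous_orbitDist (hφ : Continuous φ) (hper : Function.Periodic φ L)
    (hΦ : ⇑Φ.toL2 =ᵐ[perMeasure L] φ) : Continuous fun w : Hper L s => orbitDist L s w φ := by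
  have : LipschitzWith 1 fun w : Hper L s => orbitDist L s w φ :=
    LipschitzWith.of_le_add fun w z => by
      rw [dist_eq_norm]
      exact orbitDist_sub_le hφ hper hΦ w z
  exact this.continuous

/-- The distance from the orbit is attained, and there the difference is orthogonal to the
direction of translations. -/
theorem exists_orbitDist_eq (hφ : ContDiff ℝ 1 φ) (hper : Function.Periodic φ L)
    (hΦ : ⇑Φ.toL2 =ᵐ[perMeasure L] φ) (he : ⇑e.toL2 =ᵐ[perMeasure L] deriv φ) (w : Hper L s) :
    ∃ (q : ℝ) (w' : Hper L s), (⇑w'.toL2 =ᵐ[perMeasure L] fun x => w (rotate L q x)) ∧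
      (∀ k, coeff L w' k = char L k q * coeff L w k) ∧
      ‖w' - Φ‖ = orbitDist L s w φ ∧ inner ℝ (w' - Φ) e = 0 := by
  have hLp := hL.out
  -- With these coefficients `synth L c q` is the inner product of w(· − q) with Φ. Translation
  -- preserves norms, so minimizing the distance means maximizing this continuous periodic function
  -- of q.
  set c : ℤ → ℂ := fun k => ((L * (1 + (k : ℝ) ^ 2) ^ s : ℝ) : ℂ) *
    ((starRingEnd ℂ) (coeff L w k) * coeff L Φ k) with hc
  have hek : ∀ k : ℤ, coeff L e k = 2 * Real.pi * Complex.I * k / L * coeff L Φ k := fun k => by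
    rw [coeff_congr hLp he k, coeff_congr hLp hΦ k]
    exact coeff_deriv hLp hper (fun x => (hφ.differentiable one_ne_zero x).hasDerivAt)
      (hφ.continuous_deriv le_rfl) k
  have hnc : ∀ k, ‖c k‖ = L * ((1 + (k : ℝ) ^ 2) ^ s * (‖coeff L w k‖ * ‖coeff L Φ k‖)) := by
    intro k
    have : 0 ≤ L * (1 + (k : ℝ) ^ 2) ^ s := by positivity
    rw [hc]
    simp only
    rw [norm_mul, norm_mul, RCLike.norm_conj, Complex.norm_real, Real.norm_of_nonneg this]
    ring
  have s0 : Summable fun k => ‖c k‖ :=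
    (Hper.summable_mul_norm w Φ).1.congr fun k => (hnc k).symm
  have s1 : Summable fun k : ℤ => |(k : ℝ)| * ‖c k‖ := by
    refine ((Hper.summable_mul_norm w e).1.mul_left (L / (2 * Real.pi))).congr fun k => ?_
    rw [hnc, hek, norm_mul, norm_freq hLp]
    have := Real.pi_pos
    field_simp
  obtain ⟨q₀, -, hq₀⟩ := (isCompact_Icc (a := 0) (b := L)).exists_isMaxOn
    (nonempty_Icc.2 hLp.le) (continuous_synth (L := L) s0).continuousOn
  have hmax : ∀ q, synth L c q ≤ synth L c q₀ := by
    intro q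
    obtain ⟨q', hq', h⟩ := (periodic_synth hLp c).exists_mem_Ico₀ hLp q
    rw [h]
    exact hq₀ (Ico_subset_Icc_self hq')
  have hd := hasDerivAt_synth hLp s0 s1 q₀
  -- Differentiation in q multiplies the coefficients by 2πik/L, turning Φ into e. The critical
  -- point equation is therefore orthogonality of w' to e.
  have hd0 := (IsLocalMax.hasDerivAt_eq_zero (Eventually.of_forall hmax) hd)
  have hin : ∀ (q : ℝ) (w' : Hper L s), (∀ k, coeff L w' k = char L k (-q) * coeff L w k) →
      inner ℝ w' Φ = synth L c q := by
    intro q w' hw'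
    refine (Hper.hasSum_inner w' Φ).unique ((hasSum_synth s0 q).congr_fun fun k => ?_)
    rw [hw', map_mul, conj_char, hc]
    simp only
    rw [mul_assoc (((L * (1 + (k : ℝ) ^ 2) ^ s : ℝ) : ℂ)), Complex.re_ofReal_mul, mul_assoc L]
    congr 3
    have : char L (-k) (-q) = char L k q := by
      rw [char_eq, char_eq]
      congr 3
      push_cast
      ring
    rw [this]
    ring
  have hnorm : ∀ (q : ℝ) (w' : Hper L s), (∀ k, coeff L w' k = char L k (-q) * coeff L w k) →
      ‖w' - Φ‖ ^ 2 = ‖w‖ ^ 2 + ‖Φ‖ ^ 2 - 2 * synth L c q := by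
    intro q w' hw'
    have h : ‖w'‖ = ‖w‖ := by
      rw [Hper.norm_eq, Hper.norm_eq, sobolevNorm, sobolevNorm]
      congr 2
      refine tsum_congr fun k => ?_
      rw [hw', norm_mul, norm_char, one_mul]
    rw [norm_sub_sq_real, hin q w' hw', h]
    ring
  obtain ⟨w', hw1, hw'⟩ := Hper.exists_rotation (-q₀) w
  refine ⟨-q₀, w', hw1, hw', ?_, ?_⟩
  · refine le_antisymm (le_ciInf fun q => ?_) ?_
    · obtain ⟨z, -, hz⟩ := Hper.exists_rotation (-q) w
      rw [sobolevNorm_sub_translate hφ.continuous hper hΦ hz]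
      refine abs_le_of_sq_le_sq' ?_ (norm_nonneg _) |>.2
      rw [hnorm q₀ w' hw', hnorm q z hz]
      linarith [hmax q]
    · refine (ciInf_le (bddBelow_sobolevNorm L s w φ) q₀).trans (le_of_eq ?_)
      exact sobolevNorm_sub_translate hφ.continuous hper hΦ hw'
  · have h1 : inner ℝ w' e = 0 := by
      rw [← hd0]
      have s2 : Summable fun k => ‖2 * Real.pi * Complex.I * k / L * c k‖ := by
        refine (s1.mul_left (2 * Real.pi / L)).congr fun k => ?_
        have : ‖2 * Real.pi * Complex.I * k / L * c k‖ = 2 * Real.pi / L * |(k : ℝ)| * ‖c k‖ := by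
          rw [norm_mul (2 * Real.pi * Complex.I * k / L : ℂ) (c k), norm_freq hLp]
        rw [this, mul_assoc]
      refine (Hper.hasSum_inner w' e).unique ((hasSum_synth s2 q₀).congr_fun fun k => ?_)
      rw [hw', hek, map_mul, conj_char, hc]
      simp only
      have : char L (-k) (-q₀) = char L k q₀ := by
        rw [char_eq, char_eq]
        congr 3
        push_cast
        ring
      rw [this, ← mul_assoc L, ← Complex.re_ofReal_mul]
      congr 1
      ring
    -- Each mode of this pairing is purely imaginary, the norm of Φ being invariant under
    -- translation.
    have h2 : inner ℝ Φ e = 0 := by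
      refine (Hper.hasSum_inner Φ e).unique (hasSum_zero.congr_fun fun k => ?_)
      rw [hek]
      have : (starRingEnd ℂ) (coeff L Φ k) * (2 * Real.pi * Complex.I * k / L * coeff L Φ k)
          = ((2 * Real.pi * k / L * Complex.normSq (coeff L Φ k) : ℝ) : ℂ) * Complex.I := by
        push_cast
        rw [Complex.normSq_eq_conj_mul_self]
        ring
      rw [this]
      simp
    rw [inner_sub_left, h1, h2, sub_zero]

end orbit

/-! ### The Lyapunov functional -/

/-- The energy augmented by multiples of momentum and mass. -/
def augmentedEnergy (L : ℝ) (f θ : ℝ → ℝ) (ω A : ℝ) (u : ℝ → ℝ) : ℝ :=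
  energy L f θ u + ω / 2 * (∫ x in (0 : ℝ)..L, u x ^ 2) + A * ∫ x in (0 : ℝ)..L, u x

/-- A combination of mass and momentum. -/
def charge (L a b : ℝ) (u : ℝ → ℝ) : ℝ :=
  a * (∫ x in (0 : ℝ)..L, u x) + b / 2 * ∫ x in (0 : ℝ)..L, u x ^ 2

/-- The Lyapunov functional of the wave `φ`. -/
def lyapunov (L : ℝ) (f θ : ℝ → ℝ) (ω A a b K : ℝ) (φ u : ℝ → ℝ) : ℝ :=
  augmentedEnergy L f θ ω A u - augmentedEnergy L f θ ω A φ
    + K / 2 * (charge L a b u - charge L a b φ) ^ 2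

section lyapunov

variable {L m : ℝ} [hL : Fact (0 < L)] {f θ φ : ℝ → ℝ} {ω A a b K : ℝ}

theorem mulForm_congr {u u' v v' : ℝ → ℝ} (hu : u =ᵐ[perMeasure L] u')
    (hv : v =ᵐ[perMeasure L] v') : mulForm L θ u v = mulForm L θ u' v' := by
  unfold mulForm
  simp only [coeff_congr hL.out hu, coeff_congr hL.out hv]

theorem integral_sq_add {r : ℝ} {u v : Hper L r} :
    ∫ x in (0 : ℝ)..L, (u + v).toL2 x ^ 2 = (∫ x in (0 : ℝ)..L, u x ^ 2)
      + 2 * (∫ x in (0 : ℝ)..L, u x * v x) + ∫ x in (0 : ℝ)..L, v x ^ 2 := by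
  have i1 := intervalIntegrable_sq_of_memLp hL.out u.memLp
  have i2 := (intervalIntegrable_mul_of_memLp hL.out u.memLp v.memLp).const_mul 2
  have i3 := intervalIntegrable_sq_of_memLp hL.out v.memLp
  rw [← intervalIntegral.integral_const_mul (2 : ℝ), ← intervalIntegral.integral_add i1 i2,
    ← intervalIntegral.integral_add (i1.add i2) i3]
  refine integral_congr_per ?_
  filter_upwards [Hper.coe_add u v] with x hx
  rw [hx]
  ring

theorem integral_add_toL2 {r : ℝ} {u v : Hper L r} :
    ∫ x in (0 : ℝ)..L, (u + v).toL2 x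
      = (∫ x in (0 : ℝ)..L, u x) + ∫ x in (0 : ℝ)..L, v x := by
  rw [← intervalIntegral.integral_add u.intervalIntegrable v.intervalIntegrable]
  exact integral_congr_per (Hper.coe_add u v)

theorem augmentedEnergy_charge_congr {u φ' : ℝ → ℝ} (hu : u =ᵐ[perMeasure L] φ') :
    augmentedEnergy L f θ ω A u = augmentedEnergy L f θ ω A φ' ∧
      charge L a b u = charge L a b φ' := by
  have h1 : ∫ x in (0 : ℝ)..L, u x ^ 2 = ∫ x in (0 : ℝ)..L, φ' x ^ 2 := by
    refine integral_congr_per ?_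
    filter_upwards [hu] with x hx
    rw [hx]
  have h2 : ∫ x in (0 : ℝ)..L, u x = ∫ x in (0 : ℝ)..L, φ' x := integral_congr_per hu
  have h3 : potential L f u = potential L f φ' := by
    refine integral_congr_per ?_
    filter_upwards [hu] with x hx
    rw [hx]
  rw [augmentedEnergy, augmentedEnergy, charge, charge, energy, energy, h1, h2, h3,
    mulForm_congr hu hu]
  exact ⟨rfl, rfl⟩

/-- Second order expansion of the augmented energy at a wave. -/
theorem augmentedEnergy_add (hθ : IsSymbol θ m) (hf : ContDiff ℝ (⊤ : ℕ∞) f)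
    (hφ : IsPeriodicWave L f θ ω A φ) {Φ : Hper L (m / 2)} (hΦ : ⇑Φ.toL2 =ᵐ[perMeasure L] φ)
    (v : Hper L (m / 2)) :
    augmentedEnergy L f θ ω A (Φ + v).toL2 - augmentedEnergy L f θ ω A φ
      = 1 / 2 * opForm L θ (fun x => ω - deriv f (φ x)) v v
        - potentialRem L f φ v (Φ + v).toL2 := by
  have hLp := hL.out
  have cφ := hφ.smooth.continuous
  have cf' : Continuous (deriv f) := hf.continuous_deriv (by exact_mod_cast le_top)
  have e1 : mulForm L θ (Φ + v).toL2 (Φ + v).toL2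
      = mulForm L θ φ φ + 2 * mulForm L θ φ v + mulForm L θ v v := by
    rw [mulForm_add_left hθ, mulForm_symm L θ Φ, mulForm_symm L θ v, mulForm_add_left hθ,
      mulForm_add_left hθ, mulForm_symm L θ v Φ, mulForm_congr hΦ hΦ,
      mulForm_congr hΦ (Filter.EventuallyEq.refl _ _)]
    ring
  -- The wave equation paired with v; it cancels all first order terms of the expansion.
  have e2 : mulForm L θ φ v = (∫ x in (0 : ℝ)..L, f (φ x) * v x)
      - ω * (∫ x in (0 : ℝ)..L, φ x * v x) - A * ∫ x in (0 : ℝ)..L, v x := by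
    have h := (parseval_inner hLp hφ.equation.1 v.memLp).tsum_eq
    have i1 : IntervalIntegrable (fun x => f (φ x) * v x) volume 0 L :=
      intervalIntegrable_mul_of_memLp hLp
        (memLp_of_continuous (L := L) (hf.continuous.comp cφ)) v.memLp
    have i2 := intervalIntegrable_mul_of_memLp hLp (memLp_of_continuous (L := L) cφ) v.memLp
    have i3 : ∫ x in (0 : ℝ)..L, (f (φ x) - ω * φ x - A) * v x
        = (∫ x in (0 : ℝ)..L, f (φ x) * v x) - ω * (∫ x in (0 : ℝ)..L, φ x * v x)
          - A * ∫ x in (0 : ℝ)..L, v x := by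
      rw [← intervalIntegral.integral_const_mul (ω), ← intervalIntegral.integral_const_mul (A),
        ← intervalIntegral.integral_sub i1 (i2.const_mul ω),
        ← intervalIntegral.integral_sub (i1.sub (i2.const_mul ω)) (v.intervalIntegrable.const_mul A)]
      refine intervalIntegral.integral_congr fun x _ => ?_
      ring
    rw [← i3, ← h, mulForm]
    refine tsum_congr fun k => ?_
    rw [hφ.equation.2 k, map_mul, Complex.conj_ofReal, mul_assoc, Complex.re_ofReal_mul]
  have e3 : ∫ x in (0 : ℝ)..L, (ω - deriv f (φ x)) * v x * v x
      = ω * (∫ x in (0 : ℝ)..L, v x ^ 2) - ∫ x in (0 : ℝ)..L, deriv f (φ x) * v x * v x := by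
    have i1 := intervalIntegrable_sq_of_memLp hLp v.memLp
    have i2 : IntervalIntegrable (fun x => deriv f (φ x) * v x * v x) volume 0 L :=
      intervalIntegrable_potential (cf'.comp cφ) v v
    rw [← intervalIntegral.integral_const_mul (ω),
      ← intervalIntegral.integral_sub (i1.const_mul ω) i2]
    refine intervalIntegral.integral_congr fun x _ => ?_
    ring
  have e4 : ∫ x in (0 : ℝ)..L, Φ x ^ 2 = ∫ x in (0 : ℝ)..L, φ x ^ 2 := by
    refine integral_congr_per ?_
    filter_upwards [hΦ] with x hx
    rw [hx]
  have e5 : ∫ x in (0 : ℝ)..L, Φ x * v x = ∫ x in (0 : ℝ)..L, φ x * v x := by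
    refine integral_congr_per ?_
    filter_upwards [hΦ] with x hx
    rw [hx]
  have e6 : ∫ x in (0 : ℝ)..L, Φ x = ∫ x in (0 : ℝ)..L, φ x := integral_congr_per hΦ
  rw [augmentedEnergy, augmentedEnergy, energy, energy, e1, e2, integral_sq_add, integral_add_toL2,
    opForm, e3, e4, e5, e6, potentialRem]
  ring

theorem charge_add {Φ : Hper L (m / 2)} (hcφ : Continuous φ) (hΦ : ⇑Φ.toL2 =ᵐ[perMeasure L] φ)
    (v : Hper L (m / 2)) :
    charge L a b (Φ + v).toL2 - charge L a b φ
      = (∫ x in (0 : ℝ)..L, (a + b * φ x) * v x) + b / 2 * ∫ x in (0 : ℝ)..L, v x ^ 2 := by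
  have hLp := hL.out
  have e3 : ∫ x in (0 : ℝ)..L, (a + b * φ x) * v x
      = a * (∫ x in (0 : ℝ)..L, v x) + b * ∫ x in (0 : ℝ)..L, φ x * v x := by
    have i2 := intervalIntegrable_mul_of_memLp hLp (memLp_of_continuous (L := L) hcφ) v.memLp
    rw [← intervalIntegral.integral_const_mul (a), ← intervalIntegral.integral_const_mul (b),
      ← intervalIntegral.integral_add (v.intervalIntegrable.const_mul a) (i2.const_mul b)]
    refine intervalIntegral.integral_congr fun x _ => ?_
    ring
  have e4 : ∫ x in (0 : ℝ)..L, Φ x ^ 2 = ∫ x in (0 : ℝ)..L, φ x ^ 2 := by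
    refine integral_congr_per ?_
    filter_upwards [hΦ] with x hx
    rw [hx]
  have e5 : ∫ x in (0 : ℝ)..L, Φ x * v x = ∫ x in (0 : ℝ)..L, φ x * v x := by
    refine integral_congr_per ?_
    filter_upwards [hΦ] with x hx
    rw [hx]
  have e6 : ∫ x in (0 : ℝ)..L, Φ x = ∫ x in (0 : ℝ)..L, φ x := integral_congr_per hΦ
  rw [charge, charge, integral_sq_add, integral_add_toL2, e3, e4, e5, e6]
  ring

/-- The Lyapunov functional controls the distance from `φ` in the directions orthogonal to the
orbit. -/
theorem exists_le_lyapunov (hθ : IsSymbol θ m) (hf : ContDiff ℝ (⊤ : ℕ∞) f)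
    (hE : m ≤ 1 → PotentialEnergyC2 L f (m / 2)) (hφ : IsPeriodicWave L f θ ω A φ)
    {Φ e : Hper L (m / 2)} (hΦ : ⇑Φ.toL2 =ᵐ[perMeasure L] φ) {c : ℝ} (hK : 0 < K) (hc : 0 < c)
    (hcoer : ∀ v : Hper L (m / 2), inner ℝ v e = 0 → c * ‖v‖ ^ 2 ≤
      opForm L θ (fun x => ω - deriv f (φ x)) v v
        + K * (∫ x in (0 : ℝ)..L, (a + b * φ x) * v x) ^ 2) :
    ∃ δ > 0, ∀ v : Hper L (m / 2), inner ℝ v e = 0 → ‖v‖ < δ →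
      c / 4 * ‖v‖ ^ 2 ≤ lyapunov L f θ ω A a b K φ (Φ + v).toL2 := by
  have hLp := hL.out
  have hm : 0 ≤ m / 2 := by linarith [hθ.pos]
  have cφ := hφ.smooth.continuous
  have hy : MemLp (fun x => a + b * φ x) 2 (perMeasure L) :=
    memLp_of_continuous (continuous_const.add (continuous_const.mul cφ))
  obtain ⟨δ, hδ, hrem⟩ := exists_taylor_potential ⟨θ, hθ⟩ hf hE cφ Φ hΦ (ε := c / 8)
    (by positivity)
  set Y := Real.sqrt (∫ x in (0 : ℝ)..L, (a + b * φ x) ^ 2) with hY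
  have hY0 : 0 ≤ ∫ x in (0 : ℝ)..L, (a + b * φ x) ^ 2 :=
    intervalIntegral.integral_nonneg hLp.le fun x _ => sq_nonneg _
  have hYn : 0 ≤ Y := Real.sqrt_nonneg _
  -- Coercivity gives (c/2)‖v‖². The Taylor remainder takes c/8 of it, and the cross term (K/2)bIJ
  -- another c/8, because this choice ensures K|b|Y‖v‖ ≤ c/4; what remains is c/4.
  refine ⟨min δ (c / (4 * (K * |b| * Y + 1))), lt_min hδ (by positivity), fun v hv hvδ => ?_⟩
  have h1 := hcoer v hv
  have h2 := hrem v (hvδ.trans_le (min_le_left _ _))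
  have h3 : ‖v‖ * (4 * (K * |b| * Y + 1)) < c := by
    rw [← lt_div_iff₀ (by positivity)]
    exact hvδ.trans_le (min_le_right _ _)
  rw [lyapunov, augmentedEnergy_add hθ hf hφ hΦ, charge_add cφ hΦ]
  set I := ∫ x in (0 : ℝ)..L, (a + b * φ x) * v x with hI
  set J := ∫ x in (0 : ℝ)..L, v x ^ 2 with hJ
  have hJ0 : 0 ≤ J := intervalIntegral.integral_nonneg hLp.le fun x _ => sq_nonneg _
  have hJ1 : J ≤ ‖v‖ ^ 2 := v.integral_sq_le hm
  have hI1 : |I| ≤ Y * ‖v‖ := by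
    refine abs_le_of_sq_le_sq ?_ (by positivity)
    rw [mul_pow, hY, Real.sq_sqrt hY0]
    exact (sq_integral_mul_le hLp hy v.memLp).trans (by gcongr)
  have h4 : |b * I * J| ≤ |b| * (Y * ‖v‖) * ‖v‖ ^ 2 := by
    rw [abs_mul, abs_mul, abs_of_nonneg hJ0]
    gcongr
  have h5 := (abs_le.1 h4).1
  have h6 := (abs_le.1 h2).2
  have h7 : K * (|b| * (Y * ‖v‖) * ‖v‖ ^ 2) ≤ c / 4 * ‖v‖ ^ 2 := by
    have h8 : K * |b| * Y * ‖v‖ ≤ c / 4 := by nlinarith [norm_nonneg v]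
    calc K * (|b| * (Y * ‖v‖) * ‖v‖ ^ 2) = K * |b| * Y * ‖v‖ * ‖v‖ ^ 2 := by ring
      _ ≤ _ := by gcongr
  have h9 : I ^ 2 + b * I * J ≤ (I + b / 2 * J) ^ 2 := by nlinarith [sq_nonneg (b / 2 * J)]
  have h10 := mul_le_mul_of_nonneg_left h9 (show 0 ≤ K / 2 by positivity)
  have h11 := mul_le_mul_of_nonneg_left h5 hK.le
  nlinarith

theorem lyapunov_rotate (hf : Continuous f) {w w' : Hper L (m / 2)} {q : ℝ}
    (h1 : ⇑w'.toL2 =ᵐ[perMeasure L] fun x => w (rotate L q x))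
    (h2 : ∀ k, coeff L w' k = char L k q * coeff L w k) :
    lyapunov L f θ ω A a b K φ w' = lyapunov L f θ ω A a b K φ w := by
  have hw := w.aestronglyMeasurable
  have e1 : ∫ x in (0 : ℝ)..L, w' x = ∫ x in (0 : ℝ)..L, w x :=
    (integral_congr_per h1).trans (integral_comp_rotate q hw)
  have e2 : ∫ x in (0 : ℝ)..L, w' x ^ 2 = ∫ x in (0 : ℝ)..L, w x ^ 2 := by
    refine Eq.trans (integral_congr_per ?_) (integral_comp_rotate (F := fun x => w x ^ 2) q (hw.pow 2))
    filter_upwards [h1] with x hx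
    rw [hx]
  have e3 : potential L f w' = potential L f w := by
    refine Eq.trans (integral_congr_per ?_) (integral_comp_rotate (F := fun x => primitive f (w x)) q
      ((continuous_primitive hf).comp_aestronglyMeasurable hw))
    filter_upwards [h1] with x hx
    rw [hx]
  have e4 : mulForm L θ w' w' = mulForm L θ w w := by
    refine tsum_congr fun k => ?_
    rw [h2, map_mul]
    have : (starRingEnd ℂ) (char L k q) * char L k q = 1 := by
      rw [mul_comm, Complex.mul_conj, Complex.normSq_eq_norm_sq, norm_char]
      simp
    congr 3
    linear_combination ((starRingEnd ℂ) (coeff L w k) * coeff L w k) * this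
  simp only [lyapunov, augmentedEnergy, charge, energy, e1, e2, e3, e4]

theorem continuous_lyapunov (hθ : IsSymbol θ m) (hf : ContDiff ℝ (⊤ : ℕ∞) f)
    (hE : m ≤ 1 → PotentialEnergyC2 L f (m / 2)) :
    Continuous fun w : Hper L (m / 2) => lyapunov L f θ ω A a b K φ w := by
  have hm : 0 ≤ m / 2 := by linarith [hθ.pos]
  have c1 := continuous_energy (L := L) hθ hf hE
  have c2 := continuous_integral_sq (L := L) hm
  have c3 : Continuous fun w : Hper L (m / 2) => ∫ x in (0 : ℝ)..L, w x := by
    have := continuous_integral_mul (L := L) hm (g := fun _ => 1)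
      (memLp_of_continuous continuous_const)
    simpa only [one_mul] using this
  unfold lyapunov augmentedEnergy charge
  fun_prop

/-- A wave at which the second variation is coercive, up to the orbit and up to the square of a
conserved quantity, is orbitally stable. -/
theorem orbitallyStable_of_coercive {s : ℝ} (hθ : IsSymbol θ m) (hf : ContDiff ℝ (⊤ : ℕ∞) f)
    (hE : m ≤ 1 → PotentialEnergyC2 L f (m / 2)) (hs : m / 2 ≤ s)
    (hwp : IsGloballyWellPosed L f θ s) (hφ : IsPeriodicWave L f θ ω A φ)
    {Φ e : Hper L (m / 2)} (hΦ : ⇑Φ.toL2 =ᵐ[perMeasure L] φ)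
    (he : ⇑e.toL2 =ᵐ[perMeasure L] deriv φ) {c : ℝ} (hK : 0 < K) (hc : 0 < c)
    (hcoer : ∀ v : Hper L (m / 2), inner ℝ v e = 0 → c * ‖v‖ ^ 2 ≤
      opForm L θ (fun x => ω - deriv f (φ x)) v v
        + K * (∫ x in (0 : ℝ)..L, (a + b * φ x) * v x) ^ 2) :
    OrbitallyStable L f θ m s φ := by
  intro ε hε
  have cφ := hφ.smooth.continuous
  obtain ⟨δ₀, hδ₀, hlow⟩ := exists_le_lyapunov hθ hf hE hφ hΦ hK hc hcoer
  -- The barrier level lies strictly below both ε and the radius δ₀ in which the lower bound holds.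
  set η := min ε δ₀ / 2 with hη
  have hmin : 0 < min ε δ₀ := lt_min hε hδ₀
  have hη0 : 0 < η := half_pos hmin
  have hηε : η < ε := (half_lt_self hmin).trans_le (min_le_left _ _)
  have hηδ : η < δ₀ := (half_lt_self hmin).trans_le (min_le_right _ _)
  have hlyap : ∀ w : Hper L (m / 2), orbitDist L (m / 2) w φ < δ₀ →
      c / 4 * orbitDist L (m / 2) w φ ^ 2 ≤ lyapunov L f θ ω A a b K φ w := by
    intro w hw
    obtain ⟨q, w', h1, h2, h3, h4⟩ := exists_orbitDist_eq (hφ.smooth.of_le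
      (by exact_mod_cast le_top)) hφ.periodic hΦ he w
    have := hlow (w' - Φ) h4 (by rwa [h3])
    rwa [h3, add_sub_cancel, lyapunov_rotate hf.continuous h1 h2] at this
  have hΨ0 : lyapunov L f θ ω A a b K φ Φ = 0 := by
    obtain ⟨h1, h2⟩ := augmentedEnergy_charge_congr (f := f) (θ := θ) (ω := ω) (A := A) (a := a) (b := b) hΦ
    rw [lyapunov, h1, h2]
    ring
  have hcont := (continuous_lyapunov (L := L) (ω := ω) (A := A) (a := a) (b := b) (K := K) (φ := φ)
    hθ hf hE).tendsto Φ
  rw [hΨ0] at hcont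
  obtain ⟨δ, hδ, hsmall⟩ := Metric.eventually_nhds_iff.1
    (hcont.eventually (gt_mem_nhds (show 0 < c / 4 * η ^ 2 by positivity)))
  refine ⟨min δ η, lt_min hδ hη0, fun u₀ hu₀ => ⟨hwp.exists_solution u₀, fun u hu t ht => ?_⟩⟩
  set w : ℝ → Hper L (m / 2) := fun τ => Hper.incl (L := L) hs (u τ) with hw
  have hwu : ∀ τ, (w τ).toL2 = (u τ).toL2 := fun τ => Hper.toL2_incl hs (u τ)
  have hw0 : ‖w 0 - Φ‖ < min δ η := by
    refine lt_of_eq_of_lt ?_ hu₀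
    rw [Hper.norm_eq, sobolevNorm, sobolevNorm]
    congr 2
    refine tsum_congr fun k => ?_
    have h := coeff_sub_translate cφ hφ.periodic hΦ (w 0) 0 k
    have h1 : char L k 0 = 1 := by rw [char_eq]; simp
    simp only [add_zero, h1, one_mul] at h
    rw [Hper.coeff_sub, ← h, hwu, hu.init]
  have hconst : ∀ τ, 0 ≤ τ → lyapunov L f θ ω A a b K φ (w τ)
      = lyapunov L f θ ω A a b K φ (w 0) := by
    intro τ hτ
    obtain ⟨h1, h2, h3⟩ := hu.conservation hθ hf hE hs hwp hτ
    simp only [hwu, hu.init, lyapunov, augmentedEnergy, charge, h1, h2, h3]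
  have hΨlt : lyapunov L f θ ω A a b K φ (w 0) < c / 4 * η ^ 2 := by
    refine hsmall ?_
    rw [dist_eq_norm]
    exact hw0.trans_le (min_le_left _ _)
  by_contra hcon
  rw [not_lt, ← hwu] at hcon
  have hD : ContinuousOn (fun τ => orbitDist L (m / 2) (w τ) φ) (Icc 0 t) :=
    (continuous_orbitDist cφ hφ.periodic hΦ).comp_continuousOn
      ((Hper.incl (L := L) hs).continuous.comp_continuousOn
        (hu.cont.mono Icc_subset_Ici_self))
  have hstart : orbitDist L (m / 2) (w 0) φ ≤ η :=
    (orbitDist_le cφ hφ.periodic hΦ (w 0)).trans (hw0.le.trans (min_le_right _ _))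
  -- A distance starting at most η and reaching ε equals η at some time. There the functional is at
  -- least (c/4)η², although it is conserved and started below that value.
  obtain ⟨τ, hτ, hτη⟩ := intermediate_value_Icc ht hD ⟨hstart, hηε.le.trans hcon⟩
  simp only at hτη
  have := hlyap (w τ) (by rw [hτη]; exact hηδ)
  rw [hτη, hconst τ hτ.1] at this
  linarith

end lyapunov

/-! ### Families of waves -/

section partialDeriv

variable {ψ : ℝ → ℝ → ℝ} {I : Set ℝ}

theorem hasDerivAt_left (hI : IsOpen I)
    (hψ : ContDiffOn ℝ 1 (fun p : ℝ × ℝ => ψ p.1 p.2) (I ×ˢ univ)) {t : ℝ} (ht : t ∈ I) (x : ℝ) :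
    HasDerivAt (fun τ => ψ τ x) (fderiv ℝ (fun p : ℝ × ℝ => ψ p.1 p.2) (t, x) (1, 0)) t := by
  have h1 : (t, x) ∈ I ×ˢ (univ : Set ℝ) := ⟨ht, mem_univ _⟩
  have h2 := (hψ.contDiffAt ((hI.prod isOpen_univ).mem_nhds h1)).differentiableAt one_ne_zero
  exact h2.hasFDerivAt.comp_hasDerivAt t ((hasDerivAt_id t).prodMk (hasDerivAt_const t x))

theorem continuousOn_deriv_left (hI : IsOpen I)
    (hψ : ContDiffOn ℝ 1 (fun p : ℝ × ℝ => ψ p.1 p.2) (I ×ˢ univ)) :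
    ContinuousOn (fun p : ℝ × ℝ => fderiv ℝ (fun p : ℝ × ℝ => ψ p.1 p.2) p (1, 0))
      (I ×ˢ univ) :=
  (hψ.continuousOn_fderiv_of_isOpen (hI.prod isOpen_univ) le_rfl).clm_apply continuousOn_const

theorem continuous_deriv_left (hI : IsOpen I)
    (hψ : ContDiffOn ℝ 1 (fun p : ℝ × ℝ => ψ p.1 p.2) (I ×ˢ univ)) {t : ℝ} (ht : t ∈ I) :
    Continuous fun x => deriv (fun τ => ψ τ x) t := by
  have h : (fun x => deriv (fun τ => ψ τ x) t)
      = fun x => fderiv ℝ (fun p : ℝ × ℝ => ψ p.1 p.2) (t, x) (1, 0) :=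
    funext fun x => (hasDerivAt_left hI hψ ht x).deriv
  rw [h, ← continuousOn_univ]
  exact (continuousOn_deriv_left hI hψ).comp (by fun_prop) fun x _ => ⟨ht, mem_univ _⟩

theorem continuous_right (hψ : ContDiffOn ℝ 1 (fun p : ℝ × ℝ => ψ p.1 p.2) (I ×ˢ univ)) {t : ℝ}
    (ht : t ∈ I) : Continuous (ψ t) := by
  rw [← continuousOn_univ]
  exact hψ.continuousOn.comp (f := fun x : ℝ => (t, x)) (by fun_prop) fun x _ => ⟨ht, mem_univ _⟩

/-- Fourier coefficients may be differentiated with respect to a parameter. -/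
theorem hasDerivAt_coeff {L : ℝ} (hL : 0 < L) (hI : IsOpen I)
    (hψ : ContDiffOn ℝ 1 (fun p : ℝ × ℝ => ψ p.1 p.2) (I ×ˢ univ)) {t : ℝ} (ht : t ∈ I) (k : ℤ) :
    HasDerivAt (fun τ => coeff L (ψ τ) k) (coeff L (fun x => deriv (fun τ => ψ τ x) t) k) t := by
  simp only [coeff_eq]
  refine HasDerivAt.const_mul _ ?_
  set D : ℝ × ℝ → ℝ := fun p => fderiv ℝ (fun p : ℝ × ℝ => ψ p.1 p.2) p (1, 0) with hD
  have hDc : ContinuousOn D (I ×ˢ univ) := continuousOn_deriv_left hI hψ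
  have e : (fun x => ((deriv (fun τ => ψ τ x) t : ℝ) : ℂ) * char L (-k) x)
      = fun x => (D (t, x) : ℂ) * char L (-k) x :=
    funext fun x => by rw [(hasDerivAt_left hI hψ ht x).deriv]
  rw [e]
  obtain ⟨ε, hε, hball⟩ := Metric.nhds_basis_closedBall.mem_iff.1 (hI.mem_nhds ht)
  obtain ⟨C, hC⟩ := ((isCompact_closedBall t ε).prod (isCompact_Icc (a := 0) (b := L))
    ).exists_bound_of_continuousOn (hDc.mono fun p hp => ⟨hball hp.1, mem_univ _⟩)
  have hcc : ∀ τ ∈ I, Continuous fun x => (ψ τ x : ℂ) * char L (-k) x := fun τ hτ =>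
    (Complex.continuous_ofReal.comp (continuous_right hψ hτ)).mul (continuous_char L (-k))
  have hDt : Continuous fun x => (D (t, x) : ℂ) * char L (-k) x := by
    refine (Complex.continuous_ofReal.comp ?_).mul (continuous_char L (-k))
    rw [← continuousOn_univ]
    exact hDc.comp (by fun_prop) fun x _ => ⟨ht, mem_univ _⟩
  refine (intervalIntegral.hasDerivAt_integral_of_dominated_loc_of_deriv_le
    (F := fun τ x => (ψ τ x : ℂ) * char L (-k) x)
    (F' := fun τ x => (D (τ, x) : ℂ) * char L (-k) x) (bound := fun _ => C)
    (Metric.closedBall_mem_nhds t hε) ?_ ((hcc t ht).intervalIntegrable _ _)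
    hDt.aestronglyMeasurable ?_ intervalIntegrable_const ?_).2
  · filter_upwards [hI.mem_nhds ht] with τ hτ using (hcc τ hτ).aestronglyMeasurable
  · refine Eventually.of_forall fun x hx τ hτ => ?_
    rw [norm_mul, norm_char, mul_one, Complex.norm_real]
    rw [uIoc_of_le hL.le] at hx
    exact hC (τ, x) ⟨hτ, hx.1.le, hx.2⟩
  · refine Eventually.of_forall fun x _ τ hτ => ?_
    exact ((hasDerivAt_left hI hψ (hball hτ) x).ofReal_comp).mul_const _

/-- The equation of the linearization of a family of waves. -/
theorem isLin_deriv {L : ℝ} (hL : 0 < L) {f θ w α : ℝ → ℝ} {w' α' t : ℝ} (hI : IsOpen I)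
    (hψ : ContDiffOn ℝ 1 (fun p : ℝ × ℝ => ψ p.1 p.2) (I ×ˢ univ))
    (hf : ContDiff ℝ (⊤ : ℕ∞) f) (hw : ContDiff ℝ 1 w) (hα : ContDiff ℝ 1 α)
    (hwave : ∀ τ ∈ I, IsPeriodicWave L f θ (w τ) (α τ) (ψ τ)) (ht : t ∈ I)
    (hw' : HasDerivAt w w' t) (hα' : HasDerivAt α α' t) :
    IsLin L f θ (w t) (ψ t) (fun x => deriv (fun τ => ψ τ x) t)
      (fun x => -(w' * ψ t x + α')) := by
  have cη := continuous_deriv_left hI hψ ht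
  have cψ := continuous_right hψ ht
  have cf' : Continuous (deriv f) := hf.continuous_deriv (by exact_mod_cast le_top)
  refine ⟨memLp_of_continuous (((continuous_const.mul cψ).add continuous_const).neg.sub
    (continuous_const.mul cη) |>.add ((cf'.comp cψ).mul cη)), fun k => ?_⟩
  have hG : ContDiffOn ℝ 1 (fun p : ℝ × ℝ => f (ψ p.1 p.2) - w p.1 * ψ p.1 p.2 - α p.1)
      (I ×ˢ univ) :=
    (((hf.of_le (by exact_mod_cast le_top)).comp_contDiffOn hψ).sub
      ((hw.comp contDiff_fst).contDiffOn.mul hψ)).sub (hα.comp contDiff_fst).contDiffOn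
  have h1 := hasDerivAt_coeff (ψ := fun τ x => f (ψ τ x) - w τ * ψ τ x - α τ) hL hI hG ht k
  have h2 := (hasDerivAt_coeff hL hI hψ ht k).const_mul (θ k : ℂ)
  -- The wave equation holds in each mode for all parameters near t, so the two sides have the same
  -- derivative there.
  have h3 : (fun τ => coeff L (fun x => f (ψ τ x) - w τ * ψ τ x - α τ) k)
      =ᶠ[𝓝 t] fun τ => (θ k : ℂ) * coeff L (ψ τ) k := by
    filter_upwards [hI.mem_nhds ht] with τ hτ using (hwave τ hτ).equation.2 k
  refine Eq.trans ?_ (h1.unique (h2.congr_of_eventuallyEq h3))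
  congr 1
  funext x
  have hx : HasDerivAt (fun τ => ψ τ x) (deriv (fun τ => ψ τ x) t) t :=
    (hasDerivAt_left hI hψ ht x).differentiableAt.hasDerivAt
  have hfx := ((hf.differentiable (by simp)) (ψ t x)).hasDerivAt.comp t hx
  have h4 := (hfx.sub (hw'.mul hx)).sub hα'
  refine (Eq.trans ?_ h4.deriv.symm)
  ring

end partialDeriv

theorem integral_eq_zero_of_hasDerivAt_periodic {L : ℝ} {g g' : ℝ → ℝ} (hper : Function.Periodic g L)
    (hg : ∀ x, HasDerivAt g (g' x) x) (hg' : Continuous g') : ∫ x in (0 : ℝ)..L, g' x = 0 := by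
  rw [intervalIntegral.integral_eq_sub_of_hasDerivAt (fun x _ => hg x)
    (hg'.intervalIntegrable _ _)]
  have := hper 0
  rw [zero_add] at this
  rw [this, sub_self]

theorem IsPeriodicWave.periodic_deriv {L ω A : ℝ} {f θ φ : ℝ → ℝ} (hφ : IsPeriodicWave L f θ ω A φ) :
    Function.Periodic (deriv φ) L := fun x => by
  have h : (fun y => φ (y + L)) = φ := funext fun y => hφ.periodic y
  rw [← deriv_comp_add_const, h]

/-! ### The inverse of 𝓛 on the orthogonal complement of φ' -/

section inverse

variable {L m : ℝ} [hL : Fact (0 < L)] {f θ φ : ℝ → ℝ} {ω : ℝ}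

theorem IsMul.combine {u v g h : ℝ → ℝ} (hu : MemLp u 2 (perMeasure L))
    (hv : MemLp v 2 (perMeasure L)) (hug : IsMul L θ u g) (hvh : IsMul L θ v h) (c d : ℝ) :
    IsMul L θ (fun x => c * u x + d * v x) (fun x => c * g x + d * h x) := by
  have hLp := hL.out
  refine ⟨(hug.1.const_mul c).add (hvh.1.const_mul d), fun k => ?_⟩
  rw [coeff_fun_add ((MemLp.intervalIntegrable_per hLp hug.1).const_mul c)
      ((MemLp.intervalIntegrable_per hLp hvh.1).const_mul d),
    coeff_fun_add ((MemLp.intervalIntegrable_per hLp hu).const_mul c)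
      ((MemLp.intervalIntegrable_per hLp hv).const_mul d),
    coeff_fun_mul, coeff_fun_mul, coeff_fun_mul, coeff_fun_mul, hug.2, hvh.2]
  ring

theorem IsLin.combine {u v g h : ℝ → ℝ} (hu : MemLp u 2 (perMeasure L))
    (hv : MemLp v 2 (perMeasure L)) (hug : IsLin L f θ ω φ u g) (hvh : IsLin L f θ ω φ v h)
    (c d : ℝ) :
    IsLin L f θ ω φ (fun x => c * u x + d * v x) (fun x => c * g x + d * h x) := by
  refine (IsMul.combine hu hv hug hvh c d).congr EventuallyEq.rfl (Eventually.of_forall fun x => ?_)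
  simp only
  ring

theorem SpectralCondition.integral_deriv_sq_pos {A : ℝ} (hspec : SpectralCondition L f θ m ω φ)
    (hφ : IsPeriodicWave L f θ ω A φ) : 0 < ∫ x in (0 : ℝ)..L, deriv φ x ^ 2 := by
  have hc : Continuous (deriv φ) := hφ.smooth.continuous_deriv (by exact_mod_cast le_top)
  obtain ⟨x₀, hx₀⟩ := hspec.zero_ne
  obtain ⟨x₁, hx₁, hx₁'⟩ := hφ.periodic_deriv.exists_mem_Ico₀ hL.out x₀
  rw [hx₁'] at hx₀
  exact intervalIntegral.integral_pos hL.out (hc.pow 2).continuousOn (fun x _ => sq_nonneg _)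
    ⟨x₁, Ico_subset_Icc_self hx₁, by positivity⟩

/-- A solution of `𝓛 η = -y` yields the solution of `𝓛 g = y` orthogonal to the kernel. -/
theorem exists_isLinInv {A : ℝ} (hθ : IsSymbol θ m) (hφ : IsPeriodicWave L f θ ω A φ)
    (hspec : SpectralCondition L f θ m ω φ) {η y : ℝ → ℝ} (hη : MemLp η 2 (perMeasure L))
    (hηy : IsLin L f θ ω φ η fun x => -y x) :
    ∃ g : Hper L m, IsLinInv L f θ m ω φ y g ∧ ∀ z : ℝ → ℝ, MemLp z 2 (perMeasure L) →
      (∫ x in (0 : ℝ)..L, deriv φ x * z x) = 0 →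
      ∫ x in (0 : ℝ)..L, η x * z x = -∫ x in (0 : ℝ)..L, g x * z x := by
  have hLp := hL.out
  have hc : Continuous (deriv φ) := hφ.smooth.continuous_deriv (by exact_mod_cast le_top)
  have hcL := memLp_of_continuous (L := L) hc
  have hS := hspec.integral_deriv_sq_pos hφ
  set S := ∫ x in (0 : ℝ)..L, deriv φ x ^ 2 with hSd
  -- The multiple of the kernel function φ' that makes −η + cφ' orthogonal to φ'.
  set c := (∫ x in (0 : ℝ)..L, η x * deriv φ x) / S with hcd
  set g₀ : ℝ → ℝ := fun x => (-1) * η x + c * deriv φ x with hg₀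
  have hg₀L : MemLp g₀ 2 (perMeasure L) := (hη.const_mul (-1)).add (hcL.const_mul c)
  have hlin : IsLin L f θ ω φ g₀ y :=
    (IsLin.combine hη hcL hηy hspec.zero_eigenvalue (-1) c).congr EventuallyEq.rfl
      (Eventually.of_forall fun x => by simp)
  have hint : ∀ z : ℝ → ℝ, MemLp z 2 (perMeasure L) → ∫ x in (0 : ℝ)..L, g₀ x * z x
      = -(∫ x in (0 : ℝ)..L, η x * z x) + c * ∫ x in (0 : ℝ)..L, deriv φ x * z x := by
    intro z hz
    have i1 : IntervalIntegrable (fun x => -(η x * z x)) volume 0 L :=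
      (intervalIntegrable_mul_of_memLp hLp hη hz).neg
    have i2 := intervalIntegrable_mul_of_memLp hLp hcL hz
    rw [← intervalIntegral.integral_neg, ← intervalIntegral.integral_const_mul (c),
      ← intervalIntegral.integral_add i1 (i2.const_mul c)]
    refine intervalIntegral.integral_congr fun x _ => ?_
    simp only [hg₀]
    ring
  let g : Hper L m := Hper.ofFun g₀ hg₀L (summable_of_isMul hLp hθ hg₀L hlin)
  have hg : ⇑g.toL2 =ᵐ[perMeasure L] g₀ := Hper.coe_ofFun _ _ _
  have hgint : ∀ z : ℝ → ℝ, ∫ x in (0 : ℝ)..L, g x * z x = ∫ x in (0 : ℝ)..L, g₀ x * z x := by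
    intro z
    refine integral_congr_per ?_
    filter_upwards [hg] with x hx
    rw [hx]
  have horth : ∫ x in (0 : ℝ)..L, g x * deriv φ x = 0 := by
    rw [hgint, hint _ hcL]
    have : ∫ x in (0 : ℝ)..L, deriv φ x * deriv φ x = S := by
      rw [hSd]
      simp only [sq]
    rw [this, hcd, div_mul_cancel₀ _ hS.ne']
    ring
  have hglin : IsLin L f θ ω φ g y := hlin.congr hg.symm EventuallyEq.rfl
  refine ⟨g, ⟨⟨horth, hglin⟩, fun h hh hhl => ?_⟩, fun z hz hz0 => ?_⟩
  -- Uniqueness: the difference of two solutions lies in the kernel, so it is Cφ', and orthogonality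
  -- to φ' forces C = 0.
  · have hd : IsLin L f θ ω φ (h - g).toL2 fun _ => 0 := by
      refine (IsLin.combine h.memLp g.memLp hhl hglin 1 (-1)).congr ?_
        (Eventually.of_forall fun x => by ring)
      filter_upwards [Hper.coe_sub h g] with x hx
      rw [hx]
      ring
    obtain ⟨C, hC⟩ := hspec.zero_simple (h - g) hd
    have h0 : ∫ x in (0 : ℝ)..L, (h - g).toL2 x * deriv φ x = 0 := by
      have i1 := intervalIntegrable_mul_of_memLp hLp h.memLp hcL
      have i2 := intervalIntegrable_mul_of_memLp hLp g.memLp hcL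
      have : ∫ x in (0 : ℝ)..L, (h - g).toL2 x * deriv φ x
          = (∫ x in (0 : ℝ)..L, h x * deriv φ x) - ∫ x in (0 : ℝ)..L, g x * deriv φ x := by
        rw [← intervalIntegral.integral_sub i1 i2]
        refine integral_congr_per ?_
        filter_upwards [Hper.coe_sub h g] with x hx
        rw [hx]
        ring
      rw [this, hh, horth, sub_zero]
    have h1 : ∫ x in (0 : ℝ)..L, (h - g).toL2 x * deriv φ x = C * S := by
      rw [hSd, ← intervalIntegral.integral_const_mul (C)]
      refine integral_congr_per ?_
      filter_upwards [hC] with x hx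
      rw [hx]
      ring
    have hC0 : C = 0 := by
      rw [h1, mul_eq_zero] at h0
      exact h0.resolve_right hS.ne'
    refine Hper.ext_ae ?_
    filter_upwards [hC, Hper.coe_sub h g] with x h2 h3
    rw [h3, hC0, zero_mul] at h2
    linarith
  · rw [hgint, hint z hz, hz0]
    ring

/-- The operator `𝓛` is symmetric. -/
theorem integral_mul_comm_of_isLin (hθ : IsSymbol θ m) (hp : Continuous fun x => ω - deriv f (φ x))
    {u v g h : ℝ → ℝ} (hu : MemLp u 2 (perMeasure L)) (hv : MemLp v 2 (perMeasure L))
    (hug : IsLin L f θ ω φ u g) (hvh : IsLin L f θ ω φ v h) :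
    ∫ x in (0 : ℝ)..L, g x * v x = ∫ x in (0 : ℝ)..L, h x * u x := by
  have hLp := hL.out
  let U : Hper L (m / 2) := Hper.ofFun u hu
    (summable_half hθ.pos.le (summable_of_isMul hLp hθ hu hug))
  let V : Hper L (m / 2) := Hper.ofFun v hv
    (summable_half hθ.pos.le (summable_of_isMul hLp hθ hv hvh))
  have hU : ⇑U.toL2 =ᵐ[perMeasure L] u := Hper.coe_ofFun _ _ _
  have hV : ⇑V.toL2 =ᵐ[perMeasure L] v := Hper.coe_ofFun _ _ _
  have h1 := opForm_eq_of_isLin hp U V (hug.congr hU.symm EventuallyEq.rfl)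
  have h2 := opForm_eq_of_isLin hp V U (hvh.congr hV.symm EventuallyEq.rfl)
  have h3 : opForm L θ (fun x => ω - deriv f (φ x)) U V
      = opForm L θ (fun x => ω - deriv f (φ x)) V U := by
    rw [opForm, opForm, mulForm_symm]
    congr 1
    refine intervalIntegral.integral_congr fun x _ => ?_
    ring
  have h4 : ∫ x in (0 : ℝ)..L, g x * V x = ∫ x in (0 : ℝ)..L, g x * v x := by
    refine integral_congr_per ?_
    filter_upwards [hV] with x hx
    rw [hx]
  have h5 : ∫ x in (0 : ℝ)..L, h x * U x = ∫ x in (0 : ℝ)..L, h x * u x := by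
    refine integral_congr_per ?_
    filter_upwards [hU] with x hx
    rw [hx]
  rw [← h4, ← h5, ← h1, ← h2, h3]

end inverse

/-! ### Parameter derivatives of the waves and the stability criterion -/

section surface

variable {L m : ℝ} [hL : Fact (0 < L)] {f θ : ℝ → ℝ} {O : Set (ℝ × ℝ)} {φ : ℝ → ℝ → ℝ → ℝ}
  {ω A : ℝ}

/-- The derivatives of the waves with respect to the parameters. -/
theorem IsWaveSurface.derivatives (hφ : IsWaveSurface L f θ m O φ) (hf : ContDiff ℝ (⊤ : ℕ∞) f)
    (hmem : (ω, A) ∈ O) :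
    (Continuous fun x => deriv (fun y => φ y A x) ω) ∧
    (Continuous fun x => deriv (fun y => φ ω y x) A) ∧
    IsLin L f θ ω (φ ω A) (fun x => deriv (fun y => φ y A x) ω) (fun x => -φ ω A x) ∧
    IsLin L f θ ω (φ ω A) (fun x => deriv (fun y => φ ω y x) A) (fun _ => -1) ∧
    Fω L φ ω A = (∫ x in (0 : ℝ)..L, φ ω A x * deriv (fun y => φ y A x) ω) ∧
    FA L φ ω A = ∫ x in (0 : ℝ)..L, φ ω A x * deriv (fun y => φ ω y x) A := by
  have hLp := hL.out
  set I₁ : Set ℝ := {y | (y, A) ∈ O} with hI₁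
  set I₂ : Set ℝ := {y | (ω, y) ∈ O} with hI₂
  have o₁ : IsOpen I₁ := hφ.isOpen.preimage (by fun_prop)
  have o₂ : IsOpen I₂ := hφ.isOpen.preimage (by fun_prop)
  have s₁ : ContDiffOn ℝ 1 (fun p : ℝ × ℝ => φ p.1 A p.2) (I₁ ×ˢ univ) :=
    (hφ.smooth.of_le (by exact_mod_cast le_top)).comp (f := fun p : ℝ × ℝ => ((p.1, A), p.2))
      (by fun_prop) fun p hp => ⟨hp.1, mem_univ _⟩
  have s₂ : ContDiffOn ℝ 1 (fun p : ℝ × ℝ => φ ω p.1 p.2) (I₂ ×ˢ univ) :=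
    (hφ.smooth.of_le (by exact_mod_cast le_top)).comp (f := fun p : ℝ × ℝ => ((ω, p.1), p.2))
      (by fun_prop) fun p hp => ⟨hp.1, mem_univ _⟩
  have m₁ : ω ∈ I₁ := hmem
  have m₂ : A ∈ I₂ := hmem
  have l₁ := isLin_deriv (ψ := fun y x => φ y A x) (w := fun y => y) (α := fun _ => A) (w' := 1)
    (α' := 0) hLp o₁ s₁ hf contDiff_id contDiff_const (fun y hy => hφ.wave (y, A) hy) m₁
    (hasDerivAt_id ω) (hasDerivAt_const ω A)
  have l₂ := isLin_deriv (ψ := fun y x => φ ω y x) (w := fun _ => ω) (α := fun y => y) (w' := 0)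
    (α' := 1) hLp o₂ s₂ hf contDiff_const contDiff_id (fun y hy => hφ.wave (ω, y) hy) m₂
    (hasDerivAt_const A ω) (hasDerivAt_id A)
  refine ⟨continuous_deriv_left o₁ s₁ m₁, continuous_deriv_left o₂ s₂ m₂, ?_, ?_, ?_, ?_⟩
  · simpa using l₁
  · simpa using l₂
  · rw [Fω, ← intervalIntegral.integral_const_mul (1 / 2 : ℝ)]
    refine intervalIntegral.integral_congr fun x _ => ?_
    have h := ((hasDerivAt_left (ψ := fun y x => φ y A x) o₁ s₁ m₁ x).differentiableAt.hasDerivAt.pow 2).deriv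
    have h' : deriv (fun y => φ y A x ^ 2) ω
        = ((2 : ℕ) : ℝ) * φ ω A x ^ (2 - 1) * deriv (fun y => φ y A x) ω := h
    rw [h']
    norm_num
    ring
  · rw [FA, ← intervalIntegral.integral_const_mul (1 / 2 : ℝ)]
    refine intervalIntegral.integral_congr fun x _ => ?_
    have h := ((hasDerivAt_left (ψ := fun y x => φ ω y x) o₂ s₂ m₂ x).differentiableAt.hasDerivAt.pow 2).deriv
    have h' : deriv (fun y => φ ω y x ^ 2) A
        = ((2 : ℕ) : ℝ) * φ ω A x ^ (2 - 1) * deriv (fun y => φ ω y x) A := h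
    rw [h']
    norm_num
    ring

/-- Symmetry of 𝓛: (φ, ∂_Aφ) = −(𝓛∂_ωφ, ∂_Aφ) = −(∂_ωφ, 𝓛∂_Aφ) = (∂_ωφ, 1). -/
theorem IsWaveSurface.FA_eq_Mω (hφ : IsWaveSurface L f θ m O φ) (hθ : IsSymbol θ m)
    (hf : ContDiff ℝ (⊤ : ℕ∞) f) (hmem : (ω, A) ∈ O) : FA L φ ω A = Mω L φ ω A := by
  obtain ⟨c₁, c₂, l₁, l₂, -, e₂⟩ := hφ.derivatives hf hmem
  have cφ := (hφ.wave _ hmem).smooth.continuous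
  have cf' : Continuous (deriv f) := hf.continuous_deriv (by exact_mod_cast le_top)
  have h := integral_mul_comm_of_isLin hθ (continuous_const.sub (cf'.comp cφ))
    (memLp_of_continuous c₁) (memLp_of_continuous c₂) l₁ l₂
  simp only [neg_mul, one_mul, intervalIntegral.integral_neg, neg_inj] at h
  rw [e₂, Mω, h]

/-- Stability of a wave at which the quadratic form `Δ` takes a positive value. -/
theorem IsWaveSurface.orbitallyStable {s : ℝ} (hφ : IsWaveSurface L f θ m O φ)
    (hf : ContDiff ℝ (⊤ : ℕ∞) f) (hθ : IsSymbol θ m)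
    (hE : m ≤ 1 → PotentialEnergyC2 L f (m / 2)) (hs : m / 2 ≤ s)
    (hwp : IsGloballyWellPosed L f θ s) (hmem : (ω, A) ∈ O) {a b : ℝ}
    (hΔ : 0 < Delta L φ ω A a b) : OrbitallyStable L f θ m s (φ ω A) := by
  have hLp := hL.out
  obtain ⟨c₁, c₂, l₁, l₂, e₁, e₂⟩ := hφ.derivatives hf hmem
  have hw : IsPeriodicWave L f θ ω A (φ ω A) := hφ.wave _ hmem
  have cφ := hw.smooth.continuous
  have cf' : Continuous (deriv f) := hf.continuous_deriv (by exact_mod_cast le_top)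
  have hφL := memLp_of_continuous (L := L) cφ
  set η₁ : ℝ → ℝ := fun x => deriv (fun y => φ y A x) ω with hη₁
  set η₂ : ℝ → ℝ := fun x => deriv (fun y => φ ω y x) A with hη₂
  -- The same combination of the two linearized equations produces y = a + bφ, the gradient at φ of
  -- aM + bF. Thus η is the vector required by the coercivity criterion, and (y,η) is Δ(a,b).
  have hlin : IsLin L f θ ω (φ ω A) (fun x => a * η₂ x + b * η₁ x)
      fun x => -(a + b * φ ω A x) := by
    refine (IsLin.combine (memLp_of_continuous c₂) (memLp_of_continuous c₁) l₂ l₁ a b).congr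
      EventuallyEq.rfl (Eventually.of_forall fun x => ?_)
    ring
  have hy : Continuous fun x => a + b * φ ω A x := continuous_const.add (continuous_const.mul cφ)
  have hη : Continuous fun x => a * η₂ x + b * η₁ x :=
    (continuous_const.mul c₂).add (continuous_const.mul c₁)
  have hint : ∫ x in (0 : ℝ)..L, (a + b * φ ω A x) * (a * η₂ x + b * η₁ x)
      = Delta L φ ω A a b := by
    have i₁ := c₁.intervalIntegrable (μ := volume) 0 L
    have i₂ := c₂.intervalIntegrable (μ := volume) 0 L
    have i₃ : IntervalIntegrable (fun x => φ ω A x * η₁ x) volume 0 L :=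
      (cφ.mul c₁).intervalIntegrable 0 L
    have i₄ : IntervalIntegrable (fun x => φ ω A x * η₂ x) volume 0 L :=
      (cφ.mul c₂).intervalIntegrable 0 L
    have i₅ := (i₁.const_mul (a * b)).add (i₄.const_mul (a * b))
    have i₆ := (i₂.const_mul (a ^ 2)).add i₅
    simp only [hη₁, hη₂] at i₁ i₂ i₃ i₄ i₅ i₆
    rw [Delta, e₁, e₂, MA, Mω, mul_add, ← intervalIntegral.integral_const_mul (a ^ 2),
      ← intervalIntegral.integral_const_mul (a * b), ← intervalIntegral.integral_const_mul (a * b),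
      ← intervalIntegral.integral_const_mul (b ^ 2),
      ← intervalIntegral.integral_add (i₁.const_mul _) (i₄.const_mul _),
      ← intervalIntegral.integral_add (i₂.const_mul _) i₅,
      ← intervalIntegral.integral_add i₆ (i₃.const_mul _)]
    refine intervalIntegral.integral_congr fun x _ => ?_
    simp only [hη₁, hη₂]
    ring
  obtain ⟨K, c, e, hK, hc, he, hcoer⟩ := exists_coercive_opForm hθ
    (continuous_const.sub (cf'.comp cφ)) (hw.smooth.continuous_deriv (by exact_mod_cast le_top))
    hw.periodic_deriv (hφ.spectral _ hmem) (memLp_of_continuous hy) (memLp_of_continuous hη) hlin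
    (by rwa [hint])
  let Φ : Hper L (m / 2) := Hper.ofFun (φ ω A) hφL
    (summable_half hθ.pos.le (summable_of_isMul hLp hθ hφL hw.equation))
  exact orbitallyStable_of_coercive hθ hf hE hs hwp hw (Φ := Φ) (Hper.coe_ofFun _ _ _) he hK hc
    hcoer

end surface

end PeriodicWaves

end

/-! ### Choice of (a, b) and the formulas for the inverse -/

theorem theorem4p1 (L : ℝ) [Fact (0 < L)] (f θ : ℝ → ℝ) (m s : ℝ)
    (hf : ContDiff ℝ (⊤ : ℕ∞) f) (hθ : PeriodicWaves.IsSymbol θ m)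
    (hE : m ≤ 1 → PeriodicWaves.PotentialEnergyC2 L f (m / 2))
    (hs : m / 2 ≤ s) (hwp : PeriodicWaves.IsGloballyWellPosed L f θ s)
    (O : Set (ℝ × ℝ)) (φ : ℝ → ℝ → ℝ → ℝ) (hφ : PeriodicWaves.IsWaveSurface L f θ m O φ)
    (ω A : ℝ) (hmem : (ω, A) ∈ O)
    (hG : PeriodicWaves.GardingInequality L f θ m ω (φ ω A)) :
    ((∃ a b : ℝ, 0 < PeriodicWaves.Delta L φ ω A a b) →
      PeriodicWaves.OrbitallyStable L f θ m s (φ ω A)) ∧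
    (0 < PeriodicWaves.MA L φ ω A → PeriodicWaves.OrbitallyStable L f θ m s (φ ω A)) ∧
    (0 < PeriodicWaves.Fω L φ ω A → PeriodicWaves.OrbitallyStable L f θ m s (φ ω A)) ∧
    (0 < PeriodicWaves.Mω L φ ω A ^ 2 - PeriodicWaves.Fω L φ ω A * PeriodicWaves.MA L φ ω A →
      PeriodicWaves.OrbitallyStable L f θ m s (φ ω A)) ∧
    PeriodicWaves.FA L φ ω A = PeriodicWaves.Mω L φ ω A ∧
    (∃ g h : PeriodicWaves.Hper L m,
      PeriodicWaves.IsLinInv L f θ m ω (φ ω A) (fun _ => 1) g ∧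
      PeriodicWaves.IsLinInv L f θ m ω (φ ω A) (φ ω A) h ∧
      PeriodicWaves.MA L φ ω A = -(∫ x in (0 : ℝ)..L, g x) ∧
      PeriodicWaves.Fω L φ ω A = -(∫ x in (0 : ℝ)..L, h x * φ ω A x) ∧
      PeriodicWaves.Mω L φ ω A = -(∫ x in (0 : ℝ)..L, h x)) := by
  have hLp : 0 < L := Fact.out
  have hm0 := hθ.pos
  have hstab : ∀ a b : ℝ, 0 < PeriodicWaves.Delta L φ ω A a b →
      PeriodicWaves.OrbitallyStable L f θ m s (φ ω A) := fun a b hab =>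
    hφ.orbitallyStable hf hθ hE hs hwp hmem hab
  have hFA := hφ.FA_eq_Mω hθ hf hmem
  refine ⟨fun ⟨a, b, hab⟩ => hstab a b hab, fun h => hstab 1 0 ?_, fun h => hstab 0 1 ?_,
    fun h => ?_, hFA, ?_⟩
  · simpa [PeriodicWaves.Delta] using h
  · simpa [PeriodicWaves.Delta] using h
  · by_cases hMA : PeriodicWaves.MA L φ ω A = 0
    · rw [hMA, mul_zero, sub_zero] at h
      have hM : PeriodicWaves.Mω L φ ω A ≠ 0 := fun h0 => by
        rw [h0] at h
        simp at h
      -- When M_A = 0, Δ(a, 1) = 2aM_ω + F_ω is affine in a; this a gives it the value 1.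
      refine hstab ((1 - PeriodicWaves.Fω L φ ω A) / (2 * PeriodicWaves.Mω L φ ω A)) 1 ?_
      rw [PeriodicWaves.Delta, hMA, hFA]
      have : (1 - PeriodicWaves.Fω L φ ω A) / (2 * PeriodicWaves.Mω L φ ω A)
          * (2 * PeriodicWaves.Mω L φ ω A) = 1 - PeriodicWaves.Fω L φ ω A :=
        div_mul_cancel₀ _ (mul_ne_zero two_ne_zero hM)
      linarith
    · rcases lt_or_gt_of_ne hMA with hneg | hpos
      -- When M_A < 0, this is the maximum point of the concave quadratic a ↦ Δ(a, 1).
      · refine hstab (-PeriodicWaves.Mω L φ ω A / PeriodicWaves.MA L φ ω A) 1 ?_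
        have e : PeriodicWaves.Delta L φ ω A (-PeriodicWaves.Mω L φ ω A
            / PeriodicWaves.MA L φ ω A) 1 = (PeriodicWaves.Mω L φ ω A ^ 2
              - PeriodicWaves.Fω L φ ω A * PeriodicWaves.MA L φ ω A)
                / (-PeriodicWaves.MA L φ ω A) := by
          rw [PeriodicWaves.Delta, hFA]
          field_simp
          ring
        rw [e]
        exact div_pos h (by linarith)
      · refine hstab 1 0 ?_
        simpa [PeriodicWaves.Delta] using hpos
  · obtain ⟨c₁, c₂, l₁, l₂, e₁, e₂⟩ := hφ.derivatives hf hmem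
    have hw : PeriodicWaves.IsPeriodicWave L f θ ω A (φ ω A) := hφ.wave _ hmem
    have hsp : PeriodicWaves.SpectralCondition L f θ m ω (φ ω A) := hφ.spectral _ hmem
    have cφ := hw.smooth.continuous
    have cφ' : Continuous (deriv (φ ω A)) :=
      hw.smooth.continuous_deriv (by exact_mod_cast le_top)
    have dφ : ∀ x, HasDerivAt (φ ω A) (deriv (φ ω A) x) x := fun x =>
      (hw.smooth.differentiable (by simp) x).hasDerivAt
    -- Both 1 and φ are orthogonal to φ', so projecting off the kernel does not change pairings with
    -- them.
    have o₁ : ∫ x in (0 : ℝ)..L, deriv (φ ω A) x * 1 = 0 := by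
      simpa using PeriodicWaves.integral_eq_zero_of_hasDerivAt_periodic hw.periodic dφ cφ'
    have o₂ : ∫ x in (0 : ℝ)..L, deriv (φ ω A) x * φ ω A x = 0 := by
      refine PeriodicWaves.integral_eq_zero_of_hasDerivAt_periodic (g := fun x => 1 / 2 * φ ω A x ^ 2)
        (fun x => by simp only [hw.periodic x]) (fun x => ?_) (cφ'.mul cφ)
      refine (((dφ x).pow 2).const_mul (1 / 2 : ℝ)).congr_deriv ?_
      norm_num
      ring
    have m1 := PeriodicWaves.memLp_of_continuous (L := L) (continuous_const (y := (1 : ℝ)))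
    have mφ := PeriodicWaves.memLp_of_continuous (L := L) cφ
    obtain ⟨g, hg, hg'⟩ := PeriodicWaves.exists_isLinInv (y := fun _ => 1) hθ hw hsp
      (PeriodicWaves.memLp_of_continuous c₂) l₂
    obtain ⟨h, hh, hh'⟩ := PeriodicWaves.exists_isLinInv hθ hw hsp
      (PeriodicWaves.memLp_of_continuous c₁) l₁
    refine ⟨g, h, hg, hh, ?_, ?_, ?_⟩
    · simpa [PeriodicWaves.MA] using hg' (fun _ => 1) m1 o₁
    · rw [e₁, ← hh' _ mφ o₂]
      simp only [mul_comm]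
    · simpa [PeriodicWaves.Mω] using hh' (fun _ => 1) m1 o₁
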